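/- Let $R$ be a commutative ring, $H$ an $R$-bialgebra, $A$ a right $H$-comodule algebra (an $R$-algebra with a coassociative counital coaction $a\mapsto\sum a_{0}\otimes a_{1}\in A\otimes_R H$ that is an algebra map) and $C$ a right $H$-module coalgebra (a coassociative counital $R$-coalgebra with a right $H$-module structure $C\otimes_R H\to C$ that is a coalgebra map); that is, $(H,A,C)$ is a right-right Doi-Koppinen structure. Let $\mathcal{M}(H)_A^C$ be the category of right $A$-modules $M$ with a right $C$-comodule structure $m\mapsto\sum m_0\otimes m_1$ such that $ma\mapsto\sum m_0a_0\otimes m_1a_1$ for all $m\in M$, $a\in A$, with the $A$-linear $C$-colinear maps. Let $\mathcal{C}=A\otimes_R C$ be the associated $A$-coring, with bimodule structure $b(a\otimes c)=ba\otimes c$, $(a\otimes c)b=\sum ab_0\otimes cb_1$, comultiplication $a\otimes c\mapsto\sum(a\otimes c_1)\otimes_A(1\otimes c_2)$ and counit $a\otimes c\mapsto a\varepsilon(c)$. Its left dual ${}^*\mathcal{C}$ (left $A$-linear maps $\mathcal{C}\to A$) is an $A$-ring with $(af)(w)=f(wa)$, $(fa)(w)=f(w)a$, $(f\star g)(w)=\sum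 g(w_1f(w_2))$ and unity $\varepsilon_{\mathcal{C}}$, and it acts on $\mathcal{C}$ from the right by $w\leftharpoonup f=\sum w_1f(w_2)$. Here an $A$-ring, not necessarily with unity, is an $A$-bimodule with an associative, $A$-bilinear and $A$-balanced multiplication. A right module over an $A$-ring $B$ is a right $A$-module with an associative, $A$-linear and $A$-balanced right action of $B$; $\mathcal{M}_B$ is the category of those with $MB=M$. For a right $B$-module $K$, $\sigma[K_B]\subseteq\mathcal{M}_B$ is the full subcategory of the $K$-subgenerated modules, i.e. those isomorphic to a submodule of an epimorphic image of a direct sum of copies of $K$. A measuring left $A$-pairing $(B,\mathcal{C})$ is given by a morphism of $A$-rings $\kappa:B\to{}^*\mathcal{C}$ that maps the unity of $B$, if there is one, to that of ${}^*\mathcal{C}$; it is an $\alpha$-pairing if for every right $A$-module $M$ the map $M\otimes_A\mathcal{C}\to\mathrm{Hom}_{-A}(B,M)$, $m\otimes w\mapsto[x\mapsto m\,\kappa(x)(w)]$, is injective. Density refers to the finite topology (pointwise convergence with discrete values). Let $\#^{op}(C,A)=\mathrm{Hom}_R(C,A)$ be the $A$-ring with $(af)(c)=\sum a_0f(ca_1)$,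 $(fa)(c)=f(c)a$, $(f\cdot g)(c)=\sum f(c_2)_0\,g(c_1f(c_2)_1)$; it acts on $\mathcal{C}$ through $\varphi:\#^{op}(C,A)\to{}^*\mathcal{C}$, $f\mapsto[a\otimes c\mapsto af(c)]$, and on $M\in\mathcal{M}(H)_A^C$ by $mf=\sum m_0f(m_1)$. The dual $C^*=\mathrm{Hom}_R(C,R)$ has the convolution product $(f\star g)(c)=\sum f(c_1)g(c_2)$ and the left $H$-action $(hf)(c)=f(ch)$. For a left $H$-module subalgebra $T\subseteq C^*$ (an $R$-submodule closed under $\star$ and under $H$, not necessarily containing $\varepsilon_C$) let $A\#^{op}T=A\otimes_R T$ be the $A$-ring with $b(a\#f)=\sum b_0a\#b_1f$, $(a\#f)b=ab\#f$, $(a\#f)(b\#g)=\sum a_0b\#(a_1g)\star f$; there is a morphism of $A$-rings $\beta:A\#^{op}T\to\#^{op}(C,A)$, $a\#f\mapsto[c\mapsto af(c)]$, and $A\#^{op}T$ acts on $\mathcal{C}$ through $\kappa=\varphi\circ\beta$. 1. If ${}_RC$ is flat, then $\mathcal{M}(H)_A^C$ is a Grothendieck category with enough injective objects. 2. Let ${}_RC$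 be locally projective: for every $R$-linear epimorphism $\pi:L\to N$, every $R$-linear $g:C\to N$ and every finitely generated submodule $F\subseteq C$ there is an $R$-linear $g':C\to L$ with $\pi\circ g'=g$ on $F$. Let $T\subseteq C^*$ be a dense left $H$-module subalgebra that is $A$-pure, i.e. $A\otimes_RT\to A\otimes_RC^*$ is injective. Then $\beta(A\#^{op}T)\subseteq\#^{op}(C,A)$ is dense, $(A\#^{op}T,\mathcal{C})$ with $\kappa$ is a measuring left $\alpha$-pairing, and $$\mathcal{M}(H)_A^C\simeq\sigma[\mathcal{C}_{\#^{op}(C,A)}]=\sigma[\mathcal{C}_{A\#^{op}T}]:$$ the functor $M\mapsto M$ with $mf=\sum m_0f(m_1)$ is an isomorphism of categories onto $\sigma[\mathcal{C}_{\#^{op}(C,A)}]$, and restriction of scalars along $\beta$ is an isomorphism of categories $\sigma[\mathcal{C}_{\#^{op}(C,A)}]\to\sigma[\mathcal{C}_{A\#^{op}T}]$. 3. If ${}_RC$ is finitely generated and projective, then the same functors give isomorphisms of categories $$\mathcal{M}(H)_A^C\simeq\mathcal{M}_{\#^{op}(C,A)}\simeq\mathcal{M}_{A\#^{op}C^*}.$$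 -/

import Mathlib

open TensorProduct MulOpposite CategoryTheory

universe u


noncomputable section

/-! ### Tensor products over a noncommutative algebra

Here `A` is an algebra over a commutative ring `R`. Right `A`-modules are modules over `Aᵐᵒᵖ`. -/

section ATensor

variable (R A M N : Type*) [CommRing R] [Ring A] [Algebra R A]
  [AddCommGroup M] [Module R M] [Module Aᵐᵒᵖ M] [AddCommGroup N] [Module R N] [Module A N]

/-- The relations `m a ⊗ n = m ⊗ a n` in `M ⊗[R] N`. -/
def ATensor.relations : Submodule R (M ⊗[R] N) :=
  Submodule.span R (Set.range fun p : M × A × N =>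
    (op p.2.1 • p.1) ⊗ₜ[R] p.2.2 - p.1 ⊗ₜ[R] (p.2.1 • p.2.2))

/-- The tensor product `M ⊗_A N` of a right `A`-module and a left `A`-module. -/
def ATensor : Type _ := (M ⊗[R] N) ⧸ ATensor.relations R A M N

instance : AddCommGroup (ATensor R A M N) :=
  inferInstanceAs (AddCommGroup ((M ⊗[R] N) ⧸ ATensor.relations R A M N))

instance : Module R (ATensor R A M N) :=
  inferInstanceAs (Module R ((M ⊗[R] N) ⧸ ATensor.relations R A M N))

end ATensor

namespace ATensor

variable {R A M N P M' N' L W : Type*} [CommRing R] [Ring A] [Algebra R A]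
  [AddCommGroup M] [Module R M] [Module Aᵐᵒᵖ M] [AddCommGroup N] [Module R N] [Module A N]
  [AddCommGroup M'] [Module R M'] [Module Aᵐᵒᵖ M'] [AddCommGroup N'] [Module R N'] [Module A N']
  [AddCommGroup P] [Module R P]

variable (R A) in
/-- The pure tensor `m ⊗ n` in `M ⊗_A N`. -/
def tmul (m : M) (n : N) : ATensor R A M N := Submodule.Quotient.mk (m ⊗ₜ[R] n)

variable (R A M N) in
/-- The canonical bilinear map `M × N → M ⊗_A N`. -/
def mk : M →ₗ[R] N →ₗ[R] ATensor R A M N :=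
  LinearMap.compr₂ (TensorProduct.mk R M N) (Submodule.mkQ (relations R A M N))

@[simp] theorem mk_apply (m : M) (n : N) : mk R A M N m n = tmul R A m n := rfl

theorem tmul_add (m : M) (n n' : N) :
    tmul R A m (n + n') = tmul R A m n + tmul R A m n' := (mk R A M N m).map_add n n'

theorem add_tmul (m m' : M) (n : N) :
    tmul R A (m + m') n = tmul R A m n + tmul R A m' n := by
  simp [← mk_apply]

@[simp] theorem zero_tmul (n : N) : tmul R A (0 : M) n = 0 := by
  simp [← mk_apply]

@[simp] theorem tmul_zero (m : M) : tmul R A m (0 : N) = 0 :=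
  (mk R A M N m).map_zero

theorem rsmul_tmul (r : R) (m : M) (n : N) : tmul R A (r • m) n = r • tmul R A m n := by
  simp [← mk_apply]

theorem tmul_rsmul (r : R) (m : M) (n : N) : tmul R A m (r • n) = r • tmul R A m n :=
  (mk R A M N m).map_smul r n

theorem smul_tmul (a : A) (m : M) (n : N) :
    tmul R A (op a • m) n = tmul R A m (a • n) :=
  (Submodule.Quotient.eq _).2 (Submodule.subset_span ⟨(m, a, n), rfl⟩)

theorem induction {p : ATensor R A M N → Prop} (t : ATensor R A M N)
    (h0 : p 0) (h1 : ∀ m n, p (tmul R A m n)) (h2 : ∀ s t, p s → p t → p (s + t)) : p t := by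
  obtain ⟨t, rfl⟩ := Submodule.Quotient.mk_surjective _ t
  induction t with
  | zero => exact h0
  | tmul m n => exact h1 m n
  | add s t hs ht => exact h2 _ _ hs ht

/-- The linear map `M ⊗_A N → P` given by a balanced bilinear map. -/
def lift (f : M →ₗ[R] N →ₗ[R] P) (h : ∀ m (a : A) n, f (op a • m) n = f m (a • n)) :
    ATensor R A M N →ₗ[R] P :=
  Submodule.liftQ _ (TensorProduct.lift f) (by
    rw [relations, Submodule.span_le]
    rintro _ ⟨p, rfl⟩
    simp [h])

@[simp] theorem lift_tmul (f : M →ₗ[R] N →ₗ[R] P)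
    (h : ∀ m (a : A) n, f (op a • m) n = f m (a • n)) (m : M) (n : N) :
    lift f h (tmul R A m n) = f m n := rfl

theorem hom_ext {f g : ATensor R A M N →ₗ[R] P}
    (h : ∀ m n, f (tmul R A m n) = g (tmul R A m n)) : f = g := by
  ext t
  induction t using ATensor.induction with
  | h0 => simp
  | h1 m n => exact h m n
  | h2 s t hs ht => simp [hs, ht]

/-- The map `f ⊗ g` for a right `A`-linear `f` and a left `A`-linear `g`. -/
def map (f : M →ₗ[R] M') (hf : ∀ (a : A) m, f (op a • m) = op a • f m)
    (g : N →ₗ[R] N') (hg : ∀ (a : A) n, g (a • n) = a • g n) :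
    ATensor R A M N →ₗ[R] ATensor R A M' N' :=
  lift ((mk R A M' N').compl₁₂ f g) (fun m a n => by simp [hf, hg, smul_tmul])

@[simp] theorem map_tmul (f : M →ₗ[R] M') (hf : ∀ (a : A) m, f (op a • m) = op a • f m)
    (g : N →ₗ[R] N') (hg : ∀ (a : A) n, g (a • n) = a • g n) (m : M) (n : N) :
    map f hf g hg (tmul R A m n) = tmul R A (f m) (g n) := rfl

section Bimodule

variable [Module A M] [IsScalarTower R A M] [SMulCommClass A Aᵐᵒᵖ M]

/-- For an `A`-bimodule `M`, the left `A`-action `a (m ⊗ n) = a m ⊗ n`. -/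
instance : SMul A (ATensor R A M N) where
  smul a := map (Algebra.lsmul R R M a) (fun b m => smul_comm a (op b) m)
    LinearMap.id (fun _ _ => rfl)

@[simp] theorem smul_tmul_left (a : A) (m : M) (n : N) :
    a • tmul R A m n = tmul R A (a • m) n := rfl

theorem lsmul_add (a : A) (s t : ATensor R A M N) : a • (s + t) = a • s + a • t :=
  LinearMap.map_add (map (Algebra.lsmul R R M a) _ LinearMap.id _) s t

theorem lsmul_zero (a : A) : a • (0 : ATensor R A M N) = 0 :=
  LinearMap.map_zero (map (Algebra.lsmul R R M a) _ LinearMap.id _)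

theorem lsmul_rsmul (a : A) (r : R) (t : ATensor R A M N) : a • r • t = r • a • t :=
  LinearMap.map_smul (map (Algebra.lsmul R R M a) _ LinearMap.id _) r t

instance : Module A (ATensor R A M N) where
  smul_zero := lsmul_zero
  smul_add := lsmul_add
  one_smul t := by
    induction t using ATensor.induction with
    | h0 => exact lsmul_zero _
    | h1 m n => simp
    | h2 s t hs ht => rw [lsmul_add, hs, ht]
  mul_smul a b t := by
    induction t using ATensor.induction with
    | h0 => simp [lsmul_zero]
    | h1 m n => simp [mul_smul]
    | h2 s t hs ht => simp [lsmul_add, hs, ht]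
  add_smul a b t := by
    induction t using ATensor.induction with
    | h0 => simp [lsmul_zero]
    | h1 m n => simp [add_smul, add_tmul]
    | h2 s t hs ht => simp only [lsmul_add, hs, ht]; abel
  zero_smul t := by
    induction t using ATensor.induction with
    | h0 => exact lsmul_zero _
    | h1 m n => simp
    | h2 s t hs ht => rw [lsmul_add, hs, ht, add_zero]

instance : IsScalarTower R A (ATensor R A M N) where
  smul_assoc r a t := by
    induction t using ATensor.induction with
    | h0 => simp
    | h1 m n => simp [rsmul_tmul]
    | h2 s t hs ht => simp only [smul_add, hs, ht]

end Bimodule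

section Bimodule

variable [Module Aᵐᵒᵖ N] [IsScalarTower R Aᵐᵒᵖ N] [SMulCommClass A Aᵐᵒᵖ N]

/-- For an `A`-bimodule `N`, the right `A`-action `(m ⊗ n) a = m ⊗ n a`. -/
instance : SMul Aᵐᵒᵖ (ATensor R A M N) where
  smul a := map LinearMap.id (fun _ _ => rfl)
    (Algebra.lsmul R R N a) (fun b n => (smul_comm b a n).symm)

@[simp] theorem op_smul_tmul (a : Aᵐᵒᵖ) (m : M) (n : N) :
    a • tmul R A m n = tmul R A m (a • n) := rfl

theorem rsmul_add (a : Aᵐᵒᵖ) (s t : ATensor R A M N) : a • (s + t) = a • s + a • t :=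
  LinearMap.map_add (map LinearMap.id _ (Algebra.lsmul R R N a) _) s t

theorem rsmul_zero (a : Aᵐᵒᵖ) : a • (0 : ATensor R A M N) = 0 :=
  LinearMap.map_zero (map LinearMap.id _ (Algebra.lsmul R R N a) _)

instance : Module Aᵐᵒᵖ (ATensor R A M N) where
  smul_zero := rsmul_zero
  smul_add := rsmul_add
  one_smul t := by
    induction t using ATensor.induction with
    | h0 => exact rsmul_zero _
    | h1 m n => simp
    | h2 s t hs ht => rw [rsmul_add, hs, ht]
  mul_smul a b t := by
    induction t using ATensor.induction with
    | h0 => simp [rsmul_zero]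
    | h1 m n => simp [mul_smul]
    | h2 s t hs ht => simp [rsmul_add, hs, ht]
  add_smul a b t := by
    induction t using ATensor.induction with
    | h0 => simp [rsmul_zero]
    | h1 m n => simp [add_smul, tmul_add]
    | h2 s t hs ht => simp only [rsmul_add, hs, ht]; abel
  zero_smul t := by
    induction t using ATensor.induction with
    | h0 => exact rsmul_zero _
    | h1 m n => simp
    | h2 s t hs ht => rw [rsmul_add, hs, ht, add_zero]

instance : IsScalarTower R Aᵐᵒᵖ (ATensor R A M N) where
  smul_assoc r a t := by
    induction t using ATensor.induction with
    | h0 => simp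
    | h1 m n => simp [tmul_rsmul]
    | h2 s t hs ht => simp only [smul_add, hs, ht]

end Bimodule

variable [AddCommGroup W] [Module R W] [Module A W] [Module Aᵐᵒᵖ W]
  [IsScalarTower R A W] [IsScalarTower R Aᵐᵒᵖ W] [SMulCommClass A Aᵐᵒᵖ W]

/-- The map `m ⊗ w ↦ m ⊗ (w ⊗ n)`, linear in `n`. -/
def assocAux : N →ₗ[R] ATensor R A M W →ₗ[R] ATensor R A M (ATensor R A W N) where
  toFun n := lift ((mk R A M (ATensor R A W N)).compl₁₂ LinearMap.id ((mk R A W N).flip n))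
    (fun m a w => smul_tmul a m (tmul R A w n))
  map_add' n n' := hom_ext fun m w => by
    change tmul R A m (tmul R A w (n + n')) =
      tmul R A m (tmul R A w n) + tmul R A m (tmul R A w n')
    rw [tmul_add, tmul_add]
  map_smul' r n := hom_ext fun m w => by
    change tmul R A m (tmul R A w (r • n)) = r • tmul R A m (tmul R A w n)
    rw [tmul_rsmul, tmul_rsmul]

@[simp] theorem assocAux_tmul (n : N) (m : M) (w : W) :
    assocAux n (tmul R A m w) = tmul R A m (tmul R A w n) := rfl

/-- The canonical map `(M ⊗_A W) ⊗_A N → M ⊗_A (W ⊗_A N)` for an `A`-bimodule `W`. -/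
def assoc : ATensor R A (ATensor R A M W) N →ₗ[R] ATensor R A M (ATensor R A W N) :=
  lift (LinearMap.flip assocAux) (fun t a n => by
    induction t using ATensor.induction with
    | h0 => simp
    | h1 m w =>
      simp only [LinearMap.flip_apply, op_smul_tmul, assocAux_tmul, smul_tmul]
    | h2 s t hs ht => simp only [smul_add, map_add, LinearMap.add_apply, hs, ht])

@[simp] theorem assoc_tmul (m : M) (w : W) (n : N) :
    assoc (tmul R A (tmul R A m w) n) = tmul R A m (tmul R A w n) := rfl

end ATensor
/-! ### `A`-rings and their modules -/

/-- An associative `A`-ring, not necessarily with unity: an `A`-bimodule `B` with an associative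
multiplication that is `A`-bilinear and `A`-balanced. -/
class IsARing (R A B : Type*) [CommRing R] [Ring A] [Algebra R A] [NonUnitalRing B]
    [Module R B] [Module A B] [Module Aᵐᵒᵖ B] : Prop
    extends IsScalarTower R A B, SMulCommClass A Aᵐᵒᵖ B where
  isScalarTower_op : IsScalarTower R Aᵐᵒᵖ B
  smul_mul : ∀ (a : A) (x y : B), (a • x) * y = a • (x * y)
  mul_op_smul : ∀ (a : A) (x y : B), x * (op a • y) = op a • (x * y)
  op_smul_mul : ∀ (a : A) (x y : B), (op a • x) * y = x * (a • y)

attribute [instance] IsARing.isScalarTower_op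

/-- A morphism of (not necessarily unital) `A`-rings. -/
structure ARingHom (R A B B' : Type*) [CommRing R] [Ring A] [Algebra R A]
    [NonUnitalRing B] [Module R B] [Module A B] [Module Aᵐᵒᵖ B]
    [NonUnitalRing B'] [Module R B'] [Module A B'] [Module Aᵐᵒᵖ B'] where
  toLinearMap : B →ₗ[R] B'
  map_smul : ∀ (a : A) x, toLinearMap (a • x) = a • toLinearMap x
  map_op_smul : ∀ (a : A) x, toLinearMap (op a • x) = op a • toLinearMap x
  map_mul : ∀ x y, toLinearMap (x * y) = toLinearMap x * toLinearMap y

/-- Composition of morphisms of `A`-rings. -/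
def ARingHom.comp {R A B B' B'' : Type*} [CommRing R] [Ring A] [Algebra R A]
    [NonUnitalRing B] [Module R B] [Module A B] [Module Aᵐᵒᵖ B]
    [NonUnitalRing B'] [Module R B'] [Module A B'] [Module Aᵐᵒᵖ B']
    [NonUnitalRing B''] [Module R B''] [Module A B''] [Module Aᵐᵒᵖ B'']
    (g : ARingHom R A B' B'') (f : ARingHom R A B B') : ARingHom R A B B'' where
  toLinearMap := g.toLinearMap ∘ₗ f.toLinearMap
  map_smul a x := by simp [f.map_smul, g.map_smul]
  map_op_smul a x := by simp [f.map_op_smul, g.map_op_smul]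
  map_mul x y := by simp [f.map_mul, g.map_mul]

/-- A right module over an `A`-ring `B`: a right `A`-module `M` with an associative
`A`-linear and `A`-balanced action `M × B → M`. No unitality is required here. -/
structure AMod (R A B : Type u) [CommRing R] [Ring A] [Algebra R A] [NonUnitalRing B]
    [Module R B] [Module A B] [Module Aᵐᵒᵖ B] [IsARing R A B] where
  carrier : Type u
  [addCommGroup : AddCommGroup carrier]
  [module : Module R carrier]
  [opModule : Module Aᵐᵒᵖ carrier]
  [isScalarTower : IsScalarTower R Aᵐᵒᵖ carrier]
  /-- the action `(m, x) ↦ m x` -/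
  act : carrier →ₗ[R] B →ₗ[R] carrier
  act_act : ∀ m x y, act (act m x) y = act m (x * y)
  op_smul_act : ∀ (a : A) m x, act (op a • m) x = act m (a • x)
  act_op_smul : ∀ (a : A) m x, act m (op a • x) = op a • act m x

namespace AMod

attribute [instance] AMod.addCommGroup AMod.module AMod.opModule AMod.isScalarTower

variable {R A B B' : Type u} [CommRing R] [Ring A] [Algebra R A]
  [NonUnitalRing B] [Module R B] [Module A B] [Module Aᵐᵒᵖ B] [IsARing R A B]
  [NonUnitalRing B'] [Module R B'] [Module A B'] [Module Aᵐᵒᵖ B'] [IsARing R A B']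

/-- Morphisms: right `A`-linear maps that commute with the action of `B`. -/
@[ext] structure Hom (M N : AMod R A B) where
  toLinearMap : M.carrier →ₗ[Aᵐᵒᵖ] N.carrier
  map_act : ∀ m x, toLinearMap (M.act m x) = N.act (toLinearMap m) x

instance : Category.{u} (AMod R A B) where
  Hom M N := Hom M N
  id M := ⟨LinearMap.id, fun _ _ => rfl⟩
  comp f g := ⟨g.toLinearMap ∘ₗ f.toLinearMap, fun m x => by simp [f.map_act, g.map_act]⟩

/-- `M` is unital if `M B = M`. -/
def IsUnital (M : AMod R A B) : Prop :=
  AddSubgroup.closure {n : M.carrier | ∃ m x, M.act m x = n} = ⊤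

/-- The direct sum of copies of `K` indexed by `I`. -/
def copower (K : AMod R A B) (I : Type u) : AMod R A B where
  carrier := I →₀ K.carrier
  act := LinearMap.mk₂ R (fun m x => Finsupp.mapRange.linearMap (K.act.flip x) m)
    (fun m m' x => LinearMap.map_add _ _ _) (fun r m x => by simp)
    (fun m x x' => by ext i; simp) (fun r m x => by ext i; simp)
  act_act m x y := by ext i; simp [K.act_act]
  op_smul_act a m x := by ext i; simp [K.op_smul_act]
  act_op_smul a m x := by ext i; simp [K.act_op_smul]

/-- `N` is `K`-subgenerated: it is isomorphic to a submodule of a `K`-generated module `L`, that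
is, of an epimorphic image `L` of a direct sum of copies of `K`. -/
def IsSubgenerated (K N : AMod R A B) : Prop :=
  ∃ (I : Type u) (L : AMod R A B) (p : copower K I ⟶ L) (i : N ⟶ L),
    Function.Surjective p.toLinearMap ∧ Function.Injective i.toLinearMap

variable (R A B) in
/-- The (full) subcategory `M_B` of unital right `B`-modules. -/
def unital : ObjectProperty (AMod R A B) := fun N => N.IsUnital

/-- The (full) subcategory `σ[K]` of `K`-subgenerated unital right `B`-modules. -/
def sigma (K : AMod R A B) : ObjectProperty (AMod R A B) :=
  fun N => N.IsUnital ∧ IsSubgenerated K N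

/-- Restriction of scalars along a morphism of `A`-rings. -/
def restrict (f : ARingHom R A B B') : AMod R A B' ⥤ AMod R A B where
  obj M :=
    { carrier := M.carrier
      act := M.act.compl₂ f.toLinearMap
      act_act := fun m x y => by simp [M.act_act, f.map_mul]
      op_smul_act := fun a m x => by simp [M.op_smul_act, f.map_smul]
      act_op_smul := fun a m x => by simp [M.act_op_smul, f.map_op_smul] }
  map g := ⟨g.toLinearMap, fun m x => g.map_act m (f.toLinearMap x)⟩

end AMod

/-! ### Corings, their left dual rings, and measuring pairings -/

section Coring

variable (R A W : Type*) [CommRing R] [Ring A] [Algebra R A]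
  [AddCommGroup W] [Module R W] [Module A W] [Module Aᵐᵒᵖ W]
  [IsScalarTower R A W] [IsScalarTower R Aᵐᵒᵖ W] [SMulCommClass A Aᵐᵒᵖ W]

variable {R A W} in
/-- The bilinear map `(x, y) ↦ e(x) y`. -/
def Coring.contractLeft (e : W →ₗ[R] A) : W →ₗ[R] W →ₗ[R] W :=
  (Algebra.lsmul R R W).toLinearMap ∘ₗ e

variable {R A W} in
/-- The bilinear map `(x, y) ↦ x e(y)`. -/
def Coring.contractRight (e : W →ₗ[R] A) : W →ₗ[R] W →ₗ[R] W :=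
  ((Algebra.lsmul R R W).toLinearMap ∘ₗ (opLinearEquiv R).toLinearMap ∘ₗ e).flip

variable {R A W} in
@[simp] theorem Coring.contractLeft_apply (e : W →ₗ[R] A) (x y : W) :
    contractLeft e x y = e x • y := rfl

variable {R A W} in
@[simp] theorem Coring.contractRight_apply (e : W →ₗ[R] A) (x y : W) :
    contractRight e x y = op (e y) • x := rfl

variable {R A W} in
theorem Coring.contractLeft_balanced (e : W →ₗ[R] A) (h : ∀ (a : A) w, e (op a • w) = e w * a)
    (x : W) (a : A) (y : W) : contractLeft e (op a • x) y = contractLeft e x (a • y) := by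
  simp [h, mul_smul]

variable {R A W} in
theorem Coring.contractRight_balanced (e : W →ₗ[R] A) (h : ∀ (a : A) w, e (a • w) = a * e w)
    (x : W) (a : A) (y : W) : contractRight e (op a • x) y = contractRight e x (a • y) := by
  simp [h, mul_smul]

/-- A (coassociative, counital) `A`-coring structure on the `A`-bimodule `W`. -/
class Coring where
  comul : W →ₗ[R] ATensor R A W W
  counit : W →ₗ[R] A
  comul_smul : ∀ (a : A) w, comul (a • w) = a • comul w
  comul_op_smul : ∀ (a : A) w, comul (op a • w) = op a • comul w
  counit_smul : ∀ (a : A) w, counit (a • w) = a * counit w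
  counit_op_smul : ∀ (a : A) w, counit (op a • w) = counit w * a
  coassoc : ∀ w,
    ATensor.assoc (ATensor.map comul comul_op_smul LinearMap.id (fun _ _ => rfl) (comul w)) =
      ATensor.map LinearMap.id (fun _ _ => rfl) comul comul_smul (comul w)
  /-- `∑ ε(w₁) w₂ = w` -/
  counit_comul : ∀ w,
    ATensor.lift (Coring.contractLeft counit)
      (Coring.contractLeft_balanced counit counit_op_smul) (comul w) = w
  /-- `∑ w₁ ε(w₂) = w` -/
  comul_counit : ∀ w,
    ATensor.lift (Coring.contractRight counit)
      (Coring.contractRight_balanced counit counit_smul) (comul w) = w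

/-- The left dual `*W` of left `A`-linear maps `W → A`. -/
def LeftDual (_R : Type*) (A W : Type*) [Ring A] [AddCommGroup W] [Module A W] : Type _ := W →ₗ[A] A

end Coring

namespace LeftDual

variable {R A W : Type*} [CommRing R] [Ring A] [Algebra R A]
  [AddCommGroup W] [Module R W] [Module A W] [Module Aᵐᵒᵖ W]
  [IsScalarTower R A W] [IsScalarTower R Aᵐᵒᵖ W] [SMulCommClass A Aᵐᵒᵖ W]

instance : AddCommGroup (LeftDual R A W) := inferInstanceAs (AddCommGroup (W →ₗ[A] A))
instance : Module R (LeftDual R A W) := inferInstanceAs (Module R (W →ₗ[A] A))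
instance : FunLike (LeftDual R A W) W A := inferInstanceAs (FunLike (W →ₗ[A] A) W A)
instance : LinearMapClass (LeftDual R A W) A W A :=
  inferInstanceAs (LinearMapClass (W →ₗ[A] A) A W A)

@[ext] theorem ext {f g : LeftDual R A W} (h : ∀ w, f w = g w) : f = g := LinearMap.ext h

@[simp] theorem add_apply (f g : LeftDual R A W) (w : W) : (f + g) w = f w + g w := rfl
@[simp] theorem zero_apply (w : W) : (0 : LeftDual R A W) w = 0 := rfl
@[simp] theorem rsmul_apply (r : R) (f : LeftDual R A W) (w : W) : (r • f) w = r • f w := rfl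

/-- The right `A`-action `(f a)(w) = f(w) a`. -/
instance : Module Aᵐᵒᵖ (LeftDual R A W) := inferInstanceAs (Module Aᵐᵒᵖ (W →ₗ[A] A))

@[simp] theorem op_smul_apply (a : A) (f : LeftDual R A W) (w : W) : (op a • f) w = f w * a := rfl

/-- The left `A`-action `(a f)(w) = f(w a)`. -/
instance : Module A (LeftDual R A W) where
  smul a f := ((f : W →ₗ[A] A) ∘ₗ
    { toFun := fun w => op a • w
      map_add' := smul_add _
      map_smul' := fun b w => (smul_comm b (op a) w).symm } : W →ₗ[A] A)
  one_smul f := ext fun w => congrArg f (one_smul _ w)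
  mul_smul a b f := ext fun w => congrArg f (mul_smul (op b) (op a) w)
  smul_zero _ := rfl
  smul_add _ _ _ := rfl
  add_smul a b f := ext fun w => (congrArg f (add_smul (op a) (op b) w)).trans (map_add f _ _)
  zero_smul f := ext fun w => (congrArg f (zero_smul Aᵐᵒᵖ w)).trans (map_zero f)

@[simp] theorem smul_apply (a : A) (f : LeftDual R A W) (w : W) : (a • f) w = f (op a • w) := rfl

theorem map_rsmul (f : LeftDual R A W) (r : R) (w : W) : f (r • w) = r • f w :=
  LinearMap.map_smul_of_tower (f : W →ₗ[A] A) r w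

/-- The map `∑ u ⊗ v ↦ ∑ u f(v)` from `W ⊗_A W` to `W`. -/
def contract (f : LeftDual R A W) : ATensor R A W W →ₗ[R] W :=
  ATensor.lift (Coring.contractRight ((f : W →ₗ[A] A).restrictScalars R))
    (Coring.contractRight_balanced _ (fun a w => map_smul f a w))

@[simp] theorem contract_tmul (f : LeftDual R A W) (u v : W) :
    contract f (ATensor.tmul R A u v) = op (f v) • u := rfl

theorem contract_smul (f : LeftDual R A W) (a : A) (t : ATensor R A W W) :
    contract f (a • t) = a • contract f t := by
  induction t using ATensor.induction with
  | h0 => simp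
  | h1 u v => simp [smul_comm]
  | h2 s t hs ht => simp [hs, ht]

variable [Coring R A W]

/-- The right action `w ↼ f = ∑ w₁ f(w₂)` of `*W` on `W`. -/
def act (f : LeftDual R A W) : W →ₗ[R] W :=
  contract f ∘ₗ Coring.comul (A := A)

theorem act_apply (f : LeftDual R A W) (w : W) : act f w = contract f (Coring.comul w) := rfl

theorem act_smul (f : LeftDual R A W) (a : A) (w : W) : act f (a • w) = a • act f w := by
  rw [act_apply, Coring.comul_smul, contract_smul, act_apply]

/-- The multiplication `(f ⋆ g)(w) = ∑ g(w₁ f(w₂))` of `*W`. -/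
instance : Mul (LeftDual R A W) where
  mul f g :=
    ({ toFun := fun w => g (act f w)
       map_add' := fun w w' => by simp
       map_smul' := fun a w => by simp [act_smul] } : W →ₗ[A] A)

theorem mul_apply (f g : LeftDual R A W) (w : W) : (f * g) w = g (act f w) := rfl

theorem act_op_smul (f : LeftDual R A W) (a : A) (w : W) :
    act f (op a • w) = act (a • f) w := by
  rw [act_apply, act_apply, Coring.comul_op_smul]
  induction Coring.comul (R := R) (A := A) w using ATensor.induction with
  | h0 => simp
  | h1 u v => simp
  | h2 s t hs ht => simp only [smul_add, map_add, hs, ht]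

theorem op_smul_act (f : LeftDual R A W) (a : A) (w : W) :
    act (op a • f) w = op a • act f w := by
  rw [act_apply, act_apply]
  induction Coring.comul (R := R) (A := A) w using ATensor.induction with
  | h0 => simp
  | h1 u v => simp [mul_smul]
  | h2 s t hs ht => simp only [smul_add, map_add, hs, ht]

theorem act_add (f g : LeftDual R A W) (w : W) : act (f + g) w = act f w + act g w := by
  rw [act_apply, act_apply, act_apply]
  induction Coring.comul (R := R) (A := A) w using ATensor.induction with
  | h0 => simp
  | h1 u v => simp [add_smul]
  | h2 s t hs ht => simp only [map_add, hs, ht]; abel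

theorem act_rsmul (r : R) (f : LeftDual R A W) (w : W) : act (r • f) w = r • act f w := by
  rw [act_apply, act_apply]
  induction Coring.comul (R := R) (A := A) w using ATensor.induction with
  | h0 => simp
  | h1 u v => simp
  | h2 s t hs ht => simp only [map_add, smul_add, hs, ht]

theorem act_act (f g : LeftDual R A W) (w : W) : act g (act f w) = act (f * g) w := by
  have h := congrArg (contract g ∘ₗ ATensor.map LinearMap.id (fun _ _ => rfl) (contract f)
    (contract_smul f)) (Coring.coassoc (R := R) (A := A) w)
  rw [act_apply, act_apply, act_apply]
  trans
  · have key : ∀ t : ATensor R A W W, contract g (Coring.comul (contract f t)) =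
        (contract g ∘ₗ ATensor.map LinearMap.id (fun _ _ => rfl) (contract f) (contract_smul f))
          (ATensor.assoc (ATensor.map Coring.comul Coring.comul_op_smul LinearMap.id
            (fun _ _ => rfl) t)) := by
      intro t
      induction t using ATensor.induction with
      | h0 => simp
      | h1 u v =>
        simp only [contract_tmul, Coring.comul_op_smul, ATensor.map_tmul, LinearMap.id_apply]
        induction Coring.comul (R := R) (A := A) u using ATensor.induction with
        | h0 => simp
        | h1 x y => simp
        | h2 s t hs ht => simp only [smul_add, map_add, ATensor.add_tmul, hs, ht]
      | h2 s t hs ht => simp only [map_add, hs, ht]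
    exact key _
  · refine h.trans ?_
    induction Coring.comul (R := R) (A := A) w using ATensor.induction with
    | h0 => simp
    | h1 u v => rfl
    | h2 s t hs ht => simp only [map_add, hs, ht]

instance : NonUnitalRing (LeftDual R A W) where
  left_distrib f g h := rfl
  right_distrib f g h := ext fun w => by simp [mul_apply, act_add]
  zero_mul f := ext fun w => by
    rw [mul_apply, show (0 : LeftDual R A W) = (0 : R) • 0 by simp, act_rsmul]
    simp
  mul_zero f := rfl
  mul_assoc f g h := ext fun w => by simp only [mul_apply, act_act]

instance : IsARing R A (LeftDual R A W) where
  smul_assoc r a f := ext fun w => by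
    simp only [smul_apply, rsmul_apply, op_smul, smul_assoc, map_rsmul]
  isScalarTower_op := inferInstanceAs (IsScalarTower R Aᵐᵒᵖ (W →ₗ[A] A))
  smul_comm a b f := rfl
  smul_mul a f g := ext fun w => by simp [mul_apply, act_op_smul]
  mul_op_smul a f g := rfl
  op_smul_mul a f g := ext fun w => by simp [mul_apply, op_smul_act]

variable (R A W) in
/-- The counit of a coring, as an element of its left dual; it is the unity of `*W`. -/
def counit : LeftDual R A W :=
  ({ toFun := Coring.counit (R := R) (A := A)
     map_add' := map_add _
     map_smul' := Coring.counit_smul } : W →ₗ[A] A)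

end LeftDual

/-- The right `*W`-module `W` of a coring `W`, with `w ↼ f = ∑ w₁ f(w₂)`. -/
def Coring.regular (R A W : Type u) [CommRing R] [Ring A] [Algebra R A]
    [AddCommGroup W] [Module R W] [Module A W] [Module Aᵐᵒᵖ W]
    [IsScalarTower R A W] [IsScalarTower R Aᵐᵒᵖ W] [SMulCommClass A Aᵐᵒᵖ W] [Coring R A W] :
    AMod R A (LeftDual R A W) where
  carrier := W
  act := LinearMap.mk₂ R (fun w f => LeftDual.act f w) (fun _ _ _ => map_add _ _ _)
    (fun _ _ _ => LinearMap.map_smul _ _ _) (fun w f g => LeftDual.act_add f g w)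
    (fun r w f => LeftDual.act_rsmul r f w)
  act_act w f g := LeftDual.act_act f g w
  op_smul_act a w f := LeftDual.act_op_smul f a w
  act_op_smul a w f := LeftDual.op_smul_act f a w

section Pairing

variable {R A B W : Type u} [CommRing R] [Ring A] [Algebra R A]
  [NonUnitalRing B] [Module R B] [Module A B] [Module Aᵐᵒᵖ B] [IsARing R A B]
  [AddCommGroup W] [Module R W] [Module A W] [Module Aᵐᵒᵖ W]
  [IsScalarTower R A W] [IsScalarTower R Aᵐᵒᵖ W] [SMulCommClass A Aᵐᵒᵖ W] [Coring R A W]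

/-- A measuring left `A`-pairing `(B, W)` is given by a morphism of `A`-rings `κ : B → *W`
that sends the unity of `B`, if there is one, to the unity `ε` of `*W`. -/
structure IsMeasuringPairing (κ : B → LeftDual R A W) : Prop where
  isARingHom : ∃ f : ARingHom R A B (LeftDual R A W), ∀ x, f.toLinearMap x = κ x
  map_unity : ∀ e : B, (∀ x, e * x = x ∧ x * e = x) → κ e = LeftDual.counit R A W

/-- The bilinear map `(m, w) ↦ m ⟨x, w⟩`, where `⟨x, w⟩ = κ(x)(w)`. -/
def alphaAux (κ : B → LeftDual R A W) (M : Type u) [AddCommGroup M] [Module R M]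
    [Module Aᵐᵒᵖ M] [IsScalarTower R Aᵐᵒᵖ M] (x : B) : M →ₗ[R] W →ₗ[R] M :=
  LinearMap.mk₂ R (fun (m : M) (w : W) => op (κ x w) • m) (fun _ _ _ => smul_add _ _ _)
    (fun r m w => smul_comm _ _ _) (fun m w w' => by simp [add_smul])
    (fun r m w => by rw [LeftDual.map_rsmul, op_smul, smul_assoc])

theorem alphaAux_balanced (κ : B → LeftDual R A W) (M : Type u) [AddCommGroup M] [Module R M]
    [Module Aᵐᵒᵖ M] [IsScalarTower R Aᵐᵒᵖ M] (x : B) (m : M) (a : A) (w : W) :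
    alphaAux κ M x (op a • m) w = alphaAux κ M x m (a • w) := by
  simp [alphaAux, mul_smul]

/-- The map `α_M : M ⊗_A W → Hom_{-A}(B, M)`, `m ⊗ w ↦ [x ↦ m ⟨x, w⟩]`, evaluated at `x`. -/
def alphaMap (κ : B → LeftDual R A W) (M : Type u) [AddCommGroup M] [Module R M]
    [Module Aᵐᵒᵖ M] [IsScalarTower R Aᵐᵒᵖ M] (t : ATensor R A M W) (x : B) : M :=
  ATensor.lift (alphaAux κ M x) (alphaAux_balanced κ M x) t

/-- The left `α`-condition: `α_M` is injective for every right `A`-module `M`. -/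
def AlphaCondition (κ : B → LeftDual R A W) : Prop :=
  ∀ (M : Type u) [AddCommGroup M] [Module R M] [Module Aᵐᵒᵖ M] [IsScalarTower R Aᵐᵒᵖ M],
    Function.Injective (alphaMap κ M)

end Pairing
/-! ### Doi-Koppinen structures -/

section DoiKoppinen

variable (R H A C : Type u) [CommRing R] [Ring H] [Bialgebra R H] [Ring A] [Algebra R A]
  [AddCommGroup C] [Module R C] [Coalgebra R C]

/-- A right-right Doi-Koppinen structure `(H, A, C)`: a bialgebra `H`, a right `H`-comodule
algebra `A` and a right `H`-module coalgebra `C`. -/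
structure DoiKoppinen where
  /-- the coaction `a ↦ ∑ a₀ ⊗ a₁`, an algebra morphism -/
  coact : A →ₐ[R] A ⊗[R] H
  coact_coassoc : ∀ a, TensorProduct.assoc R A H H (coact.toLinearMap.rTensor H (coact a)) =
    (Coalgebra.comul (R := R) (A := H)).lTensor A (coact a)
  coact_counit : ∀ a, (Coalgebra.counit (R := R) (A := H)).lTensor A (coact a) = a ⊗ₜ[R] (1 : R)
  /-- the action `c ⊗ h ↦ c h`, a coalgebra morphism -/
  act : C ⊗[R] H →ₗc[R] C
  act_one : ∀ c, act (c ⊗ₜ 1) = c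
  act_mul : ∀ c (h k : H), act (c ⊗ₜ (h * k)) = act (act (c ⊗ₜ h) ⊗ₜ k)

end DoiKoppinen

/-- For a right `A`-module `M`, the action `m ⊗ a ↦ m a`. -/
def rightMul (R A M : Type*) [CommRing R] [Ring A] [Algebra R A] [AddCommGroup M] [Module R M]
    [Module Aᵐᵒᵖ M] [IsScalarTower R Aᵐᵒᵖ M] : M ⊗[R] A →ₗ[R] M :=
  TensorProduct.lift
    ((Algebra.lsmul R R M).toLinearMap ∘ₗ (opLinearEquiv R : A ≃ₗ[R] Aᵐᵒᵖ).toLinearMap).flip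

@[simp] theorem rightMul_tmul (R A M : Type*) [CommRing R] [Ring A] [Algebra R A]
    [AddCommGroup M] [Module R M] [Module Aᵐᵒᵖ M] [IsScalarTower R Aᵐᵒᵖ M] (m : M) (a : A) :
    rightMul R A M (m ⊗ₜ a) = op a • m := rfl

/-- The left `A`-linear map `A ⊗ C → N`, `a ⊗ c ↦ a f(c)`, given by an `R`-linear `f : C → N`. -/
def extendLeft {R A C N : Type*} [CommRing R] [Ring A] [Algebra R A] [AddCommGroup C] [Module R C]
    [AddCommGroup N] [Module R N] [Module A N] [IsScalarTower R A N] (f : C →ₗ[R] N) :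
    A ⊗[R] C →ₗ[A] N where
  toFun := TensorProduct.lift ((Algebra.lsmul R R N).toLinearMap.compl₂ f)
  map_add' := map_add _
  map_smul' a t := by
    induction t with
    | zero => simp
    | add s t hs ht => simp only [smul_add, map_add, hs, ht]
    | tmul b c => simp [smul_tmul']

@[simp] theorem extendLeft_tmul {R A C N : Type*} [CommRing R] [Ring A] [Algebra R A]
    [AddCommGroup C] [Module R C] [AddCommGroup N] [Module R N] [Module A N] [IsScalarTower R A N]
    (f : C →ₗ[R] N) (a : A) (c : C) : extendLeft f (a ⊗ₜ[R] c) = a • f c := rfl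

theorem extendLeft_rsmul {R A C N : Type*} [CommRing R] [Ring A] [Algebra R A]
    [AddCommGroup C] [Module R C] [AddCommGroup N] [Module R N] [Module A N] [IsScalarTower R A N]
    (f : C →ₗ[R] N) (r : R) (t : A ⊗[R] C) : extendLeft f (r • t) = r • extendLeft f t :=
  LinearMap.map_smul_of_tower _ r t

namespace DoiKoppinen

variable {R H A C : Type u} [CommRing R] [Ring H] [Bialgebra R H] [Ring A] [Algebra R A]
  [AddCommGroup C] [Module R C] [Coalgebra R C] (D : DoiKoppinen R H A C)

/-- For a right `A`-module `M`, the map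
`(m ⊗ c) ⊗ (a ⊗ h) ↦ m a ⊗ c h` from `(M ⊗ C) ⊗ (A ⊗ H)` to `M ⊗ C`. -/
def diag (M : Type*) [AddCommGroup M] [Module R M] [Module Aᵐᵒᵖ M] [IsScalarTower R Aᵐᵒᵖ M] :
    (M ⊗[R] C) ⊗[R] (A ⊗[R] H) →ₗ[R] M ⊗[R] C :=
  TensorProduct.map (rightMul R A M) D.act.toLinearMap ∘ₗ
    (TensorProduct.tensorTensorTensorComm R M C A H).toLinearMap

@[simp] theorem diag_tmul (M : Type*) [AddCommGroup M] [Module R M] [Module Aᵐᵒᵖ M]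
    [IsScalarTower R Aᵐᵒᵖ M] (m : M) (c : C) (a : A) (h : H) :
    D.diag M ((m ⊗ₜ c) ⊗ₜ (a ⊗ₜ h)) = (op a • m) ⊗ₜ[R] D.act (c ⊗ₜ h) := rfl

/-- The map `c ↦ c h` for a fixed `h`, linear in `h`. -/
def actH : H →ₗ[R] C →ₗ[R] C := (TensorProduct.curry D.act.toLinearMap).flip

@[simp] theorem actH_apply (h : H) (c : C) : D.actH h c = D.act (c ⊗ₜ h) := rfl

/-- The entwining map `ψ(c ⊗ a) = ∑ a₀ ⊗ c a₁`. -/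
def psi : C →ₗ[R] A →ₗ[R] A ⊗[R] C :=
  LinearMap.mk₂ R (fun c a => (D.actH.flip c).lTensor A (D.coact a))
    (fun c c' a => by simp [LinearMap.lTensor_add]) (fun r c a => by simp [LinearMap.lTensor_smul])
    (fun c a a' => by simp) (fun r c a => by simp)

theorem psi_apply (c : C) (a : A) : D.psi c a = (D.actH.flip c).lTensor A (D.coact a) := rfl

theorem psi_one (c : C) : D.psi c 1 = 1 ⊗ₜ c := by
  rw [psi_apply, map_one]
  exact congrArg (fun x => (1 : A) ⊗ₜ[R] x) (D.act_one c)

/-- `a ⊗ c ↦ ∑ a b₀ ⊗ c b₁`, the right action of `b` on `A ⊗ C`. -/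
def coringAct (b : A) : A ⊗[R] C →ₗ[A] A ⊗[R] C := extendLeft (D.psi.flip b)

@[simp] theorem coringAct_tmul (b a : A) (c : C) :
    D.coringAct b (a ⊗ₜ c) = a • D.psi c b := rfl

theorem psi_mul (c : C) (a b : A) : D.psi c (a * b) = D.coringAct b (D.psi c a) := by
  rw [psi_apply, psi_apply, map_mul]
  induction D.coact a with
  | zero => simp
  | add s t hs ht => simp only [add_mul, map_add, hs, ht]
  | tmul x h =>
    rw [LinearMap.lTensor_tmul, coringAct_tmul, psi_apply]
    induction D.coact b with
    | zero => simp
    | add s t hs ht => simp only [mul_add, map_add, smul_add, hs, ht]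
    | tmul y k => simp [D.act_mul, smul_tmul']

theorem coringAct_one (t : A ⊗[R] C) : D.coringAct 1 t = t := by
  induction t with
  | zero => simp
  | add s t hs ht => simp only [map_add, hs, ht]
  | tmul a c => simp [psi_one, smul_tmul']

theorem coringAct_mul (a b : A) (t : A ⊗[R] C) :
    D.coringAct (a * b) t = D.coringAct b (D.coringAct a t) := by
  induction t with
  | zero => simp
  | add s t hs ht => simp only [map_add, hs, ht]
  | tmul x c => simp [psi_mul]

theorem coringAct_add (a b : A) (t : A ⊗[R] C) :
    D.coringAct (a + b) t = D.coringAct a t + D.coringAct b t := by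
  induction t with
  | zero => simp
  | add s t hs ht => simp only [map_add, hs, ht]; abel
  | tmul x c => simp

theorem coringAct_rsmul (r : R) (a : A) (t : A ⊗[R] C) :
    D.coringAct (r • a) t = r • D.coringAct a t := by
  induction t with
  | zero => simp
  | add s t hs ht => simp only [map_add, smul_add, hs, ht]
  | tmul x c => rw [coringAct_tmul, coringAct_tmul, LinearMap.map_smul, smul_comm]

theorem coringAct_zero (t : A ⊗[R] C) : D.coringAct 0 t = 0 := by
  rw [← zero_smul R (0 : A), coringAct_rsmul, zero_smul]

/-- `∑ a_ψ ε(c^ψ) = ε(c) a`. -/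
theorem psi_counit (c : C) (a : A) :
    extendLeft (Algebra.linearMap R A ∘ₗ Coalgebra.counit) (D.psi c a) =
      Coalgebra.counit (R := R) c • a := by
  have h1 : ∀ t : A ⊗[R] H, extendLeft (Algebra.linearMap R A ∘ₗ Coalgebra.counit)
      ((D.actH.flip c).lTensor A t) = Coalgebra.counit (R := R) c •
        TensorProduct.rid R A ((Coalgebra.counit (R := R) (A := H)).lTensor A t) := by
    intro t
    induction t with
    | zero => simp
    | add s t hs ht => simp only [map_add, smul_add, hs, ht]
    | tmul x h =>
      have : Coalgebra.counit (R := R) (D.act (c ⊗ₜ h)) =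
          Coalgebra.counit (R := R) c * Coalgebra.counit (R := R) h := by
        rw [CoalgHomClass.counit_comp_apply]; simp [mul_comm]
      simp [this, Algebra.algebraMap_eq_smul_one, smul_smul]
  rw [psi_apply, h1, D.coact_counit]; simp

theorem comul_act (c : C) (h : H) : Coalgebra.comul (R := R) (D.act (c ⊗ₜ h)) =
    TensorProduct.map D.act.toLinearMap D.act.toLinearMap
      (TensorProduct.tensorTensorTensorComm R C C H H
        (Coalgebra.comul (R := R) c ⊗ₜ Coalgebra.comul (R := R) h)) :=
  (LinearMap.congr_fun D.act.map_comp_comul (c ⊗ₜ h)).symm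

/-- The map `c₁ ⊗ c₂ ↦ ∑ a_ψΨ ⊗ c₁^Ψ ⊗ c₂^ψ`. -/
def psiTwice (a : A) : C ⊗[R] C →ₗ[R] A ⊗[R] (C ⊗[R] C) :=
  TensorProduct.lift (LinearMap.mk₂ R
    (fun c₁ c₂ => TensorProduct.assoc R A C C ((D.psi c₁).rTensor C (D.psi c₂ a)))
    (fun _ _ _ => by simp [LinearMap.rTensor_add]) (fun _ _ _ => by simp [LinearMap.rTensor_smul])
    (fun _ _ _ => by simp) (fun _ _ _ => by simp))

@[simp] theorem psiTwice_tmul (a : A) (c₁ c₂ : C) : D.psiTwice a (c₁ ⊗ₜ c₂) =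
    TensorProduct.assoc R A C C ((D.psi c₁).rTensor C (D.psi c₂ a)) := rfl

/-- `∑ a_ψ ⊗ Δ(c^ψ) = ∑ a_ψΨ ⊗ c₁^Ψ ⊗ c₂^ψ`. -/
theorem psi_comul (c : C) (a : A) :
    (Coalgebra.comul (R := R) (A := C)).lTensor A (D.psi c a) =
      D.psiTwice a (Coalgebra.comul c) := by
  have h1 : ∀ (c₁ c₂ : C) (t : A ⊗[R] H),
      TensorProduct.assoc R A C C ((D.psi c₁).rTensor C ((D.actH.flip c₂).lTensor A t)) =
      (TensorProduct.map (D.actH.flip c₁) (D.actH.flip c₂)).lTensor A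
        (TensorProduct.assoc R A H H (D.coact.toLinearMap.rTensor H t)) := by
    intro c₁ c₂ t
    induction t with
    | zero => simp
    | add s t hs ht => simp only [map_add, hs, ht]
    | tmul x h =>
      simp only [LinearMap.lTensor_tmul, LinearMap.rTensor_tmul, psi_apply, AlgHom.toLinearMap_apply]
      induction D.coact x with
      | zero => simp
      | add s t hs ht => simp only [map_add, add_tmul, hs, ht]
      | tmul y k => simp
  let Φ : C ⊗[R] C →ₗ[R] H ⊗[R] H →ₗ[R] C ⊗[R] C :=
    TensorProduct.homTensorHomMap (RingHom.id R) H H C C ∘ₗ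
      TensorProduct.map D.actH.flip D.actH.flip
  have hΦ : ∀ c₁ c₂, Φ (c₁ ⊗ₜ c₂) = TensorProduct.map (D.actH.flip c₁) (D.actH.flip c₂) :=
    fun _ _ => rfl
  have h2 : ∀ (h : H), Coalgebra.comul (R := R) (D.act (c ⊗ₜ h)) =
      Φ (Coalgebra.comul c) (Coalgebra.comul h) := by
    intro h
    rw [comul_act]
    induction Coalgebra.comul (R := R) c with
    | zero => simp
    | add s t hs ht => simp only [add_tmul, map_add, LinearMap.add_apply, hs, ht]
    | tmul x y =>
      induction Coalgebra.comul (R := R) h with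
      | zero => simp
      | add s t hs ht => simp only [tmul_add, map_add, hs, ht]
      | tmul x y => rfl
  have h3 : ∀ t : A ⊗[R] H,
      (Coalgebra.comul (R := R) (A := C)).lTensor A ((D.actH.flip c).lTensor A t) =
      (Φ (Coalgebra.comul c)).lTensor A ((Coalgebra.comul (R := R) (A := H)).lTensor A t) := by
    intro t
    induction t with
    | zero => simp
    | add s t hs ht => simp only [map_add, hs, ht]
    | tmul x h => simp [h2]
  have h4 : ∀ u : C ⊗[R] C, D.psiTwice a u =
      (Φ u).lTensor A (TensorProduct.assoc R A H H (D.coact.toLinearMap.rTensor H (D.coact a))) := by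
    intro u
    induction u with
    | zero => simp
    | add s t hs ht => simp only [map_add, LinearMap.lTensor_add, LinearMap.add_apply, hs, ht]
    | tmul x y => rw [psiTwice_tmul, psi_apply D y, h1, hΦ]
  rw [psi_apply, h3, h4, D.coact_coassoc]

end DoiKoppinen
/-! ### The coring `A ⊗ C` -/

section DKCoring

variable {R H A C : Type u} [CommRing R] [Ring H] [Bialgebra R H] [Ring A] [Algebra R A]
  [AddCommGroup C] [Module R C] [Coalgebra R C]

/-- The `A`-bimodule `A ⊗ C`, with `b (a ⊗ c) = b a ⊗ c` and `(a ⊗ c) b = ∑ a b₀ ⊗ c b₁`. -/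
def DKCoring (_D : DoiKoppinen R H A C) : Type u := A ⊗[R] C

namespace DKCoring

variable (D : DoiKoppinen R H A C)

instance : AddCommGroup (DKCoring D) := inferInstanceAs (AddCommGroup (A ⊗[R] C))
instance : Module R (DKCoring D) := inferInstanceAs (Module R (A ⊗[R] C))
instance : Module A (DKCoring D) := inferInstanceAs (Module A (A ⊗[R] C))
instance : IsScalarTower R A (DKCoring D) := inferInstanceAs (IsScalarTower R A (A ⊗[R] C))

/-- The identification of `A ⊗ C` with its underlying left `A`-module. -/
def ofTensor : A ⊗[R] C ≃ₗ[A] DKCoring D := LinearEquiv.refl A (A ⊗[R] C)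

theorem ofTensor_rsmul (r : R) (t : A ⊗[R] C) : ofTensor D (r • t) = r • ofTensor D t := rfl

/-- The element `a ⊗ c`, bilinear in `a` and `c`. -/
def tmul : A →ₗ[R] C →ₗ[R] DKCoring D := TensorProduct.mk R A C

theorem ofTensor_tmul (a : A) (c : C) : ofTensor D (a ⊗ₜ[R] c) = tmul D a c := rfl

variable {D} in
theorem induction {p : DKCoring D → Prop} (w : DKCoring D) (h0 : p 0)
    (h1 : ∀ a c, p (tmul D a c)) (h2 : ∀ s t, p s → p t → p (s + t)) : p w :=
  TensorProduct.induction_on (motive := p) w h0 h1 h2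

theorem smul_tmul (a b : A) (c : C) : a • tmul D b c = tmul D (a * b) c := rfl

instance : Module Aᵐᵒᵖ (DKCoring D) where
  smul b w := D.coringAct b.unop w
  one_smul w := D.coringAct_one w
  mul_smul a b w := D.coringAct_mul b.unop a.unop w
  smul_zero b := LinearMap.map_zero (D.coringAct b.unop)
  smul_add b := LinearMap.map_add (D.coringAct b.unop)
  add_smul a b w := D.coringAct_add a.unop b.unop w
  zero_smul w := D.coringAct_zero w

theorem op_smul_tmul (b a : A) (c : C) :
    op b • tmul D a c = a • ofTensor D (D.psi c b) := rfl

instance : SMulCommClass A Aᵐᵒᵖ (DKCoring D) where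
  smul_comm a b w := ((D.coringAct b.unop).map_smul a w).symm

instance : IsScalarTower R Aᵐᵒᵖ (DKCoring D) where
  smul_assoc r b w := D.coringAct_rsmul r b.unop w

/-- The map `c₁ ⊗ c₂ ↦ (a ⊗ c₁) ⊗_A (1 ⊗ c₂)`, linear in `a`. -/
def split (a : A) : C ⊗[R] C →ₗ[R] ATensor R A (DKCoring D) (DKCoring D) :=
  TensorProduct.lift ((ATensor.mk R A (DKCoring D) (DKCoring D)).compl₁₂ (tmul D a) (tmul D 1))

@[simp] theorem split_tmul (a : A) (c₁ c₂ : C) :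
    split D a (c₁ ⊗ₜ c₂) = ATensor.tmul R A (tmul D a c₁) (tmul D 1 c₂) := rfl

theorem split_add (a b : A) (u : C ⊗[R] C) : split D (a + b) u = split D a u + split D b u := by
  induction u with
  | zero => simp
  | add s t hs ht => simp only [map_add, hs, ht]; abel
  | tmul x y => simp [ATensor.add_tmul]

theorem split_rsmul (r : R) (a : A) (u : C ⊗[R] C) : split D (r • a) u = r • split D a u := by
  induction u with
  | zero => simp
  | add s t hs ht => simp only [map_add, smul_add, hs, ht]
  | tmul x y => simp [ATensor.rsmul_tmul]

theorem smul_split (a b : A) (u : C ⊗[R] C) : a • split D b u = split D (a * b) u := by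
  induction u with
  | zero => simp
  | add s t hs ht => simp only [map_add, smul_add, hs, ht]
  | tmul x y => simp [smul_tmul]

/-- `Δ(a ⊗ c) = ∑ (a ⊗ c₁) ⊗_A (1 ⊗ c₂)`. -/
def comul : DKCoring D →ₗ[R] ATensor R A (DKCoring D) (DKCoring D) :=
  TensorProduct.lift (LinearMap.mk₂ R (fun a c => split D a (Coalgebra.comul c))
    (fun _ _ _ => split_add D _ _ _) (fun _ _ _ => split_rsmul D _ _ _)
    (fun _ _ _ => by simp) (fun _ _ _ => by simp))

theorem comul_tmul (a : A) (c : C) : comul D (tmul D a c) = split D a (Coalgebra.comul c) := rfl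

/-- `ε(a ⊗ c) = a ε(c)`. -/
def counit : DKCoring D →ₗ[R] A :=
  (extendLeft (Algebra.linearMap R A ∘ₗ Coalgebra.counit (R := R) (A := C))).restrictScalars R

theorem counit_tmul (a : A) (c : C) :
    counit D (tmul D a c) = a * algebraMap R A (Coalgebra.counit c) := rfl

theorem comul_smul (a : A) (w : DKCoring D) : comul D (a • w) = a • comul D w := by
  induction w using DKCoring.induction with
  | h0 => simp
  | h1 b c => rw [smul_tmul, comul_tmul, comul_tmul, smul_split]
  | h2 s t hs ht => simp only [smul_add, map_add, hs, ht]

theorem comul_psi (b : A) (c : C) :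
    comul D (ofTensor D (D.psi c b)) = op b • split D 1 (Coalgebra.comul c) := by
  have h1 : ∀ t : A ⊗[R] C, comul D (ofTensor D t) =
      extendLeft (split D 1) ((Coalgebra.comul (R := R) (A := C)).lTensor A t) := by
    intro t
    induction t with
    | zero => simp
    | add s t hs ht => simp only [map_add, hs, ht]
    | tmul x d => rw [LinearMap.lTensor_tmul, extendLeft_tmul, smul_split, mul_one, ofTensor_tmul,
        comul_tmul]
  have h2 : ∀ (c₁ : C) (t : A ⊗[R] C), extendLeft (split D 1)
      (TensorProduct.assoc R A C C ((D.psi c₁).rTensor C t)) =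
      ATensor.tmul R A (tmul D 1 c₁) (ofTensor D t) := by
    intro c₁ t
    induction t with
    | zero => simp
    | add s t hs ht => simp only [map_add, ATensor.tmul_add, hs, ht]
    | tmul x d =>
      have h := ATensor.smul_tmul (R := R) x (tmul D 1 c₁) (tmul D 1 d)
      rw [op_smul_tmul, one_smul, smul_tmul, mul_one] at h
      rw [ofTensor_tmul, ← h, LinearMap.rTensor_tmul]
      induction D.psi c₁ x with
      | zero => simp
      | add s t hs ht => simp only [add_tmul, map_add, ATensor.add_tmul, hs, ht]
      | tmul y e =>
        rw [TensorProduct.assoc_tmul, extendLeft_tmul, smul_split, mul_one, split_tmul,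
          ofTensor_tmul]
  rw [h1, D.psi_comul]
  induction Coalgebra.comul (R := R) c with
  | zero => simp
  | add s t hs ht => simp only [map_add, smul_add, hs, ht]
  | tmul x y =>
    rw [D.psiTwice_tmul, h2, split_tmul, ATensor.op_smul_tmul, op_smul_tmul, one_smul]

theorem comul_op_smul (b : A) (w : DKCoring D) : comul D (op b • w) = op b • comul D w := by
  induction w using DKCoring.induction with
  | h0 => simp
  | h1 a c =>
    rw [op_smul_tmul, comul_smul, comul_psi, comul_tmul, ← mul_one a, ← smul_split, mul_one]
    induction Coalgebra.comul (R := R) c with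
    | zero => simp
    | add s t hs ht => simp only [map_add, smul_add, hs, ht]
    | tmul x y => simp
  | h2 s t hs ht => simp only [smul_add, map_add, hs, ht]

theorem counit_smul (a : A) (w : DKCoring D) : counit D (a • w) = a * counit D w :=
  (extendLeft (Algebra.linearMap R A ∘ₗ Coalgebra.counit (R := R) (A := C))).map_smul a w

theorem counit_op_smul (b : A) (w : DKCoring D) : counit D (op b • w) = counit D w * b := by
  induction w using DKCoring.induction with
  | h0 => simp
  | h1 a c =>
    rw [op_smul_tmul, counit_smul, counit_tmul, mul_assoc]
    congr 1
    exact (D.psi_counit c b).trans (Algebra.smul_def _ _)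
  | h2 s t hs ht => simp only [smul_add, map_add, add_mul, hs, ht]

theorem coassoc (w : DKCoring D) :
    ATensor.assoc (ATensor.map (comul D) (comul_op_smul D) LinearMap.id (fun _ _ => rfl)
      (comul D w)) =
    ATensor.map LinearMap.id (fun _ _ => rfl) (comul D) (comul_smul D) (comul D w) := by
  induction w using DKCoring.induction with
  | h0 => simp
  | h2 s t hs ht => simp only [map_add, hs, ht]
  | h1 a c =>
    rw [comul_tmul]
    let Ψ : C ⊗[R] (C ⊗[R] C) →ₗ[R]
        ATensor R A (DKCoring D) (ATensor R A (DKCoring D) (DKCoring D)) :=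
      TensorProduct.lift ((ATensor.mk R A (DKCoring D) (ATensor R A (DKCoring D) (DKCoring D))).compl₁₂
        (tmul D a) (split D 1))
    have h1 : ∀ u : C ⊗[R] C,
        ATensor.assoc (ATensor.map (comul D) (comul_op_smul D) LinearMap.id (fun _ _ => rfl)
          (split D a u)) =
        Ψ (TensorProduct.assoc R C C C ((Coalgebra.comul (R := R) (A := C)).rTensor C u)) := by
      intro u
      induction u with
      | zero => simp
      | add s t hs ht => simp only [map_add, hs, ht]
      | tmul x y =>
        rw [split_tmul, ATensor.map_tmul, comul_tmul, LinearMap.rTensor_tmul]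
        induction Coalgebra.comul (R := R) x with
        | zero => simp
        | add s t hs ht => simp only [map_add, ATensor.add_tmul, add_tmul, hs, ht]
        | tmul p q => rfl
    have h2 : ∀ u : C ⊗[R] C,
        ATensor.map LinearMap.id (fun _ _ => rfl) (comul D) (comul_smul D) (split D a u) =
        Ψ ((Coalgebra.comul (R := R) (A := C)).lTensor C u) := by
      intro u
      induction u with
      | zero => simp
      | add s t hs ht => simp only [map_add, hs, ht]
      | tmul x y => rfl
    rw [h1, h2, Coalgebra.coassoc_apply]

instance : Coring R A (DKCoring D) where
  comul := comul D
  counit := counit D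
  comul_smul := comul_smul D
  comul_op_smul := comul_op_smul D
  counit_smul := counit_smul D
  counit_op_smul := counit_op_smul D
  coassoc := coassoc D
  counit_comul w := by
    induction w using DKCoring.induction with
    | h0 => simp
    | h2 s t hs ht => simp only [map_add, hs, ht]
    | h1 a c =>
      have h1 : ∀ u : C ⊗[R] C, ATensor.lift (Coring.contractLeft (counit D))
          (Coring.contractLeft_balanced _ (counit_op_smul D)) (split D a u) =
          tmul D a (TensorProduct.lid R C ((Coalgebra.counit (R := R) (A := C)).rTensor C u)) := by
        intro u
        induction u with
        | zero => simp
        | add s t hs ht => simp only [map_add, hs, ht]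
        | tmul x y =>
          simp only [split_tmul, ATensor.lift_tmul, Coring.contractLeft_apply, counit_tmul,
            smul_tmul, mul_one, LinearMap.rTensor_tmul, TensorProduct.lid_tmul, map_smul]
          rw [← Algebra.commutes, ← Algebra.smul_def, map_smul, LinearMap.smul_apply]
      rw [comul_tmul, h1, Coalgebra.rTensor_counit_comul]
      simp
  comul_counit w := by
    induction w using DKCoring.induction with
    | h0 => simp
    | h2 s t hs ht => simp only [map_add, hs, ht]
    | h1 a c =>
      have h1 : ∀ u : C ⊗[R] C, ATensor.lift (Coring.contractRight (counit D))
          (Coring.contractRight_balanced _ (counit_smul D)) (split D a u) =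
          tmul D a (TensorProduct.rid R C ((Coalgebra.counit (R := R) (A := C)).lTensor C u)) := by
        intro u
        induction u with
        | zero => simp
        | add s t hs ht => simp only [map_add, hs, ht]
        | tmul x y =>
          simp only [split_tmul, ATensor.lift_tmul, Coring.contractRight_apply, counit_tmul,
            one_mul, LinearMap.lTensor_tmul, TensorProduct.rid_tmul, map_smul]
          rw [Algebra.algebraMap_eq_smul_one, op_smul, smul_assoc, op_one, one_smul]
      rw [comul_tmul, h1, Coalgebra.lTensor_counit_comul]
      simp

end DKCoring

end DKCoring
/-! ### The `A`-ring `#ᵒᵖ(C, A)` -/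

section OpHom

variable {R H A C : Type u} [CommRing R] [Ring H] [Bialgebra R H] [Ring A] [Algebra R A]
  [AddCommGroup C] [Module R C] [Coalgebra R C]

/-- The `A`-ring `#ᵒᵖ(C, A) = Hom_R(C, A)` of a Doi-Koppinen structure. -/
def OpHom (_D : DoiKoppinen R H A C) : Type u := C →ₗ[R] A

namespace OpHom

variable (D : DoiKoppinen R H A C)

instance : AddCommGroup (OpHom D) := inferInstanceAs (AddCommGroup (C →ₗ[R] A))
instance : Module R (OpHom D) := inferInstanceAs (Module R (C →ₗ[R] A))
instance : FunLike (OpHom D) C A := inferInstanceAs (FunLike (C →ₗ[R] A) C A)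
instance : LinearMapClass (OpHom D) R C A := inferInstanceAs (LinearMapClass (C →ₗ[R] A) R C A)

/-- The right `A`-action `(f a)(c) = f(c) a`. -/
instance : Module Aᵐᵒᵖ (OpHom D) := inferInstanceAs (Module Aᵐᵒᵖ (C →ₗ[R] A))

/-- The underlying `R`-linear map. -/
def toLin : OpHom D ≃ₗ[R] (C →ₗ[R] A) := LinearEquiv.refl R (C →ₗ[R] A)

variable {D}

@[simp] theorem toLin_apply (f : OpHom D) (c : C) : toLin D f c = f c := rfl

@[simp] theorem toLin_symm_apply (f : C →ₗ[R] A) (c : C) : (toLin D).symm f c = f c := rfl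

@[ext] theorem ext {f g : OpHom D} (h : ∀ c, f c = g c) : f = g := LinearMap.ext h

@[simp] theorem add_apply (f g : OpHom D) (c : C) : (f + g) c = f c + g c := rfl
@[simp] theorem zero_apply (c : C) : (0 : OpHom D) c = 0 := rfl
@[simp] theorem rsmul_apply (r : R) (f : OpHom D) (c : C) : (r • f) c = r • f c := rfl
@[simp] theorem op_smul_apply (a : A) (f : OpHom D) (c : C) : (op a • f) c = f c * a := rfl

/-- The left `A`-action `(a f)(c) = ∑ a₀ f(c a₁)`. -/
instance : SMul A (OpHom D) where
  smul a f := (toLin D).symm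
    ((extendLeft (toLin D f)).restrictScalars R ∘ₗ D.psi.flip a)

theorem smul_apply (a : A) (f : OpHom D) (c : C) :
    (a • f) c = extendLeft (toLin D f) (D.psi c a) := rfl

/-- The map `c₁ ⊗ c₂ ↦ ∑ f(c₂)₀ ⊗ c₁ f(c₂)₁`. -/
def conv (f : OpHom D) : C ⊗[R] C →ₗ[R] A ⊗[R] C :=
  TensorProduct.lift (D.psi.compl₂ (toLin D f))

@[simp] theorem conv_tmul (f : OpHom D) (c₁ c₂ : C) : conv f (c₁ ⊗ₜ c₂) = D.psi c₁ (f c₂) := rfl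

/-- The multiplication `(f g)(c) = ∑ f(c₂)₀ g(c₁ f(c₂)₁)`. -/
instance : Mul (OpHom D) where
  mul f g := (toLin D).symm
    ((extendLeft (toLin D g)).restrictScalars R ∘ₗ conv f ∘ₗ Coalgebra.comul)

theorem mul_apply (f g : OpHom D) (c : C) :
    (f * g) c = extendLeft (toLin D g) (conv f (Coalgebra.comul c)) := rfl

/-- The isomorphism `φ : #ᵒᵖ(C, A) → *(A ⊗ C)`, `f ↦ [a ⊗ c ↦ a f(c)]`. -/
def phi (f : OpHom D) : LeftDual R A (DKCoring D) :=
  (extendLeft (toLin D f) ∘ₗ (DKCoring.ofTensor D).symm.toLinearMap : DKCoring D →ₗ[A] A)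

@[simp] theorem phi_ofTensor (f : OpHom D) (t : A ⊗[R] C) :
    phi f (DKCoring.ofTensor D t) = extendLeft (toLin D f) t := rfl

@[simp] theorem phi_tmul (f : OpHom D) (a : A) (c : C) :
    phi f (DKCoring.tmul D a c) = a * f c := rfl

theorem phi_injective : Function.Injective (phi (D := D)) := fun f g h => ext fun c => by
  simpa using congrArg (fun k => k (DKCoring.tmul D 1 c)) h

theorem dual_ext {f g : LeftDual R A (DKCoring D)}
    (h : ∀ c, f (DKCoring.tmul D 1 c) = g (DKCoring.tmul D 1 c)) : f = g := by
  ext w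
  induction w using DKCoring.induction with
  | h0 => rw [map_zero, map_zero]
  | h1 a c =>
    have : DKCoring.tmul D a c = a • DKCoring.tmul D 1 c := by
      rw [DKCoring.smul_tmul, mul_one]
    rw [this, map_smul, map_smul, h]
  | h2 s t hs ht => rw [map_add, map_add, hs, ht]

theorem phi_add (f g : OpHom D) : phi (f + g) = phi f + phi g :=
  dual_ext fun c => by simp

theorem phi_rsmul (r : R) (f : OpHom D) : phi (r • f) = r • phi f :=
  dual_ext fun c => by simp

theorem phi_zero : phi (0 : OpHom D) = 0 := dual_ext fun c => by simp

theorem phi_op_smul (a : A) (f : OpHom D) : phi (op a • f) = op a • phi f :=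
  dual_ext fun c => by simp

theorem phi_smul (a : A) (f : OpHom D) : phi (a • f) = a • phi f :=
  dual_ext fun c => by
    rw [LeftDual.smul_apply, DKCoring.op_smul_tmul, one_smul, phi_ofTensor, phi_tmul, one_mul,
      smul_apply]

theorem act_phi (f : OpHom D) (c : C) :
    LeftDual.act (phi f) (DKCoring.tmul D 1 c) =
      DKCoring.ofTensor D (conv f (Coalgebra.comul c)) := by
  have h : LeftDual.act (phi f) (DKCoring.tmul D 1 c) =
      LeftDual.contract (phi f) (DKCoring.split D 1 (Coalgebra.comul c)) := rfl
  rw [h]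
  induction Coalgebra.comul (R := R) c with
  | zero => simp
  | add s t hs ht => simp only [map_add, hs, ht]
  | tmul x y =>
    rw [DKCoring.split_tmul, LeftDual.contract_tmul, phi_tmul, one_mul, DKCoring.op_smul_tmul,
      one_smul, conv_tmul]

theorem phi_mul (f g : OpHom D) : phi (f * g) = phi f * phi g :=
  dual_ext fun c => by
    rw [LeftDual.mul_apply, act_phi, phi_ofTensor, phi_tmul, one_mul, mul_apply]

instance : Module A (OpHom D) where
  one_smul f := phi_injective (by rw [phi_smul, one_smul])
  mul_smul a b f := phi_injective (by simp only [phi_smul, mul_smul])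
  smul_zero a := phi_injective (by rw [phi_smul, phi_zero, smul_zero])
  smul_add a f g := phi_injective (by simp only [phi_smul, phi_add, smul_add])
  add_smul a b f := phi_injective (by simp only [phi_smul, phi_add, add_smul])
  zero_smul f := phi_injective (by rw [phi_smul, phi_zero, zero_smul])

instance : NonUnitalRing (OpHom D) where
  left_distrib f g h := phi_injective (by simp only [phi_mul, phi_add, mul_add])
  right_distrib f g h := phi_injective (by simp only [phi_mul, phi_add, add_mul])
  zero_mul f := phi_injective (by rw [phi_mul, phi_zero, zero_mul])
  mul_zero f := phi_injective (by rw [phi_mul, phi_zero, mul_zero])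
  mul_assoc f g h := phi_injective (by simp only [phi_mul, mul_assoc])

instance : IsARing R A (OpHom D) where
  smul_assoc r a f := phi_injective (by simp only [phi_smul, phi_rsmul, smul_assoc])
  isScalarTower_op := inferInstanceAs (IsScalarTower R Aᵐᵒᵖ (C →ₗ[R] A))
  smul_comm a b f := phi_injective (by
    rw [← op_unop b, phi_smul, phi_op_smul, phi_op_smul, phi_smul, smul_comm])
  smul_mul a f g := phi_injective (by
    simp only [phi_smul, phi_mul, IsARing.smul_mul (R := R)])
  mul_op_smul a f g := phi_injective (by
    simp only [phi_op_smul, phi_mul, IsARing.mul_op_smul (R := R)])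
  op_smul_mul a f g := phi_injective (by
    simp only [phi_smul, phi_op_smul, phi_mul, IsARing.op_smul_mul (R := R)])

variable (D) in
/-- `φ` as a morphism of `A`-rings. -/
def phiHom : ARingHom R A (OpHom D) (LeftDual R A (DKCoring D)) where
  toLinearMap :=
    { toFun := phi
      map_add' := phi_add
      map_smul' := phi_rsmul }
  map_smul := phi_smul
  map_op_smul := phi_op_smul
  map_mul := phi_mul

end OpHom

end OpHom
/-! ### The `A`-ring `A #ᵒᵖ T` -/

section OpSmash

variable {R H A C : Type u} [CommRing R] [Ring H] [Bialgebra R H] [Ring A] [Algebra R A]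
  [AddCommGroup C] [Module R C] [Coalgebra R C]

/-- The convolution product `(f ⋆ g)(c) = ∑ f(c₁) g(c₂)` on the dual `C*` of a coalgebra. -/
def convolution (R C : Type u) [CommRing R] [AddCommGroup C] [Module R C] [Coalgebra R C] :
    Module.Dual R C →ₗ[R] Module.Dual R C →ₗ[R] Module.Dual R C :=
  LinearMap.mk₂ R (fun f g => LinearMap.mul' R R ∘ₗ TensorProduct.map f g ∘ₗ Coalgebra.comul)
    (fun f f' g => by ext; simp [TensorProduct.map_add_left])
    (fun r f g => by ext; simp [TensorProduct.map_smul_left])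
    (fun f g g' => by ext; simp [TensorProduct.map_add_right])
    (fun r f g => by ext; simp [TensorProduct.map_smul_right])

theorem convolution_apply (f g : Module.Dual R C) (c : C) :
    convolution R C f g c =
      LinearMap.mul' R R (TensorProduct.map f g (Coalgebra.comul c)) := rfl

theorem convolution_assoc (f g k : Module.Dual R C) :
    convolution R C (convolution R C f g) k = convolution R C f (convolution R C g k) := by
  let Φ : C ⊗[R] (C ⊗[R] C) →ₗ[R] R :=
    LinearMap.mul' R R ∘ₗ TensorProduct.map f (LinearMap.mul' R R ∘ₗ TensorProduct.map g k)
  have h1 : ∀ t : C ⊗[R] C, LinearMap.mul' R R (TensorProduct.map (convolution R C f g) k t) =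
      Φ (TensorProduct.assoc R C C C ((Coalgebra.comul (R := R) (A := C)).rTensor C t)) := by
    intro t
    induction t with
    | zero => simp
    | add s t hs ht => simp only [map_add, hs, ht]
    | tmul x y =>
      rw [TensorProduct.map_tmul, LinearMap.mul'_apply, LinearMap.rTensor_tmul, convolution_apply]
      induction Coalgebra.comul (R := R) x with
      | zero => simp
      | add s t hs ht => simp only [map_add, add_mul, add_tmul, hs, ht]
      | tmul p q => simp [Φ, mul_assoc]
  have h2 : ∀ t : C ⊗[R] C, LinearMap.mul' R R (TensorProduct.map f (convolution R C g k) t) =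
      Φ ((Coalgebra.comul (R := R) (A := C)).lTensor C t) := by
    intro t
    induction t with
    | zero => simp
    | add s t hs ht => simp only [map_add, hs, ht]
    | tmul x y => rfl
  ext c
  rw [convolution_apply, convolution_apply, h1, h2, Coalgebra.coassoc_apply]

namespace DoiKoppinen

variable (D : DoiKoppinen R H A C)

/-- The left action `(h f)(c) = f(c h)` of `H` on `C*`. -/
def dualAct : H →ₗ[R] Module.Dual R C →ₗ[R] Module.Dual R C :=
  LinearMap.mk₂ R (fun h f => f ∘ₗ D.actH h)
    (fun _ _ _ => by ext; simp) (fun _ _ _ => by ext; simp)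
    (fun _ _ _ => rfl) (fun _ _ _ => rfl)

@[simp] theorem dualAct_apply (h : H) (f : Module.Dual R C) (c : C) :
    D.dualAct h f c = f (D.act (c ⊗ₜ h)) := rfl

theorem dualAct_one (f : Module.Dual R C) : D.dualAct 1 f = f := by
  ext c; simp [D.act_one]

theorem dualAct_mul (h k : H) (f : Module.Dual R C) :
    D.dualAct (h * k) f = D.dualAct h (D.dualAct k f) := by
  ext c; simp [D.act_mul]

/-- `h (f ⋆ g) = ∑ (h₁ f) ⋆ (h₂ g)`. -/
theorem dualAct_convolution (h : H) (f g : Module.Dual R C) :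
    D.dualAct h (convolution R C f g) =
      TensorProduct.lift ((convolution R C).compl₁₂ (D.dualAct.flip f) (D.dualAct.flip g))
        (Coalgebra.comul h) := by
  ext c
  rw [dualAct_apply, convolution_apply, comul_act]
  induction Coalgebra.comul (R := R) h with
  | zero => simp
  | add s t hs ht => simp only [tmul_add, map_add, LinearMap.add_apply, hs, ht]
  | tmul p q =>
    rw [TensorProduct.lift.tmul, LinearMap.compl₁₂_apply, convolution_apply]
    induction Coalgebra.comul (R := R) c with
    | zero => simp
    | add s t hs ht => simp only [add_tmul, map_add, hs, ht]
    | tmul x y => rfl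

end DoiKoppinen

/-- A left `H`-module subalgebra `T ⊆ C*` (not necessarily containing the unity `ε` of `C*`). -/
structure HSubalgebra (D : DoiKoppinen R H A C) extends Submodule R (Module.Dual R C) where
  convolution_mem : ∀ f ∈ carrier, ∀ g ∈ carrier, convolution R C f g ∈ carrier
  dualAct_mem : ∀ (h : H), ∀ f ∈ carrier, D.dualAct h f ∈ carrier

namespace HSubalgebra

variable {D : DoiKoppinen R H A C}

variable (D) in
/-- The whole dual `C*`. -/
def whole : HSubalgebra D where
  toSubmodule := ⊤
  convolution_mem _ _ _ _ := trivial
  dualAct_mem _ _ _ := trivial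

variable (T : HSubalgebra D)

/-- The product of `T`. -/
def mul : T.toSubmodule →ₗ[R] T.toSubmodule →ₗ[R] T.toSubmodule :=
  LinearMap.mk₂ R (fun f g => ⟨convolution R C f g, T.convolution_mem f f.2 g g.2⟩)
    (fun _ _ _ => Subtype.ext (by simp)) (fun _ _ _ => Subtype.ext (by simp))
    (fun _ _ _ => Subtype.ext (by simp)) (fun _ _ _ => Subtype.ext (by simp))

/-- The action of `H` on `T`. -/
def act : H →ₗ[R] T.toSubmodule →ₗ[R] T.toSubmodule :=
  LinearMap.mk₂ R (fun h f => ⟨D.dualAct h f, T.dualAct_mem h f f.2⟩)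
    (fun _ _ _ => Subtype.ext (by simp)) (fun _ _ _ => Subtype.ext (by simp))
    (fun _ _ _ => Subtype.ext (by simp)) (fun _ _ _ => Subtype.ext (by simp))

@[simp] theorem coe_mul (f g : T.toSubmodule) :
    (T.mul f g : Module.Dual R C) = convolution R C f g := rfl

@[simp] theorem coe_act (h : H) (f : T.toSubmodule) :
    (T.act h f : Module.Dual R C) = D.dualAct h f := rfl

theorem mul_assoc (f g k : T.toSubmodule) : T.mul (T.mul f g) k = T.mul f (T.mul g k) :=
  Subtype.ext (convolution_assoc _ _ _)

theorem act_one (f : T.toSubmodule) : T.act 1 f = f := Subtype.ext (D.dualAct_one _)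

theorem act_mul (h k : H) (f : T.toSubmodule) : T.act (h * k) f = T.act h (T.act k f) :=
  Subtype.ext (D.dualAct_mul _ _ _)

theorem act_convolution (h : H) (f g : T.toSubmodule) : T.act h (T.mul f g) =
    TensorProduct.lift (T.mul.compl₁₂ (T.act.flip f) (T.act.flip g)) (Coalgebra.comul h) := by
  apply Subtype.ext
  rw [coe_act, coe_mul, D.dualAct_convolution]
  induction Coalgebra.comul (R := R) h with
  | zero => simp
  | add s t hs ht => simp only [map_add, Submodule.coe_add, hs, ht]
  | tmul p q => rfl

end HSubalgebra

/-- The `A`-ring `A #ᵒᵖ T = A ⊗ T` of a left `H`-module subalgebra `T ⊆ C*`. -/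
def OpSmash {D : DoiKoppinen R H A C} (T : HSubalgebra D) : Type u := A ⊗[R] T.toSubmodule

namespace OpSmash

variable {D : DoiKoppinen R H A C} (T : HSubalgebra D)

instance : AddCommGroup (OpSmash T) := inferInstanceAs (AddCommGroup (A ⊗[R] T.toSubmodule))
instance : Module R (OpSmash T) := inferInstanceAs (Module R (A ⊗[R] T.toSubmodule))

/-- The action `(x ⊗ h) (a ⊗ f) = x a ⊗ h f` of `A ⊗ H` on `A ⊗ T`. -/
def tensorAct : A ⊗[R] H →ₗ[R] A ⊗[R] T.toSubmodule →ₗ[R] A ⊗[R] T.toSubmodule :=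
  TensorProduct.homTensorHomMap (RingHom.id R) A T.toSubmodule A T.toSubmodule ∘ₗ
    TensorProduct.map (LinearMap.mul R A) T.act

@[simp] theorem tensorAct_tmul (x : A) (h : H) (a : A) (f : T.toSubmodule) :
    tensorAct T (x ⊗ₜ h) (a ⊗ₜ f) = (x * a) ⊗ₜ[R] T.act h f := rfl

theorem tensorAct_one (t : A ⊗[R] T.toSubmodule) : tensorAct T 1 t = t := by
  induction t with
  | zero => simp
  | add s t hs ht => simp only [map_add, hs, ht]
  | tmul a f => rw [Algebra.TensorProduct.one_def, tensorAct_tmul, one_mul, T.act_one]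

theorem tensorAct_mul (s s' : A ⊗[R] H) (t : A ⊗[R] T.toSubmodule) :
    tensorAct T (s * s') t = tensorAct T s (tensorAct T s' t) := by
  induction t with
  | zero => simp
  | add u v hu hv => simp only [map_add, hu, hv]
  | tmul a f =>
    induction s with
    | zero => simp
    | add u v hu hv => simp only [add_mul, map_add, LinearMap.add_apply, hu, hv]
    | tmul x h =>
      induction s' with
      | zero => simp
      | add u v hu hv => simp only [mul_add, map_add, LinearMap.add_apply, hu, hv]
      | tmul y k => simp [T.act_mul, _root_.mul_assoc]

/-- The left action `ã (a # f) = ∑ ã₀ a # ã₁ f` of `A` on `A ⊗ T`. -/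
def lact : A →ₗ[R] A ⊗[R] T.toSubmodule →ₗ[R] A ⊗[R] T.toSubmodule :=
  tensorAct T ∘ₗ D.coact.toLinearMap

theorem lact_apply (a : A) (t : A ⊗[R] T.toSubmodule) :
    lact T a t = tensorAct T (D.coact a) t := rfl

theorem lact_one (t : A ⊗[R] T.toSubmodule) : lact T 1 t = t := by
  rw [lact_apply, map_one, tensorAct_one]

theorem lact_mul (a b : A) (t : A ⊗[R] T.toSubmodule) :
    lact T (a * b) t = lact T a (lact T b t) := by
  rw [lact_apply, map_mul, tensorAct_mul, lact_apply, lact_apply]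

/-- The right action `(a # f) ã = a ã # f` of `A` on `A ⊗ T`. -/
def ract (b : A) : A ⊗[R] T.toSubmodule →ₗ[R] A ⊗[R] T.toSubmodule :=
  (LinearMap.mulRight R b).rTensor T.toSubmodule

@[simp] theorem ract_tmul (b a : A) (f : T.toSubmodule) :
    ract T b (a ⊗ₜ f) = (a * b) ⊗ₜ[R] f := rfl

theorem ract_one (t : A ⊗[R] T.toSubmodule) : ract T 1 t = t := by
  induction t with
  | zero => simp
  | add s t hs ht => simp only [map_add, hs, ht]
  | tmul a f => simp

theorem ract_mul (a b : A) (t : A ⊗[R] T.toSubmodule) :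
    ract T (a * b) t = ract T b (ract T a t) := by
  induction t with
  | zero => simp
  | add s t hs ht => simp only [map_add, hs, ht]
  | tmul x f => simp [_root_.mul_assoc]

theorem ract_add (a b : A) (t : A ⊗[R] T.toSubmodule) :
    ract T (a + b) t = ract T a t + ract T b t := by
  induction t with
  | zero => simp
  | add s t hs ht => simp only [map_add, hs, ht]; abel
  | tmul x f => simp [mul_add, add_tmul]

theorem ract_rsmul (r : R) (a : A) (t : A ⊗[R] T.toSubmodule) :
    ract T (r • a) t = r • ract T a t := by
  induction t with
  | zero => simp
  | add s t hs ht => simp only [map_add, smul_add, hs, ht]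
  | tmul x f => simp [smul_tmul']

theorem ract_zero (t : A ⊗[R] T.toSubmodule) : ract T 0 t = 0 := by
  rw [← zero_smul R (0 : A), ract_rsmul, zero_smul]

theorem lact_ract (a b : A) (t : A ⊗[R] T.toSubmodule) :
    lact T a (ract T b t) = ract T b (lact T a t) := by
  rw [lact_apply, lact_apply]
  induction t with
  | zero => simp
  | add s t hs ht => simp only [map_add, hs, ht]
  | tmul x f =>
    induction D.coact a with
    | zero => simp
    | add s t hs ht => simp only [map_add, LinearMap.add_apply, hs, ht]
    | tmul y h => simp [_root_.mul_assoc]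

/-- The map `a # g ↦ a # g ⋆ f`, linear in `f`. -/
def convRight : T.toSubmodule →ₗ[R] A ⊗[R] T.toSubmodule →ₗ[R] A ⊗[R] T.toSubmodule :=
  LinearMap.lTensorHom A ∘ₗ T.mul.flip

@[simp] theorem convRight_tmul (f : T.toSubmodule) (a : A) (g : T.toSubmodule) :
    convRight T f (a ⊗ₜ g) = a ⊗ₜ[R] T.mul g f := rfl

theorem convRight_mul (g f : T.toSubmodule) (t : A ⊗[R] T.toSubmodule) :
    convRight T (T.mul g f) t = convRight T f (convRight T g t) := by
  induction t with
  | zero => simp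
  | add s t hs ht => simp only [map_add, hs, ht]
  | tmul a k => simp [T.mul_assoc]

theorem convRight_ract (f : T.toSubmodule) (b : A) (t : A ⊗[R] T.toSubmodule) :
    convRight T f (ract T b t) = ract T b (convRight T f t) := by
  induction t with
  | zero => simp
  | add s t hs ht => simp only [map_add, hs, ht]
  | tmul a k => simp

/-- The multiplication `(a # f) (b # g) = ∑ a₀ b # (a₁ g) ⋆ f`. -/
def mulMap : A ⊗[R] T.toSubmodule →ₗ[R] A ⊗[R] T.toSubmodule →ₗ[R] A ⊗[R] T.toSubmodule :=
  TensorProduct.lift (LinearMap.mk₂ R (fun a f => convRight T f ∘ₗ lact T a)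
    (fun _ _ _ => by simp [LinearMap.comp_add]) (fun _ _ _ => by simp [LinearMap.comp_smul])
    (fun _ _ _ => by simp [LinearMap.add_comp]) (fun _ _ _ => by simp [LinearMap.smul_comp]))

theorem mulMap_tmul (a : A) (f : T.toSubmodule) (t : A ⊗[R] T.toSubmodule) :
    mulMap T (a ⊗ₜ f) t = convRight T f (lact T a t) := rfl

theorem mulMap_convRight (f : T.toSubmodule) (s t : A ⊗[R] T.toSubmodule) :
    mulMap T (convRight T f s) t = convRight T f (mulMap T s t) := by
  induction s with
  | zero => simp
  | add u v hu hv => simp only [map_add, LinearMap.add_apply, hu, hv]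
  | tmul a g => rw [convRight_tmul, mulMap_tmul, mulMap_tmul, convRight_mul]

theorem mulMap_ract (a : A) (s t : A ⊗[R] T.toSubmodule) :
    mulMap T s (ract T a t) = ract T a (mulMap T s t) := by
  induction s with
  | zero => simp
  | add u v hu hv => simp only [map_add, LinearMap.add_apply, hu, hv]
  | tmul b g => rw [mulMap_tmul, mulMap_tmul, lact_ract, convRight_ract]

theorem mulMap_ract_left (a : A) (s t : A ⊗[R] T.toSubmodule) :
    mulMap T (ract T a s) t = mulMap T s (lact T a t) := by
  induction s with
  | zero => simp
  | add u v hu hv => simp only [map_add, LinearMap.add_apply, hu, hv]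
  | tmul b g => rw [ract_tmul, mulMap_tmul, mulMap_tmul, lact_mul]

/-- `a (t ⋆ g) = ∑ (a₀ t) ⋆ (a₁ g)`. -/
theorem lact_convRight (a : A) (g : T.toSubmodule) (t : A ⊗[R] T.toSubmodule) :
    lact T a (convRight T g t) =
      TensorProduct.lift ((LinearMap.llcomp R (A ⊗[R] T.toSubmodule) (A ⊗[R] T.toSubmodule)
        (A ⊗[R] T.toSubmodule)).flip.compl₁₂ (lact T) (convRight T ∘ₗ T.act.flip g))
          (D.coact a) t := by
  induction t with
  | zero => simp
  | add u v hu hv => simp only [map_add, hu, hv]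
  | tmul b k =>
    let Φ : A ⊗[R] (H ⊗[R] H) →ₗ[R] A ⊗[R] T.toSubmodule :=
      TensorProduct.map (LinearMap.mulRight R b)
        (TensorProduct.lift (T.mul.compl₁₂ (T.act.flip k) (T.act.flip g)))
    have h1 : ∀ s : A ⊗[R] H, tensorAct T s (convRight T g (b ⊗ₜ k)) =
        Φ ((Coalgebra.comul (R := R) (A := H)).lTensor A s) := by
      intro s
      induction s with
      | zero => simp
      | add u v hu hv => simp only [map_add, LinearMap.add_apply, hu, hv]
      | tmul x h =>
        rw [convRight_tmul, tensorAct_tmul, T.act_convolution]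
        rfl
    have h2 : ∀ s : A ⊗[R] H,
        TensorProduct.lift ((LinearMap.llcomp R (A ⊗[R] T.toSubmodule) (A ⊗[R] T.toSubmodule)
          (A ⊗[R] T.toSubmodule)).flip.compl₁₂ (lact T) (convRight T ∘ₗ T.act.flip g))
            s (b ⊗ₜ k) =
        Φ (TensorProduct.assoc R A H H (D.coact.toLinearMap.rTensor H s)) := by
      intro s
      induction s with
      | zero => simp
      | add u v hu hv => simp only [map_add, LinearMap.add_apply, hu, hv]
      | tmul x h =>
        change convRight T (T.act h g) (tensorAct T (D.coact x) (b ⊗ₜ k)) = _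
        rw [LinearMap.rTensor_tmul, AlgHom.toLinearMap_apply]
        induction D.coact x with
        | zero => simp
        | add u v hu hv => simp only [map_add, LinearMap.add_apply, add_tmul, hu, hv]
        | tmul y l => rfl
    rw [lact_apply, h1, h2, D.coact_coassoc]

theorem mulMap_lact (a : A) (s t : A ⊗[R] T.toSubmodule) :
    mulMap T (lact T a s) t = lact T a (mulMap T s t) := by
  induction s with
  | zero => simp
  | add u v hu hv => simp only [map_add, LinearMap.add_apply, hu, hv]
  | tmul b g =>
    rw [mulMap_tmul, lact_convRight, lact_apply]
    induction D.coact a with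
    | zero => simp
    | add u v hu hv => simp only [map_add, LinearMap.add_apply, hu, hv]
    | tmul x h =>
      rw [tensorAct_tmul, mulMap_tmul, lact_mul]
      rfl

theorem mulMap_assoc (s t u : A ⊗[R] T.toSubmodule) :
    mulMap T (mulMap T s t) u = mulMap T s (mulMap T t u) := by
  induction s with
  | zero => simp
  | add u v hu hv => simp only [map_add, LinearMap.add_apply, hu, hv]
  | tmul a f => rw [mulMap_tmul, mulMap_tmul, mulMap_convRight, mulMap_lact]

instance : NonUnitalRing (OpSmash T) where
  mul := fun s t => mulMap T s t
  left_distrib s := map_add (mulMap T s)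
  right_distrib s t u := LinearMap.congr_fun (map_add (mulMap T) s t) u
  zero_mul t := LinearMap.congr_fun (map_zero (mulMap T)) t
  mul_zero s := map_zero (mulMap T s)
  mul_assoc := mulMap_assoc T

instance : Module A (OpSmash T) where
  smul a t := lact T a t
  one_smul := lact_one T
  mul_smul := lact_mul T
  smul_zero a := map_zero (lact T a)
  smul_add a := map_add (lact T a)
  add_smul a b t := LinearMap.congr_fun (map_add (lact T) a b) t
  zero_smul t := LinearMap.congr_fun (map_zero (lact T)) t

instance : Module Aᵐᵒᵖ (OpSmash T) where
  smul a t := ract T a.unop t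
  one_smul := ract_one T
  mul_smul a b := ract_mul T b.unop a.unop
  smul_zero a := map_zero (ract T a.unop)
  smul_add a := map_add (ract T a.unop)
  add_smul a b := ract_add T a.unop b.unop
  zero_smul := ract_zero T

instance : IsARing R A (OpSmash T) where
  smul_assoc r a t := LinearMap.congr_fun (map_smul (lact T) r a) t
  isScalarTower_op := ⟨fun r a t => ract_rsmul T r a.unop t⟩
  smul_comm a b t := lact_ract T a b.unop t
  smul_mul := mulMap_lact T
  mul_op_smul := mulMap_ract T
  op_smul_mul := mulMap_ract_left T

/-- The underlying linear map `a # f ↦ [c ↦ a f(c)]` of `β`. -/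
def betaLin : A ⊗[R] T.toSubmodule →ₗ[R] C →ₗ[R] A :=
  TensorProduct.lift (LinearMap.mk₂ R (fun a f => LinearMap.toSpanSingleton R A a ∘ₗ f.1)
    (fun _ _ _ => by ext; simp) (fun r _ _ => by ext; simp [smul_comm r])
    (fun _ _ _ => by ext; simp [add_smul]) (fun _ _ _ => by ext; simp [mul_smul]))

@[simp] theorem betaLin_tmul (a : A) (f : T.toSubmodule) (c : C) :
    betaLin T (a ⊗ₜ f) c = f.1 c • a := rfl

end OpSmash

end OpSmash
namespace OpSmash

variable {R H A C : Type u} [CommRing R] [Ring H] [Bialgebra R H] [Ring A] [Algebra R A]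
  [AddCommGroup C] [Module R C] [Coalgebra R C] {D : DoiKoppinen R H A C} (T : HSubalgebra D)

theorem betaLin_ract (a : A) (t : A ⊗[R] T.toSubmodule) (c : C) :
    betaLin T (ract T a t) c = betaLin T t c * a := by
  induction t with
  | zero => simp
  | add u v hu hv => simp only [map_add, LinearMap.add_apply, add_mul, hu, hv]
  | tmul b f => simp

theorem betaLin_lact (a : A) (t : A ⊗[R] T.toSubmodule) (c : C) :
    betaLin T (lact T a t) c = extendLeft (betaLin T t) (D.psi c a) := by
  rw [lact_apply, D.psi_apply]
  induction D.coact a with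
  | zero => simp
  | add u v hu hv => simp only [map_add, LinearMap.add_apply, hu, hv]
  | tmul x h =>
    rw [LinearMap.lTensor_tmul, extendLeft_tmul]
    induction t with
    | zero => simp
    | add u v hu hv => simp only [map_add, LinearMap.add_apply, smul_add, hu, hv]
    | tmul b f => simp

theorem betaLin_convRight (f : T.toSubmodule) (t : A ⊗[R] T.toSubmodule) (c : C) :
    betaLin T (convRight T f t) c =
      TensorProduct.lift ((LinearMap.lsmul R A).flip.compl₁₂ (betaLin T t) f.1)
        (Coalgebra.comul c) := by
  induction t with
  | zero =>
    rw [map_zero, map_zero, LinearMap.zero_apply]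
    induction Coalgebra.comul (R := R) c with
    | zero => simp
    | add s t hs ht => simp only [map_add, ← hs, ← ht]; abel
    | tmul x y => simp
  | add u v hu hv =>
    simp only [map_add, LinearMap.add_apply, hu, hv]
    induction Coalgebra.comul (R := R) c with
    | zero => simp
    | add s t hs ht => simp only [map_add, ← hs, ← ht]; abel
    | tmul x y => simp
  | tmul b g =>
    rw [convRight_tmul, betaLin_tmul]
    change convolution R C g.1 f.1 c • b = _
    rw [convolution_apply]
    induction Coalgebra.comul (R := R) c with
    | zero => simp
    | add s t hs ht => simp only [map_add, add_smul, hs, ht]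
    | tmul x y =>
      rw [TensorProduct.map_tmul, LinearMap.mul'_apply, mul_comm, mul_smul]
      rfl

theorem betaLin_mulMap (s t : A ⊗[R] T.toSubmodule) (c : C) :
    betaLin T (mulMap T s t) c =
      extendLeft (betaLin T t)
        (OpHom.conv ((OpHom.toLin D).symm (betaLin T s)) (Coalgebra.comul c)) := by
  induction s with
  | zero =>
    rw [map_zero, LinearMap.zero_apply, map_zero, LinearMap.zero_apply]
    induction Coalgebra.comul (R := R) c with
    | zero => simp
    | add s t hs ht => simp only [map_add, ← hs, ← ht]; abel
    | tmul x y => simp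
  | add u v hu hv =>
    simp only [map_add, LinearMap.add_apply, hu, hv]
    induction Coalgebra.comul (R := R) c with
    | zero => simp
    | add s t hs ht => simp only [map_add, ← hs, ← ht]; abel
    | tmul x y => simp
  | tmul a f =>
    rw [mulMap_tmul, betaLin_convRight]
    induction Coalgebra.comul (R := R) c with
    | zero => simp
    | add s t hs ht => simp only [map_add, hs, ht]
    | tmul x y =>
      rw [TensorProduct.lift.tmul, LinearMap.compl₁₂_apply, LinearMap.flip_apply,
        LinearMap.lsmul_apply, betaLin_lact, OpHom.conv_tmul, OpHom.toLin_symm_apply,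
        betaLin_tmul, map_smul, extendLeft_rsmul]

/-- The morphism of `A`-rings `β : A #ᵒᵖ T → #ᵒᵖ(C, A)`, `a # f ↦ [c ↦ a f(c)]`. -/
def beta : ARingHom R A (OpSmash T) (OpHom D) where
  toLinearMap := (OpHom.toLin D).symm.toLinearMap ∘ₗ betaLin T
  map_smul a t := OpHom.ext fun c => betaLin_lact T a t c
  map_op_smul a t := OpHom.ext fun c => betaLin_ract T a t c
  map_mul s t := OpHom.ext fun c => betaLin_mulMap T s t c

/-- The morphism of `A`-rings `κ = φ ∘ β : A #ᵒᵖ T → *(A ⊗ C)`,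
`a # f ↦ [ã ⊗ c ↦ ã a f(c)]`. -/
def kappa : ARingHom R A (OpSmash T) (LeftDual R A (DKCoring D)) :=
  (OpHom.phiHom D).comp (beta T)

end OpSmash

/-! ### Doi-Koppinen modules -/

section DKModule

variable {R H A C : Type u} [CommRing R] [Ring H] [Bialgebra R H] [Ring A] [Algebra R A]
  [AddCommGroup C] [Module R C] [Coalgebra R C]

/-- A right-right Doi-Koppinen module: a right `A`-module `M` with a right `C`-comodule structure
`ρ` such that `ρ(m a) = ∑ m₀ a₀ ⊗ m₁ a₁`. -/
structure DKModule (D : DoiKoppinen R H A C) where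
  carrier : Type u
  [addCommGroup : AddCommGroup carrier]
  [module : Module R carrier]
  [opModule : Module Aᵐᵒᵖ carrier]
  [isScalarTower : IsScalarTower R Aᵐᵒᵖ carrier]
  /-- the coaction `m ↦ ∑ m₀ ⊗ m₁` -/
  coact : carrier →ₗ[R] carrier ⊗[R] C
  coassoc : ∀ m, TensorProduct.assoc R carrier C C (coact.rTensor C (coact m)) =
    (Coalgebra.comul (R := R) (A := C)).lTensor carrier (coact m)
  counit : ∀ m, (Coalgebra.counit (R := R) (A := C)).lTensor carrier (coact m) = m ⊗ₜ[R] (1 : R)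
  coact_op_smul : ∀ (a : A) m, coact (op a • m) = D.diag carrier (coact m ⊗ₜ D.coact a)

namespace DKModule

attribute [instance] DKModule.addCommGroup DKModule.module DKModule.opModule
  DKModule.isScalarTower

variable {D : DoiKoppinen R H A C}

/-- Morphisms: right `A`-linear and `C`-colinear maps. -/
@[ext] structure Hom (M N : DKModule D) where
  toLinearMap : M.carrier →ₗ[Aᵐᵒᵖ] N.carrier
  map_coact : ∀ m, N.coact (toLinearMap m) =
    (toLinearMap.restrictScalars R).rTensor C (M.coact m)

/-- The category `M(H)_A^C` of Doi-Koppinen modules. -/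
instance : Category.{u} (DKModule D) where
  Hom M N := Hom M N
  id M := ⟨LinearMap.id, fun m => (LinearMap.congr_fun (LinearMap.rTensor_id C _) _).symm⟩
  comp f g := ⟨g.toLinearMap ∘ₗ f.toLinearMap, fun m => by
    rw [LinearMap.comp_apply, g.map_coact, f.map_coact, ← LinearMap.rTensor_comp_apply]
    rfl⟩

/-- For `f : C → A`, the map `m ⊗ c ↦ m f(c)`, linear in `f`. -/
def evalMap (M : DKModule D) : (C →ₗ[R] A) →ₗ[R] M.carrier ⊗[R] C →ₗ[R] M.carrier :=
  LinearMap.compRight R (rightMul R A M.carrier) ∘ₗ LinearMap.lTensorHom M.carrier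

@[simp] theorem evalMap_tmul (M : DKModule D) (f : C →ₗ[R] A) (m : M.carrier) (c : C) :
    M.evalMap f (m ⊗ₜ c) = op (f c) • m := rfl

/-- The action `m f = ∑ m₀ f(m₁)` of `#ᵒᵖ(C, A)` on a Doi-Koppinen module. -/
def opAct (M : DKModule D) : M.carrier →ₗ[R] OpHom D →ₗ[R] M.carrier :=
  LinearMap.mk₂ R (fun m f => M.evalMap (OpHom.toLin D f) (M.coact m))
    (fun _ _ _ => by simp) (fun _ _ _ => by simp) (fun _ _ _ => by simp) (fun _ _ _ => by simp)

theorem opAct_apply (M : DKModule D) (m : M.carrier) (f : OpHom D) :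
    M.opAct m f = M.evalMap (OpHom.toLin D f) (M.coact m) := rfl

theorem evalMap_op_smul (M : DKModule D) (a : A) (f : OpHom D) (t : M.carrier ⊗[R] C) :
    M.evalMap (OpHom.toLin D (op a • f)) t = op a • M.evalMap (OpHom.toLin D f) t := by
  induction t with
  | zero => simp
  | add u v hu hv => simp only [map_add, smul_add, hu, hv]
  | tmul m c => simp [mul_smul]

theorem evalMap_diag (M : DKModule D) (a : A) (f : OpHom D) (m : M.carrier) (c : C) :
    M.evalMap (OpHom.toLin D f) (D.diag M.carrier ((m ⊗ₜ c) ⊗ₜ D.coact a)) =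
      op (extendLeft (OpHom.toLin D f) (D.psi c a)) • m := by
  rw [D.psi_apply]
  induction D.coact a with
  | zero => simp
  | add u v hu hv => simp only [tmul_add, map_add, MulOpposite.op_add, add_smul, hu, hv]
  | tmul x h => simp [mul_smul]

theorem opAct_op_smul (M : DKModule D) (a : A) (m : M.carrier) (f : OpHom D) :
    M.opAct (op a • m) f = M.opAct m (a • f) := by
  rw [opAct_apply, opAct_apply, M.coact_op_smul]
  induction M.coact m with
  | zero => simp
  | add u v hu hv => simp only [add_tmul, map_add, hu, hv]
  | tmul m c => rw [evalMap_diag, evalMap_tmul, OpHom.toLin_apply, OpHom.smul_apply]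

theorem opAct_opAct (M : DKModule D) (m : M.carrier) (f g : OpHom D) :
    M.opAct (M.opAct m f) g = M.opAct m (f * g) := by
  let Φ : M.carrier ⊗[R] (C ⊗[R] C) →ₗ[R] M.carrier :=
    rightMul R A M.carrier ∘ₗ
      ((extendLeft (OpHom.toLin D g)).restrictScalars R ∘ₗ OpHom.conv f).lTensor M.carrier
  have h1 : ∀ t : M.carrier ⊗[R] C, M.opAct (M.evalMap (OpHom.toLin D f) t) g =
      Φ (TensorProduct.assoc R M.carrier C C (M.coact.rTensor C t)) := by
    intro t
    induction t with
    | zero => simp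
    | add u v hu hv => simp only [map_add, LinearMap.add_apply, hu, hv]
    | tmul n c =>
      rw [evalMap_tmul, opAct_op_smul, opAct_apply, LinearMap.rTensor_tmul]
      induction M.coact n with
      | zero => simp
      | add u v hu hv => simp only [add_tmul, map_add, hu, hv]
      | tmul n d => rfl
  have h2 : ∀ t : M.carrier ⊗[R] C, M.evalMap (OpHom.toLin D (f * g)) t =
      Φ ((Coalgebra.comul (R := R) (A := C)).lTensor M.carrier t) := by
    intro t
    induction t with
    | zero => simp
    | add u v hu hv => simp only [map_add, hu, hv]
    | tmul n c => rfl
  rw [opAct_apply M m f, opAct_apply M m, h1, h2, M.coassoc]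

end DKModule

/-- The functor from Doi-Koppinen modules to right `#ᵒᵖ(C, A)`-modules, `m f = ∑ m₀ f(m₁)`. -/
def DKModule.toOpHom (D : DoiKoppinen R H A C) : DKModule D ⥤ AMod R A (OpHom D) where
  obj M :=
    { carrier := M.carrier
      act := M.opAct
      act_act := M.opAct_opAct
      op_smul_act := M.opAct_op_smul
      act_op_smul := fun a m f => M.evalMap_op_smul a f (M.coact m) }
  map {M N} φ := ⟨φ.toLinearMap, fun m f => by
    change φ.toLinearMap (M.evalMap (OpHom.toLin D f) (M.coact m)) =
      N.evalMap (OpHom.toLin D f) (N.coact (φ.toLinearMap m))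
    rw [φ.map_coact]
    induction M.coact m with
    | zero => simp
    | add u v hu hv => simp only [map_add, hu, hv]
    | tmul n c => simp⟩

end DKModule
/-! ### Local projectivity, purity, density, and isomorphisms of categories -/

/-- An `R`-module `W` is locally projective if, for every epimorphism `π : L → N`, every
`g : W → N` and every finitely generated submodule `F ⊆ W`, there is some `g' : W → L` such that
`π ∘ g'` and `g` agree on `F`. -/
def LocallyProjective (R W : Type u) [CommRing R] [AddCommGroup W] [Module R W] : Prop :=
  ∀ (L N : Type u) [AddCommGroup L] [Module R L] [AddCommGroup N] [Module R N]
    (π : L →ₗ[R] N), Function.Surjective π → ∀ (g : W →ₗ[R] N) (F : Submodule R W), F.FG →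
      ∃ g' : W →ₗ[R] L, ∀ w ∈ F, π (g' w) = g w

/-- A submodule `K ⊆ W` is `A`-pure if the canonical map `A ⊗ K → A ⊗ W` is injective. -/
def IsPureFor {R W : Type*} (A : Type*) [CommRing R] [AddCommGroup A] [Module R A]
    [AddCommGroup W] [Module R W] (K : Submodule R W) : Prop :=
  Function.Injective (K.subtype.lTensor A)

/-- The finite topology on a set `F` of functions `X → Y`: the topology of pointwise convergence
with respect to the discrete topology on `Y`. -/
abbrev finiteTopology (F X Y : Type*) [FunLike F X Y] : TopologicalSpace F :=
  letI : TopologicalSpace Y := ⊥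
  TopologicalSpace.induced (fun f : F => (f : X → Y)) inferInstance

/-- Density in the finite topology. -/
def FiniteDense {F X Y : Type*} [FunLike F X Y] (S : Set F) : Prop :=
  letI := finiteTopology F X Y
  Dense S

/-- Density in the finite topology: on every finite set, every function agrees with some
function in `S`. -/
theorem finiteDense_iff {F X Y : Type*} [FunLike F X Y] (S : Set F) :
    FiniteDense S ↔ ∀ (f : F) (s : Finset X), ∃ g ∈ S, ∀ x ∈ s, g x = f x := by
  let : TopologicalSpace Y := ⊥
  have : DiscreteTopology Y := ⟨rfl⟩
  let : TopologicalSpace F := finiteTopology F X Y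
  have hc : ∀ x : X, Continuous fun f : F => f x := fun x =>
    (continuous_apply x).comp continuous_induced_dom
  change Dense S ↔ _
  constructor
  · intro h f s
    have ho : IsOpen {g : F | ∀ x ∈ s, g x = f x} := by
      have : {g : F | ∀ x ∈ s, g x = f x} = ⋂ x ∈ s, (fun g : F => g x) ⁻¹' {f x} := by
        ext g; simp
      rw [this]
      exact isOpen_biInter_finset fun x _ => (isOpen_discrete _).preimage (hc x)
    obtain ⟨g, hg, hgS⟩ := h.inter_open_nonempty _ ho ⟨f, fun _ _ => rfl⟩
    exact ⟨g, hgS, hg⟩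
  · intro h
    rw [dense_iff_inter_open]
    rintro U ⟨V, hV, rfl⟩ ⟨f, hf⟩
    obtain ⟨I, u, hu, hI⟩ := isOpen_pi_iff.1 hV f hf
    obtain ⟨g, hg, hgs⟩ := h f I
    exact ⟨g, hI fun x hx => by
      change g x ∈ u x
      rw [hgs x hx]
      exact (hu x hx).2, hg⟩

/-- A functor is an isomorphism of categories if it is bijective on objects and on morphisms. -/
def IsIsoOfCategories {𝒳 𝒴 : Type*} [Category 𝒳] [Category 𝒴] (G : 𝒳 ⥤ 𝒴) : Prop :=
  Function.Bijective G.obj ∧ ∀ X Y : 𝒳, Function.Bijective (G.map : (X ⟶ Y) → _)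

/-- The coring `A ⊗ C` as a right module over `#ᵒᵖ(C, A)`. -/
def DKCoring.opHomModule {R H A C : Type u} [CommRing R] [Ring H] [Bialgebra R H] [Ring A]
    [Algebra R A] [AddCommGroup C] [Module R C] [Coalgebra R C] (D : DoiKoppinen R H A C) :
    AMod R A (OpHom D) :=
  (AMod.restrict (OpHom.phiHom D)).obj (Coring.regular R A (DKCoring D))

/-- The coring `A ⊗ C` as a right module over `A #ᵒᵖ T`. -/
def DKCoring.opSmashModule {R H A C : Type u} [CommRing R] [Ring H] [Bialgebra R H] [Ring A]
    [Algebra R A] [AddCommGroup C] [Module R C] [Coalgebra R C] {D : DoiKoppinen R H A C}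
    (T : HSubalgebra D) : AMod R A (OpSmash T) :=
  (AMod.restrict (OpSmash.kappa T)).obj (Coring.regular R A (DKCoring D))

end

/-!
The category `𝓜(H)_A^C` consists of the rational modules over `#ᵒᵖ(C, A)`. If `C` is locally
projective, a tensor in `M ⊗ C` is determined by its evaluations at any set of maps `C → A` that is
dense on functionals. So the action of such a set of maps determines the coaction, a linear map
compatible with the action is colinear, and a submodule inherits the coaction. Rationality thus
passes to submodules, quotients and direct sums, and `A ⊗ C` is rational. Conversely, the coaction
embeds `M` into the cofree module `M ⊗ C`, a quotient of a direct sum of copies of `A ⊗ C`.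
Therefore the rational modules are the subgenerated ones. If `C` is finitely generated and
projective, every unital module is rational.

For the Grothendieck property, the functor from `𝓜(H)_A^C` to right `A`-modules that forgets the
coaction is left adjoint to `M ↦ M ⊗ C` and comonadic. If `C` is flat, the comonad is left exact,
so finite limits and all colimits are computed in `A`-modules, and exactness of filtered colimits is
inherited. A coaction involves only finitely many elements of `M` at a time, so each element lies in
a subobject that is countably generated over `A`. Those form a set up to isomorphism, and their
coproduct is a separator.
-/

noncomputable section

/-! ### Evaluations and local projectivity -/

theorem exists_finset_lTensor_congr {R M W : Type*} (L : Type*) [CommRing R] [AddCommGroup M]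
    [Module R M] [AddCommGroup W] [Module R W] [AddCommGroup L] [Module R L] (t : M ⊗[R] W) :
    ∃ F : Finset W, ∀ f g : W →ₗ[R] L, (∀ w ∈ F, f w = g w) → f.lTensor M t = g.lTensor M t := by
  classical
  obtain ⟨S, rfl⟩ := TensorProduct.exists_finset t
  refine ⟨S.image Prod.snd, fun f g hfg => ?_⟩
  simp only [map_sum, LinearMap.lTensor_tmul]
  exact Finset.sum_congr rfl fun i hi => by rw [hfg _ (Finset.mem_image_of_mem _ hi)]

namespace LocallyProjective

variable {R W : Type u} [CommRing R] [AddCommGroup W] [Module R W]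

theorem exists_finsupp_coordinates (hW : LocallyProjective R W) (F : Finset W) :
    ∃ g : W →ₗ[R] (W →₀ R), ∀ w ∈ F, Finsupp.linearCombination R id (g w) = w := by
  obtain ⟨g, hg⟩ := hW (W →₀ R) W (Finsupp.linearCombination R id)
    (Finsupp.linearCombination_id_surjective R W) LinearMap.id (Submodule.span R F) ⟨F, rfl⟩
  exact ⟨g, fun w hw => hg w (Submodule.subset_span hw)⟩

theorem tensor_ext (hW : LocallyProjective R W) {M : Type*} [AddCommGroup M] [Module R M]
    {s t : M ⊗[R] W} (h : ∀ f : Module.Dual R W, f.lTensor M s = f.lTensor M t) : s = t := by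
  classical
  obtain ⟨F, hF⟩ := exists_finset_lTensor_congr W s
  obtain ⟨G, hG⟩ := exists_finset_lTensor_congr W t
  obtain ⟨g, hg⟩ := hW.exists_finsupp_coordinates (F ∪ G)
  have hgst : g.lTensor M s = g.lTensor M t := by
    refine (TensorProduct.finsuppScalarRight R R M W).injective (Finsupp.ext fun w => ?_)
    rw [finsuppScalarRight_apply, finsuppScalarRight_apply, ← LinearMap.lTensor_comp_apply,
      ← LinearMap.lTensor_comp_apply, h]
  calc s = (Finsupp.linearCombination R id ∘ₗ g).lTensor M s := by
        rw [hF _ LinearMap.id fun w hw => hg w (Finset.mem_union_left G hw)]; simp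
    _ = (Finsupp.linearCombination R id ∘ₗ g).lTensor M t := by
        rw [LinearMap.lTensor_comp_apply, hgst, ← LinearMap.lTensor_comp_apply]
    _ = t := by
        rw [hG _ LinearMap.id fun w hw => hg w (Finset.mem_union_right F hw)]; simp

end LocallyProjective

section EvalAt

variable {R A C M N : Type*} [CommRing R] [Ring A] [Algebra R A] [AddCommGroup C] [Module R C]
  [AddCommGroup M] [Module R M] [Module Aᵐᵒᵖ M] [IsScalarTower R Aᵐᵒᵖ M]
  [AddCommGroup N] [Module R N] [Module Aᵐᵒᵖ N] [IsScalarTower R Aᵐᵒᵖ N]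

variable (M) in
/-- The map `M ⊗ C → M`, `m ⊗ c ↦ m f(c)`, for a right `A`-module `M` and `f : C → A`. -/
def evalAt (f : C →ₗ[R] A) : M ⊗[R] C →ₗ[R] M :=
  rightMul R A M ∘ₗ f.lTensor M

@[simp] theorem evalAt_tmul (f : C →ₗ[R] A) (m : M) (c : C) :
    evalAt M f (m ⊗ₜ c) = op (f c) • m := rfl

theorem evalAt_rTensor (φ : M →ₗ[Aᵐᵒᵖ] N) (f : C →ₗ[R] A) (t : M ⊗[R] C) :
    evalAt N f ((φ.restrictScalars R).rTensor C t) = φ (evalAt M f t) := by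
  induction t with
  | zero => simp
  | add s t hs ht => simp only [map_add, hs, ht]
  | tmul m c => simp

theorem evalAt_self (f : C →ₗ[R] A) (t : A ⊗[R] C) : evalAt A f t = extendLeft f t := by
  induction t with
  | zero => simp
  | add s t hs ht => simp only [map_add, hs, ht]
  | tmul a c => simp

theorem evalAt_algebraMap (f : Module.Dual R C) (t : M ⊗[R] C) :
    evalAt M (Algebra.linearMap R A ∘ₗ f) t = TensorProduct.rid R M (f.lTensor M t) := by
  induction t with
  | zero => simp
  | add s t hs ht => simp only [map_add, hs, ht]
  | tmul m c => simp [Algebra.algebraMap_eq_smul_one]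

theorem exists_finset_evalAt_congr (t : M ⊗[R] C) :
    ∃ F : Finset C, ∀ f g : C →ₗ[R] A, (∀ c ∈ F, f c = g c) → evalAt M f t = evalAt M g t := by
  obtain ⟨F, hF⟩ := exists_finset_lTensor_congr A t
  exact ⟨F, fun f g hfg => congrArg (rightMul R A M) (hF f g hfg)⟩

theorem LocallyProjective.evalAt_ext {R C : Type u} [CommRing R] [Algebra R A] [AddCommGroup C]
    [Module R C] [Module R M] [IsScalarTower R Aᵐᵒᵖ M] (hC : LocallyProjective R C)
    {S : Set (C →ₗ[R] A)}
    (hS : ∀ (f : Module.Dual R C) (F : Finset C),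
      ∃ g ∈ S, ∀ c ∈ F, g c = algebraMap R A (f c))
    {s t : M ⊗[R] C} (h : ∀ g ∈ S, evalAt M g s = evalAt M g t) : s = t := by
  classical
  obtain ⟨F, hF⟩ := exists_finset_evalAt_congr (A := A) s
  obtain ⟨G, hG⟩ := exists_finset_evalAt_congr (A := A) t
  refine hC.tensor_ext fun f => (TensorProduct.rid R M).injective ?_
  obtain ⟨g, hgS, hg⟩ := hS f (F ∪ G)
  calc TensorProduct.rid R M (f.lTensor M s) = evalAt M g s := by
        rw [← evalAt_algebraMap (A := A)]
        exact (hF _ _ fun c hc => hg c (Finset.mem_union_left G hc)).symm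
    _ = evalAt M g t := h g hgS
    _ = TensorProduct.rid R M (f.lTensor M t) := by
        rw [← evalAt_algebraMap (A := A)]
        exact hG _ _ fun c hc => hg c (Finset.mem_union_right F hc)

/-- The right `A`-linear map `A → M`, `a ↦ m a`. -/
def orbitMap (m : M) : A →ₗ[Aᵐᵒᵖ] M where
  toFun a := op a • m
  map_add' a b := by rw [MulOpposite.op_add, add_smul]
  map_smul' b a := by
    rw [MulOpposite.smul_eq_mul_unop, MulOpposite.op_mul, mul_smul, op_unop, RingHom.id_apply]

@[simp] theorem orbitMap_apply (m : M) (a : A) : orbitMap m a = op a • m := rfl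

end EvalAt

/-! ### The comodule `M ⊗ C` -/

section ComulRight

variable {R C M N : Type*} [CommRing R] [AddCommGroup C] [Module R C] [Coalgebra R C]
  [AddCommGroup M] [Module R M] [AddCommGroup N] [Module R N]

variable (C M) in
/-- The coaction `m ⊗ c ↦ ∑ (m ⊗ c₁) ⊗ c₂` of the cofree comodule `M ⊗ C`. -/
def comulRight : M ⊗[R] C →ₗ[R] (M ⊗[R] C) ⊗[R] C :=
  (TensorProduct.assoc R M C C).symm.toLinearMap ∘ₗ (Coalgebra.comul (R := R) (A := C)).lTensor M

theorem comulRight_rTensor (φ : M →ₗ[R] N) (t : M ⊗[R] C) :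
    comulRight C N (φ.rTensor C t) = (φ.rTensor C).rTensor C (comulRight C M t) := by
  suffices h : comulRight C N ∘ₗ φ.rTensor C = (φ.rTensor C).rTensor C ∘ₗ comulRight C M from
    LinearMap.congr_fun h t
  refine TensorProduct.ext' fun m c => ?_
  change (TensorProduct.assoc R N C C).symm (φ m ⊗ₜ Coalgebra.comul c) =
    (φ.rTensor C).rTensor C ((TensorProduct.assoc R M C C).symm (m ⊗ₜ Coalgebra.comul c))
  induction Coalgebra.comul (R := R) c with
  | zero => simp
  | add s t hs ht => simp only [tmul_add, map_add, hs, ht]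
  | tmul x y => rfl

theorem comulRight_tmul (m : M) (c : C) :
    comulRight C M (m ⊗ₜ c) = (TensorProduct.mk R M C m).rTensor C (Coalgebra.comul c) := by
  change (TensorProduct.assoc R M C C).symm (m ⊗ₜ Coalgebra.comul c) = _
  induction Coalgebra.comul (R := R) c with
  | zero => simp
  | add s t hs ht => simp only [tmul_add, map_add, hs, ht]
  | tmul x y => rfl

theorem assoc_rTensor_comulRight (t : M ⊗[R] C) :
    TensorProduct.assoc R _ C C ((comulRight C M).rTensor C (comulRight C M t)) =
      (Coalgebra.comul (R := R) (A := C)).lTensor _ (comulRight C M t) := by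
  induction t with
  | zero => simp
  | add s t hs ht => simp only [map_add, hs, ht]
  | tmul m c =>
    have hmk : comulRight C M ∘ₗ TensorProduct.mk R M C m =
        (TensorProduct.mk R M C m).rTensor C ∘ₗ Coalgebra.comul :=
      LinearMap.ext (comulRight_tmul m)
    have hassoc (u : (C ⊗[R] C) ⊗[R] C) :
        TensorProduct.assoc R _ C C (((TensorProduct.mk R M C m).rTensor C).rTensor C u) =
          (TensorProduct.mk R M C m).rTensor (C ⊗[R] C) (TensorProduct.assoc R C C C u) := by
      simp [LinearMap.rTensor_tensor]
    rw [comulRight_tmul, ← LinearMap.rTensor_comp_apply, hmk, LinearMap.rTensor_comp_apply, hassoc,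
      Coalgebra.coassoc_apply, ← LinearMap.comp_apply, LinearMap.rTensor_comp_lTensor,
      ← LinearMap.lTensor_comp_rTensor, LinearMap.comp_apply]

theorem lTensor_counit_comulRight (t : M ⊗[R] C) :
    (Coalgebra.counit (R := R) (A := C)).lTensor _ (comulRight C M t) = t ⊗ₜ[R] (1 : R) := by
  induction t with
  | zero => simp
  | add s t hs ht => simp only [map_add, add_tmul, hs, ht]
  | tmul m c =>
    rw [comulRight_tmul, ← LinearMap.comp_apply, LinearMap.lTensor_comp_rTensor,
      ← LinearMap.rTensor_comp_lTensor, LinearMap.comp_apply, Coalgebra.lTensor_counit_comul]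
    rfl

theorem rTensor_counit_comulRight (t : M ⊗[R] C) :
    ((TensorProduct.rid R M).toLinearMap ∘ₗ
      (Coalgebra.counit (R := R) (A := C)).lTensor M).rTensor C (comulRight C M t) = t := by
  induction t with
  | zero => simp
  | add s t hs ht => simp only [map_add, hs, ht]
  | tmul m c =>
    have hmk : ((TensorProduct.rid R M).toLinearMap ∘ₗ
        (Coalgebra.counit (R := R) (A := C)).lTensor M) ∘ₗ TensorProduct.mk R M C m =
        LinearMap.toSpanSingleton R M m ∘ₗ Coalgebra.counit := by
      ext c
      simp
    rw [comulRight_tmul, ← LinearMap.rTensor_comp_apply, hmk, LinearMap.rTensor_comp_apply,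
      Coalgebra.rTensor_counit_comul]
    simp

end ComulRight

/-! ### Cofree Doi-Koppinen modules -/

section Cofree

variable {R H A C : Type u} [CommRing R] [Ring H] [Bialgebra R H] [Ring A] [Algebra R A]
  [AddCommGroup C] [Module R C] [Coalgebra R C] (D : DoiKoppinen R H A C)
  {M N : Type u} [AddCommGroup M] [Module R M] [Module Aᵐᵒᵖ M] [IsScalarTower R Aᵐᵒᵖ M]
  [AddCommGroup N] [Module R N] [Module Aᵐᵒᵖ N] [IsScalarTower R Aᵐᵒᵖ N]

namespace DoiKoppinen

theorem diag_rTensor (φ : M →ₗ[Aᵐᵒᵖ] N) (t : M ⊗[R] C) (s : A ⊗[R] H) :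
    D.diag N ((φ.restrictScalars R).rTensor C t ⊗ₜ s) =
      (φ.restrictScalars R).rTensor C (D.diag M (t ⊗ₜ s)) := by
  induction s with
  | zero => simp
  | add u v hu hv => simp only [tmul_add, map_add, hu, hv]
  | tmul x h =>
    induction t with
    | zero => simp
    | add u v hu hv => simp only [add_tmul, map_add, hu, hv]
    | tmul m c => simp

theorem diag_tmul_coact (m : M) (c : C) (a : A) :
    D.diag M ((m ⊗ₜ c) ⊗ₜ D.coact a) =
      ((orbitMap m).restrictScalars R).rTensor C (D.psi c a) := by
  rw [D.psi_apply]
  induction D.coact a with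
  | zero => simp
  | add s t hs ht => simp only [tmul_add, map_add, hs, ht]
  | tmul x h => simp

theorem diag_self_coact (t : A ⊗[R] C) (a : A) :
    D.diag A (t ⊗ₜ D.coact a) = D.coringAct a t := by
  induction t with
  | zero => simp
  | add s t hs ht => simp only [add_tmul, map_add, hs, ht]
  | tmul b c =>
    rw [diag_tmul_coact, D.coringAct_tmul]
    induction D.psi c a with
    | zero => simp
    | add s t hs ht => simp only [smul_add, map_add, hs, ht]
    | tmul x d => simp [smul_tmul']

theorem diag_coact_one (t : M ⊗[R] C) : D.diag M (t ⊗ₜ D.coact 1) = t := by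
  induction t with
  | zero => simp
  | add s t hs ht => rw [add_tmul, map_add, hs, ht]
  | tmul m c => rw [diag_tmul_coact, D.psi_one]; simp

theorem diag_coact_mul (t : M ⊗[R] C) (a b : A) :
    D.diag M (t ⊗ₜ D.coact (a * b)) = D.diag M (D.diag M (t ⊗ₜ D.coact a) ⊗ₜ D.coact b) := by
  induction t with
  | zero => simp
  | add s t hs ht => simp only [add_tmul, map_add, hs, ht]
  | tmul m c =>
    rw [diag_tmul_coact, diag_tmul_coact, diag_rTensor, diag_self_coact, D.psi_mul]

end DoiKoppinen

/-- The `R`-module `M ⊗ C`, to be given the right `A`-module structure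
`(m ⊗ c) a = ∑ m a₀ ⊗ c a₁`. It is a type synonym because `M ⊗ C` already carries the action
`(m ⊗ c) a = m a ⊗ c`. -/
def CofreeCarrier (_D : DoiKoppinen R H A C) (M : Type u) [AddCommGroup M] [Module R M] : Type u :=
  M ⊗[R] C

namespace CofreeCarrier

instance : AddCommGroup (CofreeCarrier D M) := inferInstanceAs (AddCommGroup (M ⊗[R] C))
instance : Module R (CofreeCarrier D M) := inferInstanceAs (Module R (M ⊗[R] C))

variable (M) in
/-- The identification of `M ⊗ C` with its type synonym. -/
def ofTensor : M ⊗[R] C ≃ₗ[R] CofreeCarrier D M := LinearEquiv.refl R (M ⊗[R] C)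

instance : Module Aᵐᵒᵖ (CofreeCarrier D M) where
  smul a t := ofTensor D M (D.diag M ((ofTensor D M).symm t ⊗ₜ D.coact a.unop))
  one_smul t := D.diag_coact_one (M := M) t
  mul_smul a b t := D.diag_coact_mul (M := M) t b.unop a.unop
  smul_zero a := by
    change D.diag M ((0 : M ⊗[R] C) ⊗ₜ _) = 0
    rw [zero_tmul, map_zero]
  smul_add a s t := by
    change D.diag M ((ofTensor D M).symm (s + t) ⊗ₜ _) = _
    rw [map_add, add_tmul, map_add]
    rfl
  add_smul a b t := by
    change D.diag M (_ ⊗ₜ D.coact (a.unop + b.unop)) = _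
    rw [map_add, tmul_add, map_add]
    rfl
  zero_smul t := by
    change D.diag M (_ ⊗ₜ D.coact 0) = 0
    rw [map_zero, tmul_zero, map_zero]

theorem op_smul_ofTensor (a : A) (t : M ⊗[R] C) :
    op a • ofTensor D M t = ofTensor D M (D.diag M (t ⊗ₜ D.coact a)) := rfl

instance : IsScalarTower R Aᵐᵒᵖ (CofreeCarrier D M) where
  smul_assoc r a t := by
    change D.diag M (_ ⊗ₜ D.coact (r • a.unop)) = r • D.diag M (_ ⊗ₜ D.coact a.unop)
    rw [map_smul, tmul_smul, map_smul]

theorem orbitMap_ofTensor (m : M) (c : C) :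
    (orbitMap (ofTensor D M (m ⊗ₜ c))).restrictScalars R =
      (ofTensor D M).toLinearMap ∘ₗ ((orbitMap m).restrictScalars R).rTensor C ∘ₗ D.psi c :=
  LinearMap.ext fun a => congrArg (ofTensor D M) (D.diag_tmul_coact m c a)

variable (M) in
/-- The coaction `m ⊗ c ↦ ∑ (m ⊗ c₁) ⊗ c₂`. -/
def coact : CofreeCarrier D M →ₗ[R] CofreeCarrier D M ⊗[R] C := comulRight C M

omit [Module Aᵐᵒᵖ M] [IsScalarTower R Aᵐᵒᵖ M] in
theorem coact_ofTensor (t : M ⊗[R] C) :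
    coact D M (ofTensor D M t) = (ofTensor D M).toLinearMap.rTensor C (comulRight C M t) :=
  (LinearMap.rTensor_id_apply C (M ⊗[R] C) (comulRight C M t)).symm

theorem diag_rTensor_mk (m : M) (u : C ⊗[R] C) (a : A) :
    D.diag (CofreeCarrier D M)
        (((ofTensor D M).toLinearMap ∘ₗ TensorProduct.mk R M C m).rTensor C u ⊗ₜ D.coact a) =
      ((ofTensor D M).toLinearMap ∘ₗ ((orbitMap m).restrictScalars R).rTensor C).rTensor C
        ((TensorProduct.assoc R A C C).symm (D.psiTwice a u)) := by
  induction u with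
  | zero => simp
  | add s t hs ht => simp only [map_add, add_tmul, hs, ht]
  | tmul x y =>
    rw [LinearMap.rTensor_tmul, D.diag_tmul_coact, D.psiTwice_tmul,
      LinearEquiv.symm_apply_apply, ← LinearMap.rTensor_comp_apply]
    exact congrArg (fun φ => φ.rTensor C (D.psi y a)) (orbitMap_ofTensor D m x)

theorem coact_op_smul (a : A) (t : CofreeCarrier D M) :
    coact D M (op a • t) = D.diag _ (coact D M t ⊗ₜ D.coact a) := by
  obtain ⟨t, rfl⟩ := (ofTensor D M).surjective t
  rw [op_smul_ofTensor, coact_ofTensor, coact_ofTensor]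
  induction t with
  | zero => simp
  | add s t hs ht => simp only [map_add, add_tmul, hs, ht]
  | tmul m c =>
    rw [D.diag_tmul_coact, comulRight_rTensor, comulRight_tmul, ← LinearMap.rTensor_comp_apply,
      ← LinearMap.rTensor_comp_apply, diag_rTensor_mk, ← D.psi_comul]
    rfl

end CofreeCarrier

variable (M) in
/-- The cofree Doi-Koppinen module `M ⊗ C` on a right `A`-module `M`: `M ↦ M ⊗ C` is right adjoint
to the functor forgetting the coaction. -/
abbrev DKModule.cofree : DKModule D where
  carrier := CofreeCarrier D M
  coact := CofreeCarrier.coact D M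
  coassoc := assoc_rTensor_comulRight (M := M)
  counit := lTensor_counit_comulRight (M := M)
  coact_op_smul := CofreeCarrier.coact_op_smul D

variable (R A C) in
/-- The counit of `C` as a map `C → A`; this is the unity of `#ᵒᵖ(C, A)`. -/
def counitMap : C →ₗ[R] A := Algebra.linearMap R A ∘ₗ Coalgebra.counit

theorem evalAt_counitMap (t : M ⊗[R] C) : evalAt M (counitMap R A C) t =
    TensorProduct.rid R M ((Coalgebra.counit (R := R) (A := C)).lTensor M t) :=
  evalAt_algebraMap _ t

variable {D}

namespace DKModule

theorem evalAt_counitMap_coact (M : DKModule D) (m : M.carrier) :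
    evalAt M.carrier (counitMap R A C) (M.coact m) = m := by
  rw [evalAt_counitMap, M.counit, TensorProduct.rid_tmul, one_smul]

theorem opAct_eq_evalAt (M : DKModule D) (m : M.carrier) (f : OpHom D) :
    M.opAct m f = evalAt M.carrier (OpHom.toLin D f) (M.coact m) := rfl

theorem evalAt_diag_coact (a : A) (f : OpHom D) (t : M ⊗[R] C) :
    evalAt M (OpHom.toLin D f) (D.diag M (t ⊗ₜ D.coact a)) =
      evalAt M (OpHom.toLin D (a • f)) t := by
  induction t with
  | zero => simp
  | add u v hu hv => simp only [add_tmul, map_add, hu, hv]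
  | tmul m c =>
    rw [D.diag_tmul_coact, evalAt_rTensor, evalAt_self, orbitMap_apply, ← OpHom.smul_apply,
      evalAt_tmul, OpHom.toLin_apply]

theorem evalAt_counitMap_diag_coact (t : M ⊗[R] C) (a : A) :
    evalAt M (counitMap R A C) (D.diag M (t ⊗ₜ D.coact a)) =
      op a • evalAt M (counitMap R A C) t := by
  induction t with
  | zero => simp
  | add u v hu hv => simp only [add_tmul, map_add, smul_add, hu, hv]
  | tmul m c =>
    rw [D.diag_tmul_coact, evalAt_rTensor, evalAt_self, counitMap, D.psi_counit, orbitMap_apply,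
      evalAt_tmul, smul_smul, ← MulOpposite.op_mul, Algebra.smul_def]
    rfl

variable (D M) in
/-- The right `A`-linear map `M ⊗ C → M`, `m ⊗ c ↦ m ε(c)`: the counit of the adjunction between
forgetting the coaction and forming the cofree module. -/
def cofreeCounit : CofreeCarrier D M →ₗ[Aᵐᵒᵖ] M where
  toFun t := evalAt M (counitMap R A C) ((CofreeCarrier.ofTensor D M).symm t)
  map_add' s t := by simp only [map_add]
  map_smul' a t := evalAt_counitMap_diag_coact _ a.unop

theorem rTensor_cofreeCounit_coact (t : CofreeCarrier D M) :
    ((cofreeCounit D M).restrictScalars R).rTensor C (CofreeCarrier.coact D M t) =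
      (CofreeCarrier.ofTensor D M).symm t := by
  have hcounit : (cofreeCounit D M).restrictScalars R ∘ₗ (CofreeCarrier.ofTensor D M).toLinearMap =
      (TensorProduct.rid R M).toLinearMap ∘ₗ (Coalgebra.counit (R := R) (A := C)).lTensor M :=
    LinearMap.ext evalAt_counitMap
  obtain ⟨t, rfl⟩ := (CofreeCarrier.ofTensor D M).surjective t
  rw [CofreeCarrier.coact_ofTensor, ← LinearMap.rTensor_comp_apply, hcounit,
    LinearEquiv.symm_apply_apply, rTensor_counit_comulRight]

theorem cofreeCounit_opAct (t : M ⊗[R] C) (f : OpHom D) :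
    cofreeCounit D M ((cofree D M).opAct (CofreeCarrier.ofTensor D M t) f) =
      evalAt M (OpHom.toLin D f) t := by
  rw [opAct_eq_evalAt, ← evalAt_rTensor]
  exact congrArg _ (rTensor_cofreeCounit_coact _)

theorem evalAt_cofree_opAct (t : M ⊗[R] C) (f g : OpHom D) :
    evalAt M (OpHom.toLin D g) ((CofreeCarrier.ofTensor D M).symm
      ((cofree D M).opAct (CofreeCarrier.ofTensor D M t) f)) =
      evalAt M (OpHom.toLin D (f * g)) t := by
  rw [← cofreeCounit_opAct, LinearEquiv.apply_symm_apply, opAct_opAct, cofreeCounit_opAct]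

theorem cofree_opAct_tmul (f : OpHom D) (m : M) (c : C) :
    (cofree D M).opAct (CofreeCarrier.ofTensor D M (m ⊗ₜ c)) f =
      CofreeCarrier.ofTensor D M (((orbitMap m).restrictScalars R).rTensor C
        (OpHom.conv f (Coalgebra.comul c))) := by
  have hcoact : (cofree D M).coact (CofreeCarrier.ofTensor D M (m ⊗ₜ c)) =
      ((CofreeCarrier.ofTensor D M).toLinearMap ∘ₗ TensorProduct.mk R M C m).rTensor C
        (Coalgebra.comul c) := by
    rw [LinearMap.rTensor_comp_apply, ← comulRight_tmul]
    exact CofreeCarrier.coact_ofTensor D _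
  rw [opAct_eq_evalAt, hcoact]
  induction Coalgebra.comul (R := R) c with
  | zero => simp
  | add s t hs ht => simp only [map_add, hs, ht]
  | tmul x y =>
    rw [LinearMap.rTensor_tmul, evalAt_tmul, OpHom.conv_tmul, ← D.diag_tmul_coact]
    rfl

variable (M) in
/-- The morphism `X → M ⊗ C` induced by a right `A`-linear map `X → M`. -/
def toCofree (X : DKModule D) (φ : X.carrier →ₗ[Aᵐᵒᵖ] M) : X ⟶ cofree D M where
  toLinearMap :=
    { toFun := fun x => CofreeCarrier.ofTensor D M ((φ.restrictScalars R).rTensor C (X.coact x))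
      map_add' := fun x y => by simp only [map_add]
      map_smul' := fun a x => by
        rw [← op_unop a, X.coact_op_smul, ← D.diag_rTensor]
        rfl }
  map_coact x := by
    have hcoassoc : comulRight C X.carrier (X.coact x) = X.coact.rTensor C (X.coact x) :=
      (LinearEquiv.symm_apply_eq _).2 (X.coassoc x).symm
    refine (CofreeCarrier.coact_ofTensor D
      ((φ.restrictScalars R).rTensor C (X.coact x))).trans ?_
    rw [comulRight_rTensor, hcoassoc,
      ← LinearMap.rTensor_comp_apply, ← LinearMap.rTensor_comp_apply]
    rfl

theorem toCofree_apply (X : DKModule D) (φ : X.carrier →ₗ[Aᵐᵒᵖ] M) (x : X.carrier) :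
    (toCofree M X φ).toLinearMap x =
      CofreeCarrier.ofTensor D M ((φ.restrictScalars R).rTensor C (X.coact x)) := rfl

theorem cofreeCounit_toCofree (X : DKModule D) (φ : X.carrier →ₗ[Aᵐᵒᵖ] M) (x : X.carrier) :
    cofreeCounit D M ((toCofree M X φ).toLinearMap x) = φ x :=
  (evalAt_rTensor φ _ _).trans (congrArg φ (X.evalAt_counitMap_coact x))

theorem toCofree_cofreeCounit_comp (X : DKModule D) (φ : X ⟶ cofree D M) :
    toCofree M X (cofreeCounit D M ∘ₗ φ.toLinearMap) = φ := by
  refine Hom.ext (LinearMap.ext fun x => ?_)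
  refine Eq.trans ?_ (rTensor_cofreeCounit_coact (D := D) (M := M) (φ.toLinearMap x))
  rw [φ.map_coact, ← LinearMap.rTensor_comp_apply]
  rfl

/-- A coaction of `C` on a right `A`-module `P` that turns `P` into a Doi-Koppinen module. -/
structure Coaction (D : DoiKoppinen R H A C) (P : Type u) [AddCommGroup P] [Module R P]
    [Module Aᵐᵒᵖ P] [IsScalarTower R Aᵐᵒᵖ P] where
  coact : P →ₗ[R] P ⊗[R] C
  rTensor_coact : ∀ p, coact.rTensor C (coact p) = comulRight C P (coact p)
  evalAt_coact : ∀ p, evalAt P (counitMap R A C) (coact p) = p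
  coact_op_smul : ∀ (a : A) p, coact (op a • p) = D.diag P (coact p ⊗ₜ D.coact a)

/-- The Doi-Koppinen module given by a coaction. -/
abbrev Coaction.toDKModule (ρ : Coaction D M) : DKModule D where
  carrier := M
  coact := ρ.coact
  coassoc p := (LinearEquiv.eq_symm_apply _).1 (ρ.rTensor_coact p)
  counit p := (TensorProduct.rid R M).injective <| by
    rw [← evalAt_counitMap (A := A), ρ.evalAt_coact, TensorProduct.rid_tmul, one_smul]
  coact_op_smul := ρ.coact_op_smul

end DKModule

end Cofree

/-! ### Direct sums of copies of a module -/

namespace AMod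

variable {R A B : Type u} [CommRing R] [Ring A] [Algebra R A] [NonUnitalRing B] [Module R B]
  [Module A B] [Module Aᵐᵒᵖ B] [IsARing R A B]

/-- The underlying right `A`-module of a direct sum of copies of `K`. -/
def copowerEquiv (K : AMod R A B) (I : Type u) :
    (I →₀ K.carrier) ≃ₗ[Aᵐᵒᵖ] (copower K I).carrier := LinearEquiv.refl _ (I →₀ K.carrier)

/-- The inclusion of a summand into a direct sum of copies of `K`. -/
def copowerSingle (K : AMod R A B) {I : Type u} (j : I) : K ⟶ copower K I :=
  ⟨(copowerEquiv K I).toLinearMap ∘ₗ Finsupp.lsingle j, fun m x =>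
    (Finsupp.mapRange_single (f := fun k => K.act k x) (hf := by simp) (a := j) (b := m)).symm⟩

theorem copower_induction {K : AMod R A B} {I : Type u} {p : (copower K I).carrier → Prop}
    (n : (copower K I).carrier) (zero : p 0)
    (single : ∀ (j : I) k, p ((copowerSingle K j).toLinearMap k))
    (add : ∀ s t, p s → p t → p (s + t)) : p n :=
  Finsupp.induction_linear (motive := p) n zero add single

/-- The morphism from a direct sum of copies of `K` given by a family of morphisms. -/
def copowerDesc {K L : AMod R A B} {I : Type u} (f : I → (K ⟶ L)) : copower K I ⟶ L :=
  have hsingle : ∀ j k, (Finsupp.lsum ℕ fun j => (f j).toLinearMap)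
      ((copowerEquiv K I).symm ((copowerSingle K j).toLinearMap k)) = (f j).toLinearMap k :=
    fun j k => Finsupp.lsum_single ℕ _ j k
  ⟨(Finsupp.lsum ℕ fun j => (f j).toLinearMap) ∘ₗ (copowerEquiv K I).symm.toLinearMap, fun m x => by
    induction m using copower_induction with
    | zero => simp
    | add s t hs ht => simp only [map_add, LinearMap.add_apply, hs, ht]
    | single j k =>
      rw [← (copowerSingle K j).map_act, LinearMap.comp_apply, LinearMap.comp_apply]
      exact (hsingle _ _).trans (((f j).map_act k x).trans
        (congrArg (fun l => L.act l x) (hsingle _ _).symm))⟩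

theorem copowerDesc_single {K L : AMod R A B} {I : Type u} (f : I → (K ⟶ L)) (j : I)
    (k : K.carrier) : (copowerDesc f).toLinearMap ((copowerSingle K j).toLinearMap k) =
      (f j).toLinearMap k :=
  Finsupp.lsum_single ℕ _ j k

theorem mk_act_eq (N : AMod R A B) (act : N.carrier →ₗ[R] B →ₗ[R] N.carrier)
    (act_act op_smul_act act_op_smul) (h : act = N.act) :
    AMod.mk N.carrier act act_act op_smul_act act_op_smul = N := by
  subst h
  rfl

end AMod

/-! ### Rational modules -/

section Rational

variable {R H A C : Type u} [CommRing R] [Ring H] [Bialgebra R H] [Ring A] [Algebra R A]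
  [AddCommGroup C] [Module R C] [Coalgebra R C] {D : DoiKoppinen R H A C}

namespace OpHom

variable (D) in
/-- The unity `c ↦ ε(c) 1` of `#ᵒᵖ(C, A)`. -/
def unit : OpHom D := (toLin D).symm (counitMap R A C)

theorem toLin_unit : toLin D (unit D) = counitMap R A C := rfl

theorem mul_unit (f : OpHom D) : f * unit D = f := by
  ext c
  have hone (g : OpHom D) : evalAt A (toLin D g) ((1 : A) ⊗ₜ c) = g c := by simp
  rw [← hone, ← DKModule.evalAt_cofree_opAct, toLin_unit, ← hone f]
  exact DKModule.cofreeCounit_opAct ((1 : A) ⊗ₜ c) f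

end OpHom

variable {B : Type u} [NonUnitalRing B] [Module R B] [Module A B] [Module Aᵐᵒᵖ B]
  {M N L : Type u} [AddCommGroup M] [Module R M] [Module Aᵐᵒᵖ M] [IsScalarTower R Aᵐᵒᵖ M]
  [AddCommGroup N] [Module R N] [Module Aᵐᵒᵖ N] [IsScalarTower R Aᵐᵒᵖ N]
  [AddCommGroup L] [Module R L] [Module Aᵐᵒᵖ L] [IsScalarTower R Aᵐᵒᵖ L]
  (β : ARingHom R A B (OpHom D))

namespace ARingHom

/-- The value of `β` at `b`, as a linear map `C → A`. -/
def lin (b : B) : C →ₗ[R] A := OpHom.toLin D (β.toLinearMap b)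

theorem evalAt_lin_ext (hC : LocallyProjective R C) (hβ : FiniteDense (Set.range β.toLinearMap))
    {s t : M ⊗[R] C} (h : ∀ b, evalAt M (β.lin b) s = evalAt M (β.lin b) t) : s = t := by
  refine hC.evalAt_ext (S := Set.range β.lin) (fun f F => ?_) (Set.forall_mem_range.2 h)
  obtain ⟨_, ⟨b, rfl⟩, hb⟩ := (finiteDense_iff _).1 hβ
    ((OpHom.toLin D).symm (Algebra.linearMap R A ∘ₗ f)) F
  exact ⟨_, ⟨b, rfl⟩, hb⟩

theorem exists_evalAt_lin (hβ : FiniteDense (Set.range β.toLinearMap)) (f : C →ₗ[R] A)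
    (t : M ⊗[R] C) : ∃ b, evalAt M (β.lin b) t = evalAt M f t := by
  obtain ⟨F, hF⟩ := exists_finset_evalAt_congr (A := A) t
  obtain ⟨_, ⟨b, rfl⟩, hb⟩ := (finiteDense_iff _).1 hβ ((OpHom.toLin D).symm f) F
  exact ⟨b, hF _ _ hb⟩

theorem mem_range_rTensor (hC : LocallyProjective R C)
    (hβ : FiniteDense (Set.range β.toLinearMap)) {i : N →ₗ[Aᵐᵒᵖ] L} {π : L →ₗ[Aᵐᵒᵖ] M}
    (hiπ : Function.Exact i π) (hπ : Function.Surjective π) {t : L ⊗[R] C}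
    (h : ∀ b, π (evalAt L (β.lin b) t) = 0) :
    t ∈ LinearMap.range ((i.restrictScalars R).rTensor C) := by
  have hexact : Function.Exact (i.restrictScalars R) (π.restrictScalars R) := hiπ
  refine (rTensor_exact C hexact hπ t).1 (β.evalAt_lin_ext hC hβ fun b => ?_)
  rw [evalAt_rTensor, map_zero, h]

end ARingHom

variable [IsARing R A B]

namespace AMod

/-- A `B`-module `N` is rational along `β : B → #ᵒᵖ(C, A)` if every `n` comes with some
`∑ nᵢ ⊗ cᵢ` such that `n b = ∑ nᵢ β(b)(cᵢ)` for all `b`, and `n = ∑ nᵢ ε(cᵢ)`. -/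
def IsRational (N : AMod R A B) : Prop :=
  ∀ n : N.carrier, ∃ t : N.carrier ⊗[R] C,
    (∀ b, N.act n b = evalAt N.carrier (β.lin b) t) ∧
      evalAt N.carrier (counitMap R A C) t = n

namespace IsRational

variable {β} {K N : AMod R A B}

theorem of_surjective (hK : IsRational β K) (p : K ⟶ N)
    (hp : Function.Surjective p.toLinearMap) : IsRational β N := fun n => by
  obtain ⟨k, rfl⟩ := hp n
  obtain ⟨t, hact, hcounit⟩ := hK k
  refine ⟨(p.toLinearMap.restrictScalars R).rTensor C t, fun b => ?_, ?_⟩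
  · rw [evalAt_rTensor, ← hact, p.map_act]
  · rw [evalAt_rTensor, hcounit]

theorem of_injective (hC : LocallyProjective R C) (hβ : FiniteDense (Set.range β.toLinearMap))
    (hK : IsRational β K) (i : N ⟶ K) (hi : Function.Injective i.toLinearMap) :
    IsRational β N := fun n => by
  obtain ⟨t, hact, hcounit⟩ := hK (i.toLinearMap n)
  obtain ⟨s, rfl⟩ := β.mem_range_rTensor hC hβ (LinearMap.exact_map_mkQ_range i.toLinearMap)
    (Submodule.mkQ_surjective _) (t := t) fun b => (Submodule.Quotient.mk_eq_zero _).2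
      ⟨N.act n b, (i.map_act n b).trans (hact b)⟩
  exact ⟨s, fun b => hi ((i.map_act n b).trans ((hact b).trans (evalAt_rTensor _ _ _))),
    hi ((evalAt_rTensor _ _ _).symm.trans hcounit)⟩

theorem copower (hK : IsRational β K) (I : Type u) : IsRational β (copower K I) := fun n => by
  induction n using copower_induction with
  | zero => exact ⟨0, fun b => by simp, by simp⟩
  | add x y hx hy =>
    obtain ⟨s, hs, hs'⟩ := hx
    obtain ⟨t, ht, ht'⟩ := hy
    exact ⟨s + t, fun b => by rw [map_add, map_add, LinearMap.add_apply, hs, ht],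
      by rw [map_add, hs', ht']⟩
  | single j k =>
    obtain ⟨t, hact, hcounit⟩ := hK k
    refine ⟨((copowerSingle K j).toLinearMap.restrictScalars R).rTensor C t, fun b => ?_, ?_⟩
    · rw [evalAt_rTensor, ← hact, (copowerSingle K j).map_act]
    · rw [evalAt_rTensor, hcounit]

theorem of_isSubgenerated (hC : LocallyProjective R C)
    (hβ : FiniteDense (Set.range β.toLinearMap)) (hK : IsRational β K)
    (hN : IsSubgenerated K N) : IsRational β N := by
  obtain ⟨I, L, p, i, hp, hi⟩ := hN
  exact ((hK.copower I).of_surjective p hp).of_injective hC hβ i hi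

theorem exists_coaction (hC : LocallyProjective R C)
    (hβ : FiniteDense (Set.range β.toLinearMap)) (hN : IsRational β N) :
    ∃ ρ : N.carrier →ₗ[R] N.carrier ⊗[R] C,
      (∀ n b, N.act n b = evalAt N.carrier (β.lin b) (ρ n)) ∧
        ∀ n, evalAt N.carrier (counitMap R A C) (ρ n) = n := by
  choose ρ hact hcounit using hN
  refine ⟨⟨⟨ρ, fun m n => ?_⟩, fun r n => ?_⟩, hact, hcounit⟩ <;>
    refine β.evalAt_lin_ext hC hβ fun b => ?_
  · rw [map_add, ← hact, ← hact, ← hact, map_add, LinearMap.add_apply]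
  · rw [map_smul, ← hact, RingHom.id_apply, ← hact, map_smul, LinearMap.smul_apply]

end IsRational

variable {β} {N : AMod R A B} {ρ : N.carrier →ₗ[R] N.carrier ⊗[R] C}

theorem coaction_op_smul (hC : LocallyProjective R C)
    (hβ : FiniteDense (Set.range β.toLinearMap))
    (hρ : ∀ n b, N.act n b = evalAt N.carrier (β.lin b) (ρ n)) (a : A) (n : N.carrier) :
    ρ (op a • n) = D.diag _ (ρ n ⊗ₜ D.coact a) :=
  β.evalAt_lin_ext hC hβ fun b => by
    rw [← hρ, N.op_smul_act, hρ, ARingHom.lin, ARingHom.lin, DKModule.evalAt_diag_coact,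
      β.map_smul]

theorem rTensor_coaction (hC : LocallyProjective R C)
    (hβ : FiniteDense (Set.range β.toLinearMap))
    (hρ : ∀ n b, N.act n b = evalAt N.carrier (β.lin b) (ρ n)) (n : N.carrier) :
    ρ.rTensor C (ρ n) = comulRight C N.carrier (ρ n) := by
  let ρ' : N.carrier →ₗ[Aᵐᵒᵖ] CofreeCarrier D N.carrier :=
    { toFun := fun n => CofreeCarrier.ofTensor D N.carrier (ρ n)
      map_add' := fun m n => by simp only [map_add]
      map_smul' := fun a n =>
        congrArg (CofreeCarrier.ofTensor D N.carrier) (coaction_op_smul hC hβ hρ a.unop n) }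
  have hρ' (b : B) : ρ' (N.act n b) =
      (DKModule.cofree D N.carrier).opAct (ρ' n) (β.toLinearMap b) :=
    (CofreeCarrier.ofTensor D N.carrier).symm.injective <| β.evalAt_lin_ext hC hβ fun b' =>
      calc evalAt N.carrier (β.lin b') (ρ (N.act n b)) =
            evalAt N.carrier (β.lin (b * b')) (ρ n) := by rw [← hρ, ← hρ, N.act_act]
        _ = _ := by
            rw [ARingHom.lin, β.map_mul]
            exact (DKModule.evalAt_cofree_opAct (ρ n) _ _).symm
  refine β.evalAt_lin_ext (M := CofreeCarrier D N.carrier) hC hβ fun b => ?_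
  calc evalAt (CofreeCarrier D N.carrier) (β.lin b) ((ρ'.restrictScalars R).rTensor C (ρ n)) =
        ρ' (N.act n b) := by rw [evalAt_rTensor, hρ]
    _ = _ := hρ' b

theorem IsRational.exists_dkModule (hC : LocallyProjective R C)
    (hβ : FiniteDense (Set.range β.toLinearMap)) (hN : IsRational β N) :
    ∃ M : DKModule D, (DKModule.toOpHom D ⋙ restrict β).obj M = N := by
  obtain ⟨ρ, hact, hcounit⟩ := hN.exists_coaction hC hβ
  let ρ' : DKModule.Coaction D N.carrier :=
    { coact := ρ
      rTensor_coact := rTensor_coaction hC hβ hact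
      evalAt_coact := hcounit
      coact_op_smul := coaction_op_smul hC hβ hact }
  exact ⟨ρ'.toDKModule, mk_act_eq N _ _ _ _ (LinearMap.ext₂ fun n b => (hact n b).symm)⟩

end AMod

namespace DKModule

/-- The functor from Doi-Koppinen modules to `B`-modules, `m b = ∑ m₀ β(b)(m₁)`. -/
abbrev toAMod : DKModule D ⥤ AMod R A B := toOpHom D ⋙ AMod.restrict β

variable {β}

theorem isRational (M : DKModule D) : AMod.IsRational β ((toAMod β).obj M) := fun m =>
  ⟨M.coact m, fun _ => rfl, M.evalAt_counitMap_coact m⟩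

theorem toAMod_map_bijective (hC : LocallyProjective R C)
    (hβ : FiniteDense (Set.range β.toLinearMap)) (M N : DKModule D) :
    Function.Bijective ((toAMod β).map : (M ⟶ N) → _) := by
  refine ⟨fun f g h => Hom.ext (congrArg AMod.Hom.toLinearMap h), fun φ => ⟨⟨φ.toLinearMap,
    fun m => β.evalAt_lin_ext hC hβ fun b => ?_⟩, rfl⟩⟩
  let ψ : M.carrier →ₗ[Aᵐᵒᵖ] N.carrier := φ.toLinearMap
  exact (φ.map_act m b).symm.trans (evalAt_rTensor ψ _ _).symm

theorem toAMod_obj_injective (hC : LocallyProjective R C)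
    (hβ : FiniteDense (Set.range β.toLinearMap)) :
    Function.Injective (toAMod (D := D) β).obj := fun M N h => by
  obtain ⟨M, ρ, _, _, _⟩ := M
  obtain ⟨N, ρ', _, _, _⟩ := N
  injection h with hcarrier haddCommGroup hmodule hopModule hact
  subst hcarrier
  obtain rfl := eq_of_heq haddCommGroup
  obtain rfl := eq_of_heq hmodule
  obtain rfl := eq_of_heq hopModule
  obtain rfl : ρ = ρ' := LinearMap.ext fun m => β.evalAt_lin_ext hC hβ fun b =>
    LinearMap.congr_fun₂ (eq_of_heq hact) m b
  rfl

theorem toAMod_isUnital (hβ : FiniteDense (Set.range β.toLinearMap)) (M : DKModule D) :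
    ((toAMod β).obj M).IsUnital := by
  refine (AddSubgroup.eq_top_iff' _).2 fun m => AddSubgroup.subset_closure ?_
  obtain ⟨b, hb⟩ := β.exists_evalAt_lin hβ (counitMap R A C) (M.coact m)
  exact ⟨m, b, hb.trans (M.evalAt_counitMap_coact m)⟩

end DKModule

end Rational

/-! ### Subgeneration by the coring -/

section Coring

variable {R H A C : Type u} [CommRing R] [Ring H] [Bialgebra R H] [Ring A] [Algebra R A]
  [AddCommGroup C] [Module R C] [Coalgebra R C] {D : DoiKoppinen R H A C}

namespace DKCoring

theorem smul_ofTensor (a : A) (t : A ⊗[R] C) :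
    a • ofTensor D t = ofTensor D (((orbitMap a).restrictScalars R).rTensor C t) := rfl

variable (D) in
/-- The coring `A ⊗ C` is the cofree Doi-Koppinen module on `A`, as a right `A`-module. -/
def toCofree : DKCoring D ≃ₗ[Aᵐᵒᵖ] CofreeCarrier D A where
  __ := ((ofTensor D).symm.restrictScalars R).trans (CofreeCarrier.ofTensor D A)
  map_smul' a w := congrArg (CofreeCarrier.ofTensor D A)
    (D.diag_self_coact ((ofTensor D).symm w) a.unop).symm

theorem toCofree_ofTensor (t : A ⊗[R] C) :
    toCofree D (ofTensor D t) = CofreeCarrier.ofTensor D A t := rfl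

theorem toCofree_act (w : DKCoring D) (f : OpHom D) :
    toCofree D (LeftDual.act (OpHom.phi f) w) = (DKModule.cofree D A).opAct (toCofree D w) f := by
  induction w using DKCoring.induction with
  | h0 => simp
  | h2 s t hs ht => simp only [map_add, LinearMap.add_apply, hs, ht]
  | h1 a c =>
    have htmul : tmul D a c = a • tmul D 1 c := by rw [smul_tmul, mul_one]
    conv_lhs => rw [htmul, LeftDual.act_smul, OpHom.act_phi, smul_ofTensor, toCofree_ofTensor]
    rw [← ofTensor_tmul, toCofree_ofTensor, DKModule.cofree_opAct_tmul]

end DKCoring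

variable {B : Type u} [NonUnitalRing B] [Module R B] [Module A B] [Module Aᵐᵒᵖ B]
  [IsARing R A B] {β : ARingHom R A B (OpHom D)}

namespace DKModule

variable (D) in
/-- The identification of the coring `A ⊗ C` with the cofree Doi-Koppinen module on `A`, as a
morphism of modules over `#ᵒᵖ(C, A)`. -/
def coringToCofree : DKCoring.opHomModule D ⟶ (toOpHom D).obj (cofree D A) :=
  ⟨(DKCoring.toCofree D).toLinearMap, DKCoring.toCofree_act⟩

theorem isRational_coring (hC : LocallyProjective R C)
    (hβ : FiniteDense (Set.range β.toLinearMap)) :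
    AMod.IsRational β ((AMod.restrict β).obj (DKCoring.opHomModule D)) :=
  (isRational (cofree D A)).of_injective hC hβ ((AMod.restrict β).map (coringToCofree D))
    (DKCoring.toCofree D).injective

section

variable {M N : Type u} [AddCommGroup M] [Module R M] [Module Aᵐᵒᵖ M] [IsScalarTower R Aᵐᵒᵖ M]
  [AddCommGroup N] [Module R N] [Module Aᵐᵒᵖ N] [IsScalarTower R Aᵐᵒᵖ N]

variable (D) in
/-- The action `φ ⊗ C` of the cofree module functor on a right `A`-linear map `φ`. -/
def cofreeMap (φ : M →ₗ[Aᵐᵒᵖ] N) : cofree D M ⟶ cofree D N :=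
  toCofree N (cofree D M) (φ ∘ₗ cofreeCounit D M)

theorem cofreeMap_ofTensor (φ : M →ₗ[Aᵐᵒᵖ] N) (t : M ⊗[R] C) :
    (cofreeMap D φ).toLinearMap (CofreeCarrier.ofTensor D M t) =
      CofreeCarrier.ofTensor D N ((φ.restrictScalars R).rTensor C t) := by
  conv_rhs => rw [← (CofreeCarrier.ofTensor D M).symm_apply_apply t,
    ← rTensor_cofreeCounit_coact, ← LinearMap.rTensor_comp_apply]
  rfl

variable (D) in
/-- The morphism `A ⊗ C → M ⊗ C`, `a ⊗ c ↦ m a ⊗ c`, of modules over `#ᵒᵖ(C, A)`. -/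
def coringToCofreeAt (m : M) : DKCoring.opHomModule D ⟶ (toOpHom D).obj (cofree D M) :=
  coringToCofree D ≫ (toOpHom D).map (cofreeMap D (orbitMap m))

theorem coringToCofreeAt_one_tmul (m : M) (c : C) :
    (coringToCofreeAt D m).toLinearMap (DKCoring.tmul D 1 c) =
      CofreeCarrier.ofTensor D M (m ⊗ₜ c) := by
  refine (cofreeMap_ofTensor (D := D) (orbitMap m) (1 ⊗ₜ c)).trans ?_
  simp

end

theorem copowerDesc_coringToCofreeAt_surjective (M : Type u) [AddCommGroup M] [Module R M]
    [Module Aᵐᵒᵖ M] [IsScalarTower R Aᵐᵒᵖ M] :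
    Function.Surjective
      (AMod.copowerDesc fun m : M => (AMod.restrict β).map (coringToCofreeAt D m)).toLinearMap := by
  intro t
  obtain ⟨t, rfl⟩ := (CofreeCarrier.ofTensor D M).surjective t
  induction t with
  | zero => exact ⟨0, (map_zero _).trans (map_zero _).symm⟩
  | add s t hs ht =>
    obtain ⟨x, hx⟩ := hs
    obtain ⟨y, hy⟩ := ht
    exact ⟨x + y, (map_add _ x y).trans ((congrArg₂ _ hx hy).trans (map_add _ s t).symm)⟩
  | tmul m c =>
    exact ⟨(AMod.copowerSingle _ m).toLinearMap (DKCoring.tmul D 1 c),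
      (AMod.copowerDesc_single _ _ _).trans (coringToCofreeAt_one_tmul m c)⟩

theorem toCofree_id_injective (M : DKModule D) :
    Function.Injective (toCofree M.carrier M LinearMap.id).toLinearMap :=
  Function.LeftInverse.injective (cofreeCounit_toCofree M LinearMap.id)

theorem isSubgenerated_toAMod (M : DKModule D) :
    AMod.IsSubgenerated ((AMod.restrict β).obj (DKCoring.opHomModule D)) ((toAMod β).obj M) :=
  ⟨M.carrier, (toAMod β).obj (cofree D M.carrier), _, (toAMod β).map (toCofree M.carrier M .id),
    copowerDesc_coringToCofreeAt_surjective M.carrier, toCofree_id_injective M⟩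

end DKModule

end Coring

/-! ### Isomorphisms of categories -/

namespace IsIsoOfCategories

variable {𝒳 𝒴 𝒵 : Type*} [Category 𝒳] [Category 𝒴] [Category 𝒵]

theorem of_lift (F : 𝒳 ⥤ 𝒴) (P : ObjectProperty 𝒴) (h : ∀ X, P (F.obj X))
    (hinj : Function.Injective F.obj) (hsurj : ∀ Y, P Y → ∃ X, F.obj X = Y)
    (hmap : ∀ X Y : 𝒳, Function.Bijective (F.map : (X ⟶ Y) → _)) :
    IsIsoOfCategories (P.lift F h) := by
  refine ⟨⟨fun X Y hXY => hinj (congrArg ObjectProperty.FullSubcategory.obj hXY), ?_⟩,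
    fun X Y => ⟨fun f g hfg => ?_, ?_⟩⟩
  · rintro ⟨Y, hY⟩
    obtain ⟨X, rfl⟩ := hsurj Y hY
    exact ⟨X, rfl⟩
  · exact (hmap X Y).1 (congrArg
      (fun k : (P.lift F h).obj X ⟶ (P.lift F h).obj Y => InducedCategory.Hom.hom k) hfg)
  · rintro ⟨g⟩
    obtain ⟨f, rfl⟩ := (hmap X Y).2 g
    exact ⟨f, rfl⟩

theorem of_comp {G : 𝒳 ⥤ 𝒴} {K : 𝒴 ⥤ 𝒵} (hG : IsIsoOfCategories G)
    (hGK : IsIsoOfCategories (G ⋙ K)) : IsIsoOfCategories K := by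
  refine ⟨(Function.Bijective.of_comp_iff K.obj hG.1).1 hGK.1, fun X Y => ?_⟩
  obtain ⟨X, rfl⟩ := hG.1.2 X
  obtain ⟨Y, rfl⟩ := hG.1.2 Y
  exact (Function.Bijective.of_comp_iff _ (hG.2 X Y)).1 (hGK.2 X Y)

end IsIsoOfCategories

section Comparison

variable {R H A C : Type u} [CommRing R] [Ring H] [Bialgebra R H] [Ring A] [Algebra R A]
  [AddCommGroup C] [Module R C] [Coalgebra R C] {D : DoiKoppinen R H A C}
  {B : Type u} [NonUnitalRing B] [Module R B] [Module A B] [Module Aᵐᵒᵖ B]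

namespace ARingHom

variable (R A B) in
/-- The identity morphism of an `A`-ring. -/
def id : ARingHom R A B B where
  toLinearMap := LinearMap.id
  map_smul _ _ := rfl
  map_op_smul _ _ := rfl
  map_mul _ _ := rfl

theorem finiteDense_range_of_surjective (β : ARingHom R A B (OpHom D))
    (h : Function.Surjective β.toLinearMap) : FiniteDense (Set.range β.toLinearMap) :=
  (finiteDense_iff _).2 fun f _ => ⟨f, h f, fun _ _ => rfl⟩

theorem finiteDense_range_id : FiniteDense (Set.range (id R A (OpHom D)).toLinearMap) :=
  finiteDense_range_of_surjective _ Function.surjective_id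

end ARingHom

variable [IsARing R A B] {β : ARingHom R A B (OpHom D)}

namespace DKModule

theorem sigma_toAMod (hβ : FiniteDense (Set.range β.toLinearMap)) (M : DKModule D) :
    AMod.sigma ((AMod.restrict β).obj (DKCoring.opHomModule D)) ((toAMod β).obj M) :=
  ⟨toAMod_isUnital hβ M, isSubgenerated_toAMod M⟩

theorem isIso_toAMod_sigma (hC : LocallyProjective R C)
    (hβ : FiniteDense (Set.range β.toLinearMap)) :
    IsIsoOfCategories ((AMod.sigma ((AMod.restrict β).obj (DKCoring.opHomModule D))).lift
      (toAMod β) (sigma_toAMod hβ)) :=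
  .of_lift _ _ _ (toAMod_obj_injective hC hβ)
    (fun _ hN => ((isRational_coring hC hβ).of_isSubgenerated hC hβ hN.2).exists_dkModule hC hβ)
    (toAMod_map_bijective hC hβ)

theorem sigma_toOpHom (M : DKModule D) :
    AMod.sigma (DKCoring.opHomModule D) ((toOpHom D).obj M) :=
  sigma_toAMod (ARingHom.finiteDense_range_id (D := D)) M

theorem isIso_toOpHom_sigma (hC : LocallyProjective R C) :
    IsIsoOfCategories ((AMod.sigma (DKCoring.opHomModule D)).lift (toOpHom D) sigma_toOpHom) :=
  isIso_toAMod_sigma hC (ARingHom.finiteDense_range_id (D := D))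

theorem sigma_restrict (hC : LocallyProjective R C)
    (hβ : FiniteDense (Set.range β.toLinearMap))
    (N : (AMod.sigma (DKCoring.opHomModule D)).FullSubcategory) :
    AMod.sigma ((AMod.restrict β).obj (DKCoring.opHomModule D)) ((AMod.restrict β).obj N.obj) := by
  obtain ⟨M, rfl⟩ := (isIso_toOpHom_sigma hC).1.2 N
  exact sigma_toAMod hβ M

theorem isIso_restrict_sigma (hC : LocallyProjective R C)
    (hβ : FiniteDense (Set.range β.toLinearMap)) :
    IsIsoOfCategories ((AMod.sigma ((AMod.restrict β).obj (DKCoring.opHomModule D))).lift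
      ((AMod.sigma (DKCoring.opHomModule D)).ι ⋙ AMod.restrict β) (sigma_restrict hC hβ)) :=
  .of_comp (isIso_toOpHom_sigma hC) (isIso_toAMod_sigma hC hβ)

end DKModule

end Comparison

/-! ### Finitely generated projective coalgebras -/

theorem LocallyProjective.of_projective (R W : Type u) [CommRing R] [AddCommGroup W] [Module R W]
    [Module.Projective R W] : LocallyProjective R W :=
  fun _ _ _ _ _ _ π hπ g _ _ =>
    (Module.projective_lifting_property π g hπ).imp fun _ hg' _ _ => LinearMap.congr_fun hg' _

theorem AMod.IsUnital.act_eq_self {R A B : Type u} [CommRing R] [Ring A] [Algebra R A]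
    [NonUnitalRing B] [Module R B] [Module A B] [Module Aᵐᵒᵖ B] [IsARing R A B] {N : AMod R A B}
    (hN : N.IsUnital) {e : B} (he : ∀ b, b * e = b) (n : N.carrier) : N.act n e = n :=
  DFunLike.congr_fun (f := (N.act.flip e).toAddMonoidHom) (g := AddMonoidHom.id _)
    (AddMonoidHom.eq_of_eqOn_dense hN fun _ ⟨m, b, hmb⟩ => by
      subst hmb
      exact (N.act_act m b e).trans (congrArg (N.act m) (he b))) n

section FiniteProjective

variable {R H A C : Type u} [CommRing R] [Ring H] [Bialgebra R H] [Ring A] [Algebra R A]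
  [AddCommGroup C] [Module R C] [Coalgebra R C] {D : DoiKoppinen R H A C}
  {B : Type u} [NonUnitalRing B] [Module R B] [Module A B] [Module Aᵐᵒᵖ B] [IsARing R A B]
  {β : ARingHom R A B (OpHom D)} [Module.Finite R C] [Module.Projective R C]

namespace AMod

/- If `∑ sᵢ ⊗ dᵢ ∈ C* ⊗ C` is the identity of `C`, then `b = ∑ xᵢ β(b)(dᵢ)` for the preimages `xᵢ`
of `sᵢ : C → R → A`, so that `n b = ∑ (n xᵢ) β(b)(dᵢ)`. -/
theorem exists_act_eq_evalAt (hβ : Function.Bijective β.toLinearMap) (N : AMod R A B)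
    (n : N.carrier) :
    ∃ t : N.carrier ⊗[R] C, ∀ b, N.act n b = evalAt N.carrier (β.lin b) t := by
  let e : B ≃ₗ[R] OpHom D := .ofBijective β.toLinearMap hβ
  have hlin (b : B) : e.symm ((OpHom.toLin D).symm (β.lin b)) = b :=
    (LinearEquiv.symm_apply_eq e).2 rfl
  let ψ : Module.Dual R C →ₗ[R] N.carrier := N.act n ∘ₗ e.symm.toLinearMap ∘ₗ
    (OpHom.toLin D).symm.toLinearMap ∘ₗ (Algebra.linearMap R A).compRight R
  have hψ (b : B) (s : Module.Dual R C ⊗[R] C) : evalAt N.carrier (β.lin b) (ψ.rTensor C s) =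
      N.act n (e.symm ((OpHom.toLin D).symm (β.lin b ∘ₗ dualTensorHom R C C s))) := by
    induction s with
    | zero => simp
    | add s t hs ht => simp only [map_add, LinearMap.comp_add, hs, ht]
    | tmul f d =>
      rw [LinearMap.rTensor_tmul, evalAt_tmul]
      refine (N.act_op_smul _ _ _).symm.trans (congrArg (N.act n) (e.injective ?_))
      refine (β.map_op_smul _ _).trans (OpHom.ext fun c => ?_)
      have hψf : β.toLinearMap (e.symm ((OpHom.toLin D).symm (Algebra.linearMap R A ∘ₗ f))) =
          (OpHom.toLin D).symm (Algebra.linearMap R A ∘ₗ f) := e.apply_symm_apply _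
      simp [hψf, Algebra.smul_def]
  obtain ⟨s, hs⟩ := (dualTensorHom_bijective (R := R) (M := C) (N := C)).2 LinearMap.id
  exact ⟨ψ.rTensor C s, fun b => by rw [hψ, hs, LinearMap.comp_id, hlin]⟩

theorem IsUnital.isRational (hβ : Function.Bijective β.toLinearMap) {N : AMod R A B}
    (hN : N.IsUnital) : IsRational β N := fun n => by
  obtain ⟨t, ht⟩ := N.exists_act_eq_evalAt hβ n
  obtain ⟨e, he⟩ := hβ.2 (OpHom.unit D)
  have hmul (b : B) : b * e = b := hβ.1 (by rw [β.map_mul, he, OpHom.mul_unit])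
  have hlin : β.lin e = counitMap R A C := by rw [ARingHom.lin, he, OpHom.toLin_unit]
  exact ⟨t, ht, by rw [← hlin, ← ht, hN.act_eq_self hmul]⟩

end AMod

namespace DKModule

theorem isIso_toAMod_unital (hβ : Function.Bijective β.toLinearMap) :
    IsIsoOfCategories ((AMod.unital R A B).lift (toAMod β)
      (toAMod_isUnital (β.finiteDense_range_of_surjective hβ.2))) :=
  have hC : LocallyProjective R C := .of_projective R C
  have hdense := β.finiteDense_range_of_surjective hβ.2
  .of_lift _ _ _ (toAMod_obj_injective hC hdense)
    (fun _ hN => (hN.isRational hβ).exists_dkModule hC hdense) (toAMod_map_bijective hC hdense)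

omit [Module.Finite R C] [Module.Projective R C] in
theorem unital_toOpHom (M : DKModule D) : AMod.unital R A (OpHom D) ((toOpHom D).obj M) :=
  toAMod_isUnital (ARingHom.finiteDense_range_id (D := D)) M

theorem isIso_toOpHom_unital :
    IsIsoOfCategories ((AMod.unital R A (OpHom D)).lift (toOpHom D) unital_toOpHom) :=
  isIso_toAMod_unital (β := ARingHom.id R A (OpHom D)) Function.bijective_id

theorem unital_restrict (hβ : Function.Bijective β.toLinearMap)
    (N : (AMod.unital R A (OpHom D)).FullSubcategory) :
    AMod.unital R A B ((AMod.restrict β).obj N.obj) := by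
  obtain ⟨M, rfl⟩ := isIso_toOpHom_unital.1.2 N
  exact toAMod_isUnital (β.finiteDense_range_of_surjective hβ.2) M

theorem isIso_restrict_unital (hβ : Function.Bijective β.toLinearMap) :
    IsIsoOfCategories ((AMod.unital R A B).lift
      ((AMod.unital R A (OpHom D)).ι ⋙ AMod.restrict β) (unital_restrict hβ)) :=
  .of_comp isIso_toOpHom_unital (isIso_toAMod_unital hβ)

end DKModule

end FiniteProjective

/-! ### The pairing of the smash product with the coring -/

section Pairing

variable {R H A C : Type u} [CommRing R] [Ring H] [Bialgebra R H] [Ring A] [Algebra R A]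
  [AddCommGroup C] [Module R C] [Coalgebra R C] {D : DoiKoppinen R H A C}

namespace DKCoring

variable (D) (M : Type u) [AddCommGroup M] [Module R M] [Module Aᵐᵒᵖ M] [IsScalarTower R Aᵐᵒᵖ M]

/-- The isomorphism `M ⊗_A (A ⊗ C) ≃ M ⊗ C`, `m ⊗ (a ⊗ c) ↦ m a ⊗ c`. -/
def tensorEquiv : ATensor R A M (DKCoring D) ≃ₗ[R] M ⊗[R] C :=
  .ofLinearMap
    (ATensor.lift ((LinearMap.rTensorHom C ∘ₗ TensorProduct.curry (rightMul R A M)).compl₂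
      ((ofTensor D).symm.toLinearMap.restrictScalars R)) fun m a w => by
        induction w using DKCoring.induction with
        | h0 => simp
        | h2 s t hs ht => simp only [smul_add, map_add, hs, ht]
        | h1 b c =>
          rw [smul_tmul, ← ofTensor_tmul, ← ofTensor_tmul]
          simp [mul_smul])
    (TensorProduct.lift ((ATensor.mk R A M (DKCoring D)).compl₂ (tmul D 1)))
    (TensorProduct.ext' fun m c => by
      rw [LinearMap.comp_apply, TensorProduct.lift.tmul, LinearMap.compl₂_apply,
        ATensor.mk_apply, ATensor.lift_tmul, ← ofTensor_tmul]
      simp)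
    (ATensor.hom_ext fun m w => by
      induction w using DKCoring.induction with
      | h0 => simp
      | h2 s t hs ht => simp only [ATensor.tmul_add, map_add, hs, ht]
      | h1 a c =>
        change ATensor.tmul R A (op a • m) (tmul D 1 c) = _
        rw [ATensor.smul_tmul, smul_tmul, mul_one, LinearMap.id_apply])

theorem tensorEquiv_tmul (m : M) (a : A) (c : C) :
    tensorEquiv D M (ATensor.tmul R A m (tmul D a c)) = (op a • m) ⊗ₜ c := rfl

end DKCoring

namespace OpSmash

theorem beta_whole_bijective [Module.Finite R C] [Module.Projective R C] :
    Function.Bijective (beta (HSubalgebra.whole D)).toLinearMap := by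
  let e : A ⊗[R] (HSubalgebra.whole D).toSubmodule ≃ₗ[R] Module.Dual R C ⊗[R] A :=
    TensorProduct.comm R A _ ≪≫ₗ Submodule.topEquiv.rTensor A
  have hbeta : betaLin (HSubalgebra.whole D) = dualTensorHom R C A ∘ₗ e.toLinearMap :=
    TensorProduct.ext' fun _ _ => rfl
  have hbij : Function.Bijective (betaLin (HSubalgebra.whole D)) := by
    rw [hbeta]
    exact dualTensorHom_bijective.comp e.bijective
  exact hbij

variable (T : HSubalgebra D)

theorem finiteDense_beta (hC : LocallyProjective R C)
    (hT : FiniteDense (T.toSubmodule : Set (Module.Dual R C))) :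
    FiniteDense (Set.range (beta T).toLinearMap) := by
  classical
  rw [finiteDense_iff] at hT ⊢
  intro f F
  obtain ⟨g, hg⟩ := hC.exists_finsupp_coordinates F
  choose t ht htF using fun d : C => hT (Finsupp.lapply d ∘ₗ g) F
  let J := F.biUnion fun c => (g c).support
  let b : A ⊗[R] T.toSubmodule := ∑ d ∈ J, f d ⊗ₜ ⟨t d, ht d⟩
  refine ⟨_, ⟨b, rfl⟩, fun c hc => ?_⟩
  have hgJ : (g c).support ⊆ J := Finset.subset_biUnion_of_mem (fun c => (g c).support) hc
  calc betaLin T b c = ∑ d ∈ J, t d c • f d := by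
        simp only [b, map_sum, LinearMap.sum_apply, betaLin_tmul]
    _ = ∑ d ∈ J, g c d • f d := Finset.sum_congr rfl fun d _ => congrArg (· • f d) (htF d c hc)
    _ = Finsupp.linearCombination R (OpHom.toLin D f) (g c) :=
        (Finsupp.sum_of_support_subset _ hgJ (fun d r => r • f d) fun d _ => zero_smul R (f d)).symm
    _ = f c := by
        rw [← OpHom.toLin_apply]
        conv_rhs => rw [← hg c hc, Finsupp.apply_linearCombination]
        rfl

variable {T}

theorem isMeasuringPairing_kappa (hC : LocallyProjective R C)
    (hβ : FiniteDense (Set.range (beta T).toLinearMap)) :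
    IsMeasuringPairing (kappa T).toLinearMap where
  isARingHom := ⟨kappa T, fun _ => rfl⟩
  map_unity e he := OpHom.dual_ext fun c => by
    let w : A ⊗[R] C := 1 ⊗ₜ c
    have hw : (DKModule.cofree D A).opAct (CofreeCarrier.ofTensor D A w) ((beta T).toLinearMap e) =
        CofreeCarrier.ofTensor D A w :=
      (CofreeCarrier.ofTensor D A).symm.injective <| (beta T).evalAt_lin_ext hC hβ fun b => by
        rw [ARingHom.lin, DKModule.evalAt_cofree_opAct, ← (beta T).map_mul, (he b).1,
          LinearEquiv.symm_apply_apply]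
    have hcounit := DKModule.cofreeCounit_opAct w ((beta T).toLinearMap e)
    rw [hw] at hcounit
    exact hcounit.symm

theorem alphaMap_kappa (M : Type u) [AddCommGroup M] [Module R M] [Module Aᵐᵒᵖ M]
    [IsScalarTower R Aᵐᵒᵖ M] (t : ATensor R A M (DKCoring D)) (b : OpSmash T) :
    alphaMap (kappa T).toLinearMap M t b =
      evalAt M ((beta T).lin b) (DKCoring.tensorEquiv D M t) := by
  induction t using ATensor.induction with
  | h0 => simp [alphaMap]
  | h2 s t hs ht => simp only [alphaMap, map_add] at hs ht ⊢; rw [hs, ht]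
  | h1 m w =>
    induction w using DKCoring.induction with
    | h0 => simp [alphaMap]
    | h2 s t hs ht => simp only [alphaMap, ATensor.tmul_add, map_add] at hs ht ⊢; rw [hs, ht]
    | h1 a c =>
      rw [DKCoring.tensorEquiv_tmul, evalAt_tmul, smul_smul]
      rfl

theorem alphaCondition_kappa (hC : LocallyProjective R C)
    (hβ : FiniteDense (Set.range (beta T).toLinearMap)) :
    AlphaCondition (kappa T).toLinearMap := fun M _ _ _ _ s t hst =>
  (DKCoring.tensorEquiv D M).injective <| (beta T).evalAt_lin_ext hC hβ fun b => by
    rw [← alphaMap_kappa, ← alphaMap_kappa, hst]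

end OpSmash

end Pairing

/-! ### Comonadicity of the forgetful functor -/

section Comonadic

variable {R H A C : Type u} [CommRing R] [Ring H] [Bialgebra R H] [Ring A] [Algebra R A]
  [AddCommGroup C] [Module R C] [Coalgebra R C] {D : DoiKoppinen R H A C}

namespace DKModule

/-- The additive group of `C`-colinear right `A`-linear maps from `M` to `N`. -/
def colinearMaps (M N : DKModule D) : AddSubgroup (M.carrier →ₗ[Aᵐᵒᵖ] N.carrier) where
  carrier := {f | ∀ m, N.coact (f m) = (f.restrictScalars R).rTensor C (M.coact m)}
  zero_mem' m := by
    rw [LinearMap.restrictScalars_zero, LinearMap.rTensor_zero]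
    exact map_zero N.coact
  add_mem' {f g} hf hg m := by
    rw [LinearMap.restrictScalars_add, LinearMap.rTensor_add, LinearMap.add_apply,
      LinearMap.add_apply, map_add, hf, hg]
  neg_mem' {f} hf m := by
    rw [LinearMap.restrictScalars_neg, LinearMap.rTensor_neg, LinearMap.neg_apply,
      LinearMap.neg_apply, map_neg, hf]

/-- Morphisms of Doi-Koppinen modules, as an additive group of linear maps. -/
def homEquivColinear (M N : DKModule D) : (M ⟶ N) ≃ colinearMaps M N where
  toFun f := ⟨f.toLinearMap, f.map_coact⟩
  invFun f := ⟨f.1, f.2⟩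

instance (M N : DKModule D) : AddCommGroup (M ⟶ N) := (homEquivColinear M N).addCommGroup

instance : Preadditive (DKModule D) where
  add_comp _ _ _ f g h := Hom.ext (LinearMap.comp_add f.toLinearMap g.toLinearMap h.toLinearMap)
  comp_add _ _ _ f g h := Hom.ext (LinearMap.add_comp f.toLinearMap h.toLinearMap g.toLinearMap)

variable (D) in
/-- The forgetful functor to right `A`-modules. -/
def forgetA : DKModule D ⥤ ModuleCat.{u} Aᵐᵒᵖ where
  obj M := ModuleCat.of _ M.carrier
  map f := ModuleCat.ofHom f.toLinearMap

instance : (forgetA D).Additive where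
  map_add := ModuleCat.hom_ext rfl

instance : (forgetA D).Faithful where
  map_injective h := Hom.ext (ModuleCat.hom_ext_iff.1 h)

/-- The isomorphism of Doi-Koppinen modules given by a colinear right `A`-linear equivalence. -/
def isoOfLinearEquiv {M N : DKModule D} (e : M.carrier ≃ₗ[Aᵐᵒᵖ] N.carrier)
    (he : ∀ m, N.coact (e m) = (e.toLinearMap.restrictScalars R).rTensor C (M.coact m)) :
    M ≅ N where
  hom := ⟨e.toLinearMap, he⟩
  inv := ⟨e.symm.toLinearMap, fun n => by
    obtain ⟨m, rfl⟩ := e.surjective n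
    rw [he, ← LinearMap.rTensor_comp_apply, ← LinearMap.restrictScalars_comp,
      LinearEquiv.symm_comp, LinearEquiv.coe_coe, e.symm_apply_apply]
    exact (LinearMap.rTensor_id_apply C M.carrier _).symm⟩
  hom_inv_id := Hom.ext (LinearMap.ext e.symm_apply_apply)
  inv_hom_id := Hom.ext (LinearMap.ext e.apply_symm_apply)

instance : (forgetA D).ReflectsIsomorphisms where
  reflects f h := (isoOfLinearEquiv
    (.ofBijective f.toLinearMap ((ConcreteCategory.isIso_iff_bijective _).1 h))
      f.map_coact).isIso_hom

end DKModule

/-- The right `A`-module `Y` with its induced action of `R`. It is a type synonym because an object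
of `ModuleCat Aᵐᵒᵖ` may already carry another action of `R`. -/
def WithScalars (_R _A Y : Type u) : Type u := Y

namespace WithScalars

variable (Y : Type u) [AddCommGroup Y] [Module Aᵐᵒᵖ Y]

instance : AddCommGroup (WithScalars R A Y) := inferInstanceAs (AddCommGroup Y)
instance : Module Aᵐᵒᵖ (WithScalars R A Y) := inferInstanceAs (Module Aᵐᵒᵖ Y)
instance : Module R (WithScalars R A Y) := Module.compHom Y (algebraMap R Aᵐᵒᵖ)
instance : IsScalarTower R Aᵐᵒᵖ (WithScalars R A Y) := IsScalarTower.of_compHom R Aᵐᵒᵖ Y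

variable (R A) in
/-- The identification of a right `A`-module with its type synonym. -/
def equiv : Y ≃ₗ[Aᵐᵒᵖ] WithScalars R A Y := LinearEquiv.refl Aᵐᵒᵖ Y

end WithScalars

namespace DKModule

/-- The universal property of cofree modules. -/
def cofreeHomEquiv (X : DKModule D) (Y : ModuleCat.{u} Aᵐᵒᵖ) :
    ((forgetA D).obj X ⟶ Y) ≃ (X ⟶ cofree D (WithScalars R A Y)) where
  toFun f := toCofree _ X ((WithScalars.equiv R A Y).toLinearMap ∘ₗ f.hom)
  invFun g := ModuleCat.ofHom ((WithScalars.equiv R A Y).symm.toLinearMap ∘ₗ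
    cofreeCounit D (WithScalars R A Y) ∘ₗ g.toLinearMap)
  left_inv f := ModuleCat.hom_ext <| LinearMap.ext fun x =>
    cofreeCounit_toCofree X ((WithScalars.equiv R A Y).toLinearMap ∘ₗ f.hom) x
  right_inv g := toCofree_cofreeCounit_comp X g

section

variable {M N : Type u} [AddCommGroup M] [Module R M] [Module Aᵐᵒᵖ M] [IsScalarTower R Aᵐᵒᵖ M]
  [AddCommGroup N] [Module R N] [Module Aᵐᵒᵖ N] [IsScalarTower R Aᵐᵒᵖ N]

theorem comp_toCofree {X X' : DKModule D} (f : X' ⟶ X) (φ : X.carrier →ₗ[Aᵐᵒᵖ] M) :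
    f ≫ toCofree M X φ = toCofree M X' (φ ∘ₗ f.toLinearMap) :=
  Hom.ext <| LinearMap.ext fun x => by
    rw [toCofree_apply, LinearMap.restrictScalars_comp, LinearMap.rTensor_comp_apply,
      ← f.map_coact]
    rfl

theorem toCofree_comp_cofreeMap (X : DKModule D) (φ : X.carrier →ₗ[Aᵐᵒᵖ] M) (ψ : M →ₗ[Aᵐᵒᵖ] N) :
    toCofree M X φ ≫ cofreeMap D ψ = toCofree N X (ψ ∘ₗ φ) :=
  (comp_toCofree _ _).trans <| congrArg (toCofree N X) <| LinearMap.ext fun x =>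
    congrArg ψ (cofreeCounit_toCofree X φ x)

end

variable (D) in
/-- The functor `M ↦ M ⊗ C` from right `A`-modules to Doi-Koppinen modules. -/
def cofreeFunctor : ModuleCat.{u} Aᵐᵒᵖ ⥤ DKModule D :=
  Adjunction.rightAdjointOfEquiv cofreeHomEquiv fun _ _ Y f _ =>
    (comp_toCofree f ((WithScalars.equiv R A Y).toLinearMap ∘ₗ _)).symm

variable (D) in
/-- The forgetful functor is left adjoint to the cofree functor. -/
def cofreeAdjunction : forgetA D ⊣ cofreeFunctor D :=
  Adjunction.adjunctionOfEquivRight cofreeHomEquiv fun _ _ Y f _ =>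
    (comp_toCofree f ((WithScalars.equiv R A Y).toLinearMap ∘ₗ _)).symm

theorem cofreeAdjunction_unit (X : DKModule D) : (cofreeAdjunction D).unit.app X =
    toCofree _ X (WithScalars.equiv R A X.carrier).toLinearMap := by
  simp only [cofreeAdjunction, Adjunction.adjunctionOfEquivRight, Adjunction.mkOfHomEquiv]
  rfl

theorem cofreeAdjunction_counit (Y : ModuleCat.{u} Aᵐᵒᵖ) : (cofreeAdjunction D).counit.app Y =
    ModuleCat.ofHom ((WithScalars.equiv R A Y).symm.toLinearMap ∘ₗ
      cofreeCounit D (WithScalars R A Y)) := by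
  simp only [cofreeAdjunction, Adjunction.adjunctionOfEquivRight, Adjunction.mkOfHomEquiv]
  rfl

theorem comparison_a (X : DKModule D) : ((Comonad.comparison (cofreeAdjunction D)).obj X).a =
    (forgetA D).map (toCofree _ X (WithScalars.equiv R A X.carrier).toLinearMap) :=
  congrArg (forgetA D).map (cofreeAdjunction_unit X)

instance : (Comonad.comparison (cofreeAdjunction D)).Faithful :=
  Comonad.comparison_faithful_of_faithful _

instance : (Comonad.comparison (cofreeAdjunction D)).Full where
  map_surjective {X Y} g := by
    let e := WithScalars.equiv R A Y.carrier
    let f : X.carrier →ₗ[Aᵐᵒᵖ] Y.carrier := g.f.hom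
    have he : Function.Injective ((e.toLinearMap.restrictScalars R).rTensor C) :=
      (LinearEquiv.rTensor C (e.restrictScalars R)).injective
    refine ⟨⟨f, fun x => he <| (CofreeCarrier.ofTensor D _).injective ?_⟩,
      Comonad.Coalgebra.Hom.ext (ModuleCat.hom_ext rfl)⟩
    have hg := g.h
    rw [comparison_a, comparison_a] at hg
    have hcomp := toCofree_comp_cofreeMap X (WithScalars.equiv R A X.carrier).toLinearMap
      (e.toLinearMap ∘ₗ f ∘ₗ (WithScalars.equiv R A X.carrier).symm.toLinearMap)
    have hx := LinearMap.congr_fun (congrArg Hom.toLinearMap hcomp) x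
    refine (LinearMap.congr_fun (ModuleCat.hom_ext_iff.1 hg) x).symm.trans (hx.trans ?_)
    exact congrArg (CofreeCarrier.ofTensor D _) (LinearMap.rTensor_comp_apply C
      (e.toLinearMap.restrictScalars R) (f.restrictScalars R) (X.coact x))

section

variable (X : (cofreeAdjunction D).toComonad.Coalgebra)

/-- The structure map of a coalgebra over the comonad `M ↦ M ⊗ C`. -/
def structureMap : WithScalars R A X.A →ₗ[Aᵐᵒᵖ] CofreeCarrier D (WithScalars R A X.A) := X.a.hom

theorem cofreeCounit_structureMap (n : WithScalars R A X.A) :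
    cofreeCounit D _ (structureMap X n) = n := by
  have hcounit := X.counit
  rw [Adjunction.toComonad_ε, cofreeAdjunction_counit] at hcounit
  exact LinearMap.congr_fun (ModuleCat.hom_ext_iff.1 hcounit) n

theorem toCofree_structureMap (n : WithScalars R A X.A) :
    (toCofree _ (cofree D (WithScalars R A X.A))
        (WithScalars.equiv R A (CofreeCarrier D (WithScalars R A X.A))).toLinearMap).toLinearMap
          (structureMap X n) =
      (cofreeMap D ((WithScalars.equiv R A (CofreeCarrier D (WithScalars R A X.A))).toLinearMap ∘ₗ
        structureMap X)).toLinearMap (structureMap X n) :=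
  (LinearMap.congr_fun (congrArg Hom.toLinearMap
    (cofreeAdjunction_unit (cofree D (WithScalars R A X.A)))) (structureMap X n)).symm.trans
      (LinearMap.congr_fun (ModuleCat.hom_ext_iff.1 X.coassoc) n)

theorem coact_structureMap (n : WithScalars R A X.A) :
    CofreeCarrier.coact D _ (structureMap X n) = ((structureMap X).restrictScalars R).rTensor C
      ((CofreeCarrier.ofTensor D _).symm (structureMap X n)) := by
  have he : Function.Injective (((WithScalars.equiv R A
      (CofreeCarrier D (WithScalars R A X.A))).toLinearMap.restrictScalars R).rTensor C) :=
    (LinearEquiv.rTensor C ((WithScalars.equiv R A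
      (CofreeCarrier D (WithScalars R A X.A))).restrictScalars R)).injective
  refine he ((CofreeCarrier.ofTensor D _).injective ((toCofree_structureMap X n).trans ?_))
  refine (cofreeMap_ofTensor _ ((CofreeCarrier.ofTensor D _).symm (structureMap X n))).trans
    (congrArg _ ?_)
  exact LinearMap.rTensor_comp_apply C ((WithScalars.equiv R A
      (CofreeCarrier D (WithScalars R A X.A))).toLinearMap.restrictScalars R)
    ((structureMap X).restrictScalars R) _

/-- The coaction given by a coalgebra over the comonad `M ↦ M ⊗ C`. -/
def coactionOfCoalgebra : Coaction D (WithScalars R A X.A) where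
  coact := (CofreeCarrier.ofTensor D _).symm.toLinearMap ∘ₗ (structureMap X).restrictScalars R
  rTensor_coact n := (coact_structureMap X n).symm
  evalAt_coact n := cofreeCounit_structureMap X n
  coact_op_smul a n :=
    congrArg (CofreeCarrier.ofTensor D _).symm ((structureMap X).map_smul (op a) n)

end

instance : (Comonad.comparison (cofreeAdjunction D)).EssSurj where
  mem_essImage X := by
    let e : (forgetA D).obj (coactionOfCoalgebra X).toDKModule ≅ X.A :=
      (WithScalars.equiv R A X.A).symm.toModuleIso
    refine ⟨_, ⟨Comonad.Coalgebra.isoMk e (ModuleCat.hom_ext <| LinearMap.ext fun n => ?_)⟩⟩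
    rw [comparison_a]
    have hcomp := toCofree_comp_cofreeMap (coactionOfCoalgebra X).toDKModule
      (WithScalars.equiv R A (WithScalars R A X.A)).toLinearMap
      (WithScalars.equiv R A (WithScalars R A X.A)).symm.toLinearMap
    refine (LinearMap.congr_fun (congrArg Hom.toLinearMap hcomp) n).trans ?_
    exact congrArg (CofreeCarrier.ofTensor D _)
      (LinearMap.rTensor_id_apply C (WithScalars R A X.A) ((coactionOfCoalgebra X).coact n))

instance : (Comonad.comparison (cofreeAdjunction D)).IsEquivalence where

instance : ComonadicLeftAdjoint (forgetA D) where
  R := cofreeFunctor D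
  adj := cofreeAdjunction D
  eqv := inferInstance

end DKModule

end Comonadic

section Abelian

open Limits

/-- A preadditive category is abelian if it has finite limits and colimits and an additive functor
to an abelian category that preserves them and reflects isomorphisms. -/
abbrev abelianOfPreservesOfReflects {𝒳 𝒴 : Type*} [Category 𝒳] [Category 𝒴] [Preadditive 𝒳]
    [Abelian 𝒴] (F : 𝒳 ⥤ 𝒴) [F.Additive] [HasFiniteLimits 𝒳] [HasFiniteColimits 𝒳]
    [PreservesFiniteLimits F] [PreservesFiniteColimits F] [F.ReflectsIsomorphisms] : Abelian 𝒳 :=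
  have (X Y : 𝒳) (f : X ⟶ Y) : IsIso (Abelian.coimageImageComparison f) := by
    have hcomparison := Abelian.PreservesCoimage.hom_coimageImageComparison F f
    have : IsIso (F.map (Abelian.coimageImageComparison f)) := by
      rw [(Iso.eq_comp_inv _).2 hcomparison.symm]
      infer_instance
    exact isIso_of_reflects_iso _ F
  Abelian.ofCoimageImageComparisonIsIso

variable {R H A C : Type u} [CommRing R] [Ring H] [Bialgebra R H] [Ring A] [Algebra R A]
  [AddCommGroup C] [Module R C] [Coalgebra R C] {D : DoiKoppinen R H A C}

namespace DKModule

instance : (cofreeFunctor D).Additive := (cofreeAdjunction D).right_adjoint_additive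

section Flat

variable [Module.Flat R C]

section

variable {M N P : Type u} [AddCommGroup M] [Module R M] [Module Aᵐᵒᵖ M] [IsScalarTower R Aᵐᵒᵖ M]
  [AddCommGroup N] [Module R N] [Module Aᵐᵒᵖ N] [IsScalarTower R Aᵐᵒᵖ N]
  [AddCommGroup P] [Module R P] [Module Aᵐᵒᵖ P] [IsScalarTower R Aᵐᵒᵖ P]

theorem cofreeMap_injective {φ : M →ₗ[Aᵐᵒᵖ] N} (hφ : Function.Injective φ) :
    Function.Injective (cofreeMap D φ).toLinearMap := fun x y hxy => by
  obtain ⟨s, rfl⟩ := (CofreeCarrier.ofTensor D M).surjective x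
  obtain ⟨t, rfl⟩ := (CofreeCarrier.ofTensor D M).surjective y
  rw [cofreeMap_ofTensor, cofreeMap_ofTensor] at hxy
  exact congrArg _ (Module.Flat.rTensor_preserves_injective_linearMap (φ.restrictScalars R) hφ
    ((CofreeCarrier.ofTensor D N).injective hxy))

theorem cofreeMap_exact {φ : M →ₗ[Aᵐᵒᵖ] N} {ψ : N →ₗ[Aᵐᵒᵖ] P} (h : Function.Exact φ ψ) :
    Function.Exact (cofreeMap D φ).toLinearMap (cofreeMap D ψ).toLinearMap := fun y => by
  have hR : Function.Exact (φ.restrictScalars R) (ψ.restrictScalars R) := h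
  obtain ⟨t, rfl⟩ := (CofreeCarrier.ofTensor D N).surjective y
  rw [cofreeMap_ofTensor, LinearEquiv.map_eq_zero_iff, Module.Flat.rTensor_exact C hR t]
  constructor
  · rintro ⟨s, rfl⟩
    exact ⟨CofreeCarrier.ofTensor D M s, cofreeMap_ofTensor φ s⟩
  · rintro ⟨x, hx⟩
    obtain ⟨s, rfl⟩ := (CofreeCarrier.ofTensor D M).surjective x
    exact ⟨s, (CofreeCarrier.ofTensor D N).injective ((cofreeMap_ofTensor φ s).symm.trans hx)⟩

end

instance preservesFiniteLimits_cofree : PreservesFiniteLimits (cofreeFunctor D ⋙ forgetA D) := by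
  refine ((cofreeFunctor D ⋙ forgetA D).preservesFiniteLimits_tfae.out 0 3).1 fun S hS => ?_
  have hfg := (ShortComplex.ShortExact.moduleCat_exact_iff_function_exact S).1 hS.exact
  exact ⟨(ShortComplex.ShortExact.moduleCat_exact_iff_function_exact _).2 (cofreeMap_exact hfg),
    (ModuleCat.mono_iff_injective _).2 (cofreeMap_injective hS.moduleCat_injective_f)⟩

instance createsFiniteLimits_forgetA (J : Type) [SmallCategory J] [FinCategory J] :
    CreatesLimitsOfShape J (forgetA D) where
  CreatesLimit {_} :=
    have : PreservesFiniteLimits (comonadicRightAdjoint (forgetA D) ⋙ forgetA D) :=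
      preservesFiniteLimits_cofree
    comonadicCreatesLimitOfPreservesLimit _ _

instance : CreatesColimitsOfSize.{u, u} (forgetA D) := comonadicCreatesColimits _

instance : HasFiniteLimits (DKModule D) where
  out _ _ _ := hasLimitsOfShape_of_hasLimitsOfShape_createsLimitsOfShape (forgetA D)

instance : PreservesFiniteLimits (forgetA D) where
  preservesFiniteLimits _ _ _ := inferInstance

instance : HasColimitsOfSize.{u, u} (DKModule D) :=
  hasColimits_of_hasColimits_createsColimits (forgetA D)

instance abelian : Abelian (DKModule D) :=
  have : PreservesColimitsOfSize.{u, u} (forgetA D) := inferInstance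
  abelianOfPreservesOfReflects (forgetA D)

instance : AB5OfSize.{u, u} (DKModule D) where
  ofShape J _ _ := HasExactColimitsOfShape.domain_of_functor J (forgetA D)

end Flat

end DKModule

end Abelian

/-! ### A separator for Doi-Koppinen modules -/

section Separator

theorem exists_countable_mem_forall_subset {α : Type*} {S : α → Set α}
    (hS : ∀ x, (S x).Countable) (a : α) : ∃ T : Set α, T.Countable ∧ a ∈ T ∧ ∀ x ∈ T, S x ⊆ T := by
  let U : ℕ → Set α := Nat.rec {a} fun _ V => ⋃ x ∈ V, S x
  have hU (n : ℕ) : (U n).Countable := by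
    induction n with
    | zero => exact Set.countable_singleton a
    | succ n ih => exact ih.biUnion fun x _ => hS x
  refine ⟨⋃ n, U n, Set.countable_iUnion hU, Set.mem_iUnion.2 ⟨0, rfl⟩, fun x hx y hy => ?_⟩
  obtain ⟨n, hn⟩ := Set.mem_iUnion.1 hx
  exact Set.mem_iUnion.2 ⟨n + 1, Set.mem_biUnion hn hy⟩

theorem exists_finset_mem_range_rTensor {R : Type*} {M : Type u} {C : Type*} [CommRing R]
    [AddCommGroup M] [Module R M] [AddCommGroup C] [Module R C] (t : M ⊗[R] C) :
    ∃ S : Finset M, ∀ {P : Type u} [AddCommGroup P] [Module R P] (i : P →ₗ[R] M),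
      (S : Set M) ⊆ Set.range i → t ∈ LinearMap.range (i.rTensor C) := by
  classical
  obtain ⟨F, rfl⟩ := TensorProduct.exists_finset t
  refine ⟨F.image Prod.fst, fun i hi => Submodule.sum_mem _ fun f hf => ?_⟩
  obtain ⟨p, hp⟩ := hi (Finset.mem_image_of_mem Prod.fst hf)
  exact ⟨p ⊗ₜ f.2, by rw [LinearMap.rTensor_tmul, hp]⟩

variable {R H A C : Type u} [CommRing R] [Ring H] [Bialgebra R H] [Ring A] [Algebra R A]
  [AddCommGroup C] [Module R C] [Coalgebra R C] {D : DoiKoppinen R H A C}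

namespace DKModule

variable (M : DKModule D)

section Restrict

variable {M} {P : Type u} [AddCommGroup P] [Module R P] [Module Aᵐᵒᵖ P] [IsScalarTower R Aᵐᵒᵖ P]

/-- The restriction of the coaction of `M` along an injective map `i : P → M`, where `ρ p` stands
for the preimage of the coaction of `i p`. -/
abbrev Coaction.ofInjective [Module.Flat R C] {i : P →ₗ[Aᵐᵒᵖ] M.carrier}
    (hi : Function.Injective i) (ρ : P →ₗ[R] P ⊗[R] C)
    (hρ : ∀ p, (i.restrictScalars R).rTensor C (ρ p) = M.coact (i p)) : Coaction D P where
  coact := ρ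
  rTensor_coact p := by
    have hiCC : Function.Injective (((i.restrictScalars R).rTensor C).rTensor C) :=
      Module.Flat.rTensor_preserves_injective_linearMap _
        (Module.Flat.rTensor_preserves_injective_linearMap _ hi)
    have hcomp : (i.restrictScalars R).rTensor C ∘ₗ ρ = M.coact ∘ₗ i.restrictScalars R :=
      LinearMap.ext hρ
    apply hiCC
    rw [← LinearMap.rTensor_comp_apply, hcomp, LinearMap.rTensor_comp_apply, ← comulRight_rTensor,
      hρ]
    exact (LinearEquiv.eq_symm_apply _).2 (M.coassoc (i p))
  evalAt_coact p := hi <| by rw [← evalAt_rTensor, hρ, M.evalAt_counitMap_coact]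
  coact_op_smul a p := by
    have hiC : Function.Injective ((i.restrictScalars R).rTensor C) :=
      Module.Flat.rTensor_preserves_injective_linearMap _ hi
    apply hiC
    rw [hρ, ← DoiKoppinen.diag_rTensor, hρ, map_smul, M.coact_op_smul]

theorem coact_mem_range_of_mem_span {i : P →ₗ[Aᵐᵒᵖ] M.carrier} {T : Set M.carrier}
    (hT : ∀ m ∈ T, M.coact m ∈ LinearMap.range ((i.restrictScalars R).rTensor C)) {m : M.carrier}
    (hm : m ∈ Submodule.span Aᵐᵒᵖ T) :
    M.coact m ∈ LinearMap.range ((i.restrictScalars R).rTensor C) := by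
  induction hm using Submodule.span_induction with
  | mem m hm => exact hT m hm
  | zero => exact (map_zero M.coact).symm ▸ zero_mem _
  | add m n _ _ hm hn => exact (map_add M.coact m n).symm ▸ add_mem hm hn
  | smul a m _ hm =>
    obtain ⟨t, ht⟩ := hm
    exact ⟨D.diag P (t ⊗ₜ D.coact a.unop), by
      rw [← DoiKoppinen.diag_rTensor, ht, ← M.coact_op_smul, op_unop]⟩

theorem exists_coaction_of_injective [Module.Flat R C] {i : P →ₗ[Aᵐᵒᵖ] M.carrier}
    (hi : Function.Injective i)
    (hrange : ∀ p, M.coact (i p) ∈ LinearMap.range ((i.restrictScalars R).rTensor C)) :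
    ∃ ρ : Coaction D P, ∀ p, M.coact (i p) = (i.restrictScalars R).rTensor C (ρ.coact p) := by
  have hiC : Function.Injective ((i.restrictScalars R).rTensor C) :=
    Module.Flat.rTensor_preserves_injective_linearMap _ hi
  have hρ :=
    LinearMap.codRestrictOfInjective_comp_apply (M.coact ∘ₗ i.restrictScalars R) _ hiC hrange
  exact ⟨.ofInjective hi _ hρ, fun p => (hρ p).symm⟩

end Restrict

theorem exists_countable_coact_mem_range (m : M.carrier) :
    ∃ T : Set M.carrier, T.Countable ∧ m ∈ T ∧
      ∀ {P : Type u} [AddCommGroup P] [Module R P] (i : P →ₗ[R] M.carrier), T ⊆ Set.range i →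
        ∀ x ∈ T, M.coact x ∈ LinearMap.range (i.rTensor C) := by
  choose S hS using fun x => exists_finset_mem_range_rTensor (M.coact x)
  obtain ⟨T, hT, hm, hST⟩ :=
    exists_countable_mem_forall_subset (fun x => (S x).countable_toSet) m
  exact ⟨T, hT, hm, fun i hi x hx => hS x i ((hST x hx).trans hi)⟩

variable (D) in
/-- The Doi-Koppinen structures on the countably generated right `A`-modules, each of which is
presented as a quotient of `A^(ℕ)`. -/
abbrev CountablyGenerated : Type u :=
  Σ K : Submodule Aᵐᵒᵖ (ℕ →₀ Aᵐᵒᵖ), Coaction D (WithScalars R A ((ℕ →₀ Aᵐᵒᵖ) ⧸ K))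

section Flat

variable [Module.Flat R C]

theorem exists_countablyGenerated (m : M.carrier) :
    ∃ (G : CountablyGenerated D) (g : G.2.toDKModule ⟶ M), m ∈ LinearMap.range g.toLinearMap := by
  obtain ⟨T, hcountable, hm, hT⟩ := M.exists_countable_coact_mem_range m
  obtain ⟨s, rfl⟩ := hcountable.exists_eq_range ⟨m, hm⟩
  let l : (ℕ →₀ Aᵐᵒᵖ) →ₗ[Aᵐᵒᵖ] M.carrier := Finsupp.linearCombination Aᵐᵒᵖ s
  let e := WithScalars.equiv R A ((ℕ →₀ Aᵐᵒᵖ) ⧸ LinearMap.ker l)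
  let i : WithScalars R A ((ℕ →₀ Aᵐᵒᵖ) ⧸ LinearMap.ker l) →ₗ[Aᵐᵒᵖ] M.carrier :=
    (LinearMap.ker l).liftQ l le_rfl ∘ₗ e.symm.toLinearMap
  have hi : Function.Injective i :=
    (LinearMap.ker_eq_bot.1 (Submodule.ker_liftQ_eq_bot' _ l rfl)).comp e.symm.injective
  have hrange : LinearMap.range i = Submodule.span Aᵐᵒᵖ (Set.range s) := by
    rw [LinearEquiv.range_comp, Submodule.range_liftQ, Finsupp.range_linearCombination]
  have hs : Set.range s ⊆ LinearMap.range i := hrange ▸ Submodule.subset_span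
  obtain ⟨ρ, hρ⟩ := exists_coaction_of_injective hi fun p =>
    coact_mem_range_of_mem_span (hT (i.restrictScalars R) hs)
      (hrange ▸ LinearMap.mem_range_self i p)
  exact ⟨⟨_, ρ⟩, ⟨i, hρ⟩, hs hm⟩

instance : HasSeparator (DKModule D) where
  hasSeparator := by
    refine ⟨Limits.sigmaObj fun G : CountablyGenerated D => G.2.toDKModule,
      ObjectProperty.IsSeparating.isSeparator_coproduct fun X Y f g hfg => ?_⟩
    refine Hom.ext <| LinearMap.ext fun m => ?_
    obtain ⟨G, k, x, rfl⟩ := X.exists_countablyGenerated m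
    exact LinearMap.congr_fun (congrArg Hom.toLinearMap (hfg _ ⟨G⟩ k)) x

instance isGrothendieckAbelian : IsGrothendieckAbelian.{u} (DKModule D) where

end Flat

end DKModule

end Separator

end

theorem mainTheorem8_general {R H A C : Type u} [CommRing R] [Ring H] [Bialgebra R H]
    [Ring A] [Algebra R A] [AddCommGroup C] [Module R C] [Coalgebra R C]
    (D : DoiKoppinen R H A C) :
    (Module.Flat R C →
      ∃ _ : Abelian (DKModule D),
        IsGrothendieckAbelian.{u} (DKModule D) ∧ EnoughInjectives (DKModule D)) ∧
    (LocallyProjective R C → ∀ T : HSubalgebra D,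
      FiniteDense (T.toSubmodule : Set (Module.Dual R C)) →
        FiniteDense (Set.range (OpSmash.beta T).toLinearMap) ∧
        IsMeasuringPairing (OpSmash.kappa T).toLinearMap ∧
        AlphaCondition (OpSmash.kappa T).toLinearMap ∧
        (∃ h : ∀ M, AMod.sigma (DKCoring.opHomModule D) ((DKModule.toOpHom D).obj M),
          IsIsoOfCategories
            ((AMod.sigma (DKCoring.opHomModule D)).lift (DKModule.toOpHom D) h)) ∧
        (∃ h : ∀ N : (AMod.sigma (DKCoring.opHomModule D)).FullSubcategory,
            AMod.sigma (DKCoring.opSmashModule T) ((AMod.restrict (OpSmash.beta T)).obj N.obj),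
          IsIsoOfCategories
            ((AMod.sigma (DKCoring.opSmashModule T)).lift
              ((AMod.sigma (DKCoring.opHomModule D)).ι ⋙ AMod.restrict (OpSmash.beta T)) h))) ∧
    (Module.Finite R C → Module.Projective R C →
        (∃ h : ∀ M, AMod.unital R A (OpHom D) ((DKModule.toOpHom D).obj M),
          IsIsoOfCategories
            ((AMod.unital R A (OpHom D)).lift (DKModule.toOpHom D) h)) ∧
        (∃ h : ∀ N : (AMod.unital R A (OpHom D)).FullSubcategory,
            AMod.unital R A (OpSmash (HSubalgebra.whole D))
              ((AMod.restrict (OpSmash.beta (HSubalgebra.whole D))).obj N.obj),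
          IsIsoOfCategories
            ((AMod.unital R A (OpSmash (HSubalgebra.whole D))).lift
              ((AMod.unital R A (OpHom D)).ι ⋙
                AMod.restrict (OpSmash.beta (HSubalgebra.whole D))) h))) := by
  refine ⟨fun _ => ⟨DKModule.abelian, DKModule.isGrothendieckAbelian, inferInstance⟩,
    fun hC T hT => ?_, fun _ _ => ?_⟩
  · have hβ := OpSmash.finiteDense_beta T hC hT
    exact ⟨hβ, OpSmash.isMeasuringPairing_kappa hC hβ, OpSmash.alphaCondition_kappa hC hβ,
      ⟨DKModule.sigma_toOpHom, DKModule.isIso_toOpHom_sigma hC⟩,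
      ⟨DKModule.sigma_restrict hC hβ, DKModule.isIso_restrict_sigma hC hβ⟩⟩
  · have hβ := OpSmash.beta_whole_bijective (D := D)
    exact ⟨⟨DKModule.unital_toOpHom, DKModule.isIso_toOpHom_unital⟩,
      ⟨DKModule.unital_restrict hβ, DKModule.isIso_restrict_unital hβ⟩⟩

theorem mainTheorem8 {R H A C : Type u} [CommRing R] [Ring H] [Bialgebra R H]
    [Ring A] [Algebra R A] [AddCommGroup C] [Module R C] [Coalgebra R C]
    (D : DoiKoppinen R H A C) :
    (Module.Flat R C →
      ∃ _ : Abelian (DKModule D),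
        IsGrothendieckAbelian.{u} (DKModule D) ∧ EnoughInjectives (DKModule D)) ∧
    (LocallyProjective R C → ∀ T : HSubalgebra D,
      IsPureFor A T.toSubmodule → FiniteDense (T.toSubmodule : Set (Module.Dual R C)) →
        FiniteDense (Set.range (OpSmash.beta T).toLinearMap) ∧
        IsMeasuringPairing (OpSmash.kappa T).toLinearMap ∧
        AlphaCondition (OpSmash.kappa T).toLinearMap ∧
        (∃ h : ∀ M, AMod.sigma (DKCoring.opHomModule D) ((DKModule.toOpHom D).obj M),
          IsIsoOfCategories
            ((AMod.sigma (DKCoring.opHomModule D)).lift (DKModule.toOpHom D) h)) ∧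
        (∃ h : ∀ N : (AMod.sigma (DKCoring.opHomModule D)).FullSubcategory,
            AMod.sigma (DKCoring.opSmashModule T) ((AMod.restrict (OpSmash.beta T)).obj N.obj),
          IsIsoOfCategories
            ((AMod.sigma (DKCoring.opSmashModule T)).lift
              ((AMod.sigma (DKCoring.opHomModule D)).ι ⋙ AMod.restrict (OpSmash.beta T)) h))) ∧
    (Module.Finite R C → Module.Projective R C →
        (∃ h : ∀ M, AMod.unital R A (OpHom D) ((DKModule.toOpHom D).obj M),
          IsIsoOfCategories
            ((AMod.unital R A (OpHom D)).lift (DKModule.toOpHom D) h)) ∧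
        (∃ h : ∀ N : (AMod.unital R A (OpHom D)).FullSubcategory,
            AMod.unital R A (OpSmash (HSubalgebra.whole D))
              ((AMod.restrict (OpSmash.beta (HSubalgebra.whole D))).obj N.obj),
          IsIsoOfCategories
            ((AMod.unital R A (OpSmash (HSubalgebra.whole D))).lift
              ((AMod.unital R A (OpHom D)).ι ⋙
                AMod.restrict (OpSmash.beta (HSubalgebra.whole D))) h))) :=
  let ⟨hGrothendieck, hLocallyProjective, hFinite⟩ := mainTheorem8_general D
  ⟨hGrothendieck, fun hC T _ => hLocallyProjective hC T, hFinite⟩
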